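/- **Theorem (secrecy capacity region of the switch channel).** A discrete memoryless interference channel has finite input alphabets $\mathcal X_1,\mathcal X_2$, finite output alphabets $\mathcal Y_1,\mathcal Y_2$ and transition probabilities $P(y_1,y_2|x_1,x_2)$. For $n\ge 1$, a code consists of message sets $\{1,\dots,M_1\}$, $\{1,\dots,M_2\}$, stochastic encoders $f_t(\mathbf x_t|w_t)$, $\mathbf x_t\in\mathcal X_t^n$, and decoders $\psi_t:\mathcal Y_t^n\to\{1,\dots,M_t\}$, $t=1,2$. The messages $W_1,W_2$ are independent and uniform, and $P_{e,t}=\Pr[\psi_t(\mathbf Y_t)\ne W_t]$. A pair $(R_1,R_2)$ with $R_1,R_2\ge 0$ is achievable (with confidential messages) if for every $\epsilon>0$ there are $n\ge1$ and a code of length $n$ with $$M_t\ge 2^{nR_t}\ (t=1,2),\qquad \max\{P_{e,1},P_{e,2}\}\le\epsilon,\qquad nR_1-H(W_1|\mathbf Y_2)\le n\epsilon,\qquad nR_2-H(W_2|\mathbf Y_1)\le n\epsilon ,$$ entropies being in bits. The secrecy capacity region is the closure of the set of achievable pairs. The channel is a switch channel if there are finite sets $\mathcal Z_1,\mathcal Z_2$,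 numbers $\tau_1,\tau_2\in[0,1]$ and channels $P_{t,k}(z|x_k)$ from $\mathcal X_k$ to $\mathcal Z_t$ ($t,k\in\{1,2\}$) such that $y_t=(z_t,s_t)\in\mathcal Z_t\times\{1,2\}$ and, for $t=1,2$, $$P(z_t,s_t|x_1,x_2)=P(s_t)\,P_{t,s_t}(z_t|x_{s_t}),\qquad P(s_t=t)=\tau_t,\quad P(s_t\neq t)=1-\tau_t .$$ That is, at each time receiver $t$ observes one transmitter through a noisy link, chosen by an i.i.d. random switch whose state it knows. For every switch channel the secrecy capacity region equals the inner-bound region $\mathcal R_{\rm I}$, the union of all $(R_1,R_2)$ satisfying $$0\le R_1\le I(V_1;Y_1|U)-I(V_1;Y_2|V_2,U),\qquad 0\le R_2\le I(V_2;Y_2|U)-I(V_2;Y_1|V_1,U)$$ over all finite alphabets for the auxiliary variables $U,V_1,V_2$ and all distributions of the form $$P(u)P(v_1|u)P(v_2|u)P(x_1|v_1)P(x_2|v_2)P(y_1,y_2|x_1,x_2).$$ Moreover the outer and inner bounds meet: $\mathcal R_{\rm I}$ equals the outer-bound region, the union of all $(R_1,R_2)$ satisfying $$0\le R_1\le\min\{I(V_1;Y_1|U)-I(V_1;Y_2|U),\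 I(V_1;Y_1|V_2,U)-I(V_1;Y_2|V_2,U)\},$$ $$0\le R_2\le\min\{I(V_2;Y_2|U)-I(V_2;Y_1|U),\ I(V_2;Y_2|V_1,U)-I(V_2;Y_1|V_1,U)\}$$ over all finite alphabets for $U,V_1,V_2$ and all distributions of the form $P(u)P(v_1,v_2|u)P(x_1|v_1)P(x_2|v_2)P(y_1,y_2|x_1,x_2)$. -/

import Mathlib

open scoped BigOperators

noncomputable section

/-! ### Finite random variables: laws, entropy and mutual information (in bits)

A law on a finite sample space `Ω` is a real vector `q : Ω → ℝ` in `stdSimplex ℝ Ω`; a finite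
random variable is a function on `Ω`. -/

open Classical in
/-- The probability `P(A = a)` of a random variable `A` on the finite space `(Ω, q)`. -/
def law {Ω α : Type*} [Fintype Ω] (q : Ω → ℝ) (A : Ω → α) (a : α) : ℝ :=
  ∑ ω, if A ω = a then q ω else 0

/-- Conditional entropy `H(A|B) = - ∑ P(a,b) log₂ P(a|b)`. -/
def condEntropy {Ω α β : Type*} [Fintype Ω] [Fintype α] [Fintype β]
    (q : Ω → ℝ) (A : Ω → α) (B : Ω → β) : ℝ :=
  - ∑ a, ∑ b, law q (fun ω => (A ω, B ω)) (a, b) *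
      Real.logb 2 (law q (fun ω => (A ω, B ω)) (a, b) / law q B b)

/-- Conditional mutual information `I(A;B|C) = H(A|C) - H(A|B,C)`. -/
def condMutualInfo {Ω α β γ : Type*} [Fintype Ω] [Fintype α] [Fintype β] [Fintype γ]
    (q : Ω → ℝ) (A : Ω → α) (B : Ω → β) (C : Ω → γ) : ℝ :=
  condEntropy q A C - condEntropy q A (fun ω => (B ω, C ω))

/-- `k` is a stochastic matrix `k(b|a)`. -/
def IsStochastic {α β : Type*} [Fintype β] (k : α → β → ℝ) : Prop :=
  ∀ a, k a ∈ stdSimplex ℝ β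

/-! ### Discrete memoryless interference channels with confidential messages -/

/-- A two-user interference channel with finite alphabets: `prob x₁ x₂ (y₁, y₂)` is the transition
probability `P(y₁,y₂|x₁,x₂)`. -/
structure InterferenceChannel (X₁ X₂ Y₁ Y₂ : Type*) [Fintype Y₁] [Fintype Y₂] where
  prob : X₁ → X₂ → Y₁ × Y₂ → ℝ
  prob_mem : ∀ x₁ x₂, prob x₁ x₂ ∈ stdSimplex ℝ (Y₁ × Y₂)

/-- A code of block length `n` with `M₁`, `M₂` messages: two stochastic encoders
`enc (message) (input sequence)` without common randomness, and two deterministic decoders. -/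
structure Code (X₁ X₂ Y₁ Y₂ : Type*) [Fintype X₁] [Fintype X₂] (M₁ M₂ n : ℕ) where
  enc₁ : Fin M₁ → (Fin n → X₁) → ℝ
  enc₂ : Fin M₂ → (Fin n → X₂) → ℝ
  enc₁_stochastic : IsStochastic enc₁
  enc₂_stochastic : IsStochastic enc₂
  dec₁ : (Fin n → Y₁) → Fin M₁
  dec₂ : (Fin n → Y₂) → Fin M₂

namespace Code

variable {X₁ X₂ Y₁ Y₂ : Type*} [Fintype X₁] [Fintype X₂] [Fintype Y₁] [Fintype Y₂]
  {M₁ M₂ n : ℕ}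

/-- The probability that the output sequences are `(y₁, y₂)` when the messages `(w₁, w₂)` are
sent over `n` memoryless uses of the channel. -/
def outputProb (c : Code X₁ X₂ Y₁ Y₂ M₁ M₂ n) (P : InterferenceChannel X₁ X₂ Y₁ Y₂)
    (w₁ : Fin M₁) (w₂ : Fin M₂) (y₁ : Fin n → Y₁) (y₂ : Fin n → Y₂) : ℝ :=
  ∑ x₁ : Fin n → X₁, ∑ x₂ : Fin n → X₂,
    c.enc₁ w₁ x₁ * c.enc₂ w₂ x₂ * ∏ i, P.prob (x₁ i) (x₂ i) (y₁ i, y₂ i)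

/-- The joint law of `(W₁, W₂, Y₁ⁿ, Y₂ⁿ)`, the messages being independent and uniform. -/
def jointLaw (c : Code X₁ X₂ Y₁ Y₂ M₁ M₂ n) (P : InterferenceChannel X₁ X₂ Y₁ Y₂) :
    Fin M₁ × Fin M₂ × (Fin n → Y₁) × (Fin n → Y₂) → ℝ :=
  fun ω => 1 / ((M₁ : ℝ) * (M₂ : ℝ)) * c.outputProb P ω.1 ω.2.1 ω.2.2.1 ω.2.2.2

/-- Average error probability of receiver 1. -/
def errorProb₁ (c : Code X₁ X₂ Y₁ Y₂ M₁ M₂ n) (P : InterferenceChannel X₁ X₂ Y₁ Y₂) : ℝ :=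
  ∑ w₁, ∑ w₂, 1 / ((M₁ : ℝ) * (M₂ : ℝ)) *
    ∑ y₁, ∑ y₂, if c.dec₁ y₁ ≠ w₁ then c.outputProb P w₁ w₂ y₁ y₂ else 0

/-- Average error probability of receiver 2. -/
def errorProb₂ (c : Code X₁ X₂ Y₁ Y₂ M₁ M₂ n) (P : InterferenceChannel X₁ X₂ Y₁ Y₂) : ℝ :=
  ∑ w₁, ∑ w₂, 1 / ((M₁ : ℝ) * (M₂ : ℝ)) *
    ∑ y₁, ∑ y₂, if c.dec₂ y₂ ≠ w₂ then c.outputProb P w₁ w₂ y₁ y₂ else 0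

/-- The equivocation `H(W₁|Y₂ⁿ)` of message 1 at receiver 2. -/
def equivocation₁ (c : Code X₁ X₂ Y₁ Y₂ M₁ M₂ n) (P : InterferenceChannel X₁ X₂ Y₁ Y₂) : ℝ :=
  condEntropy (c.jointLaw P) (fun ω => ω.1) (fun ω => ω.2.2.2)

/-- The equivocation `H(W₂|Y₁ⁿ)` of message 2 at receiver 1. -/
def equivocation₂ (c : Code X₁ X₂ Y₁ Y₂ M₁ M₂ n) (P : InterferenceChannel X₁ X₂ Y₁ Y₂) : ℝ :=
  condEntropy (c.jointLaw P) (fun ω => ω.2.1) (fun ω => ω.2.2.1)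

end Code

namespace InterferenceChannel

variable {X₁ X₂ Y₁ Y₂ : Type*} [Fintype X₁] [Fintype X₂] [Fintype Y₁] [Fintype Y₂]

/-- Achievability of the pair of nonnegative rates `R = (R₁, R₂)` with confidential messages. -/
def Achievable (P : InterferenceChannel X₁ X₂ Y₁ Y₂) (R : ℝ × ℝ) : Prop :=
  0 ≤ R.1 ∧ 0 ≤ R.2 ∧
  ∀ ε : ℝ, 0 < ε → ∃ (n M₁ M₂ : ℕ) (c : Code X₁ X₂ Y₁ Y₂ M₁ M₂ n), 1 ≤ n ∧
    (2 : ℝ) ^ ((n : ℝ) * R.1) ≤ (M₁ : ℝ) ∧ (2 : ℝ) ^ ((n : ℝ) * R.2) ≤ (M₂ : ℝ) ∧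
    max (c.errorProb₁ P) (c.errorProb₂ P) ≤ ε ∧
    (n : ℝ) * R.1 - c.equivocation₁ P ≤ (n : ℝ) * ε ∧
    (n : ℝ) * R.2 - c.equivocation₂ P ≤ (n : ℝ) * ε

/-- The secrecy capacity region: the closure of the set of achievable rate pairs. -/
def capacityRegion (P : InterferenceChannel X₁ X₂ Y₁ Y₂) : Set (ℝ × ℝ) :=
  closure {R | P.Achievable R}

/-- `q(u,v₁,v₂,x₁,x₂,y₁,y₂)` factors as
`P(u) P(v₁,v₂|u) P(x₁|v₁) P(x₂|v₂) P(y₁,y₂|x₁,x₂)`. -/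
def OuterClass (P : InterferenceChannel X₁ X₂ Y₁ Y₂) {U V₁ V₂ : Type*}
    [Fintype U] [Fintype V₁] [Fintype V₂] (q : U × V₁ × V₂ × X₁ × X₂ × Y₁ × Y₂ → ℝ) : Prop :=
  ∃ (pU : U → ℝ) (kV : U → V₁ × V₂ → ℝ) (k₁ : V₁ → X₁ → ℝ) (k₂ : V₂ → X₂ → ℝ),
    pU ∈ stdSimplex ℝ U ∧ IsStochastic kV ∧ IsStochastic k₁ ∧ IsStochastic k₂ ∧
    ∀ u v₁ v₂ x₁ x₂ y₁ y₂, q (u, v₁, v₂, x₁, x₂, y₁, y₂) =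
      pU u * kV u (v₁, v₂) * k₁ v₁ x₁ * k₂ v₂ x₂ * P.prob x₁ x₂ (y₁, y₂)

/-- `q(u,v₁,v₂,x₁,x₂,y₁,y₂)` factors as
`P(u) P(v₁|u) P(v₂|u) P(x₁|v₁) P(x₂|v₂) P(y₁,y₂|x₁,x₂)`. -/
def InnerClass (P : InterferenceChannel X₁ X₂ Y₁ Y₂) {U V₁ V₂ : Type*}
    [Fintype U] [Fintype V₁] [Fintype V₂] (q : U × V₁ × V₂ × X₁ × X₂ × Y₁ × Y₂ → ℝ) : Prop :=
  ∃ (pU : U → ℝ) (kV₁ : U → V₁ → ℝ) (kV₂ : U → V₂ → ℝ) (k₁ : V₁ → X₁ → ℝ) (k₂ : V₂ → X₂ → ℝ),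
    pU ∈ stdSimplex ℝ U ∧ IsStochastic kV₁ ∧ IsStochastic kV₂ ∧
    IsStochastic k₁ ∧ IsStochastic k₂ ∧
    ∀ u v₁ v₂ x₁ x₂ y₁ y₂, q (u, v₁, v₂, x₁, x₂, y₁, y₂) =
      pU u * kV₁ u v₁ * kV₂ u v₂ * k₁ v₁ x₁ * k₂ v₂ x₂ * P.prob x₁ x₂ (y₁, y₂)

section Coordinates

variable {U V₁ V₂ X₁ X₂ Y₁ Y₂ : Type*}

/-! The coordinate random variables on the sample space of `(U,V₁,V₂,X₁,X₂,Y₁,Y₂)`. -/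

def rvU (ω : U × V₁ × V₂ × X₁ × X₂ × Y₁ × Y₂) : U := ω.1
def rvV₁ (ω : U × V₁ × V₂ × X₁ × X₂ × Y₁ × Y₂) : V₁ := ω.2.1
def rvV₂ (ω : U × V₁ × V₂ × X₁ × X₂ × Y₁ × Y₂) : V₂ := ω.2.2.1
def rvY₁ (ω : U × V₁ × V₂ × X₁ × X₂ × Y₁ × Y₂) : Y₁ := ω.2.2.2.2.2.1
def rvY₂ (ω : U × V₁ × V₂ × X₁ × X₂ × Y₁ × Y₂) : Y₂ := ω.2.2.2.2.2.2

end Coordinates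

/-- The inner-bound region: union over all finite auxiliary alphabets and all distributions in
`InnerClass`. -/
def innerRegion (P : InterferenceChannel X₁ X₂ Y₁ Y₂) : Set (ℝ × ℝ) :=
  {R | ∃ (a b c : ℕ) (q : Fin a × Fin b × Fin c × X₁ × X₂ × Y₁ × Y₂ → ℝ), P.InnerClass q ∧
    0 ≤ R.1 ∧
    R.1 ≤ condMutualInfo q rvV₁ rvY₁ rvU
      - condMutualInfo q rvV₁ rvY₂ (fun ω => (rvV₂ ω, rvU ω)) ∧
    0 ≤ R.2 ∧
    R.2 ≤ condMutualInfo q rvV₂ rvY₂ rvU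
      - condMutualInfo q rvV₂ rvY₁ (fun ω => (rvV₁ ω, rvU ω))}

/-- The outer-bound region: union over all finite auxiliary alphabets and all distributions in
`OuterClass`. -/
def outerRegion (P : InterferenceChannel X₁ X₂ Y₁ Y₂) : Set (ℝ × ℝ) :=
  {R | ∃ (a b c : ℕ) (q : Fin a × Fin b × Fin c × X₁ × X₂ × Y₁ × Y₂ → ℝ), P.OuterClass q ∧
    0 ≤ R.1 ∧
    R.1 ≤ min
      (condMutualInfo q rvV₁ rvY₁ rvU - condMutualInfo q rvV₁ rvY₂ rvU)
      (condMutualInfo q rvV₁ rvY₁ (fun ω => (rvV₂ ω, rvU ω))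
        - condMutualInfo q rvV₁ rvY₂ (fun ω => (rvV₂ ω, rvU ω))) ∧
    0 ≤ R.2 ∧
    R.2 ≤ min
      (condMutualInfo q rvV₂ rvY₂ rvU - condMutualInfo q rvV₂ rvY₁ rvU)
      (condMutualInfo q rvV₂ rvY₂ (fun ω => (rvV₁ ω, rvU ω))
        - condMutualInfo q rvV₂ rvY₁ (fun ω => (rvV₁ ω, rvU ω)))}

end InterferenceChannel

/-! ### The switch channel -/

/-- A switch channel. The output of receiver `t` is `(z, s)`: the received signal `z` and the switch
state `s`, where `s = 0` means that the receiver listens to transmitter 1 and `s = 1` that it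
listens to transmitter 2. Receiver `t` listens to its own transmitter with probability `τₜ`,
whatever the inputs are, and `link t k` is the channel from transmitter `k` to receiver `t` that is
in force when the switch of receiver `t` selects transmitter `k`. The two observations given the
inputs may be arbitrarily dependent on each other. -/
structure SwitchChannel (X₁ X₂ Z₁ Z₂ : Type*) [Fintype Z₁] [Fintype Z₂] extends
    InterferenceChannel X₁ X₂ (Z₁ × Fin 2) (Z₂ × Fin 2) where
  τ₁ : ℝ
  τ₂ : ℝ
  τ₁_mem : τ₁ ∈ Set.Icc (0 : ℝ) 1
  τ₂_mem : τ₂ ∈ Set.Icc (0 : ℝ) 1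
  link₁₁ : X₁ → Z₁ → ℝ
  link₁₂ : X₂ → Z₁ → ℝ
  link₂₁ : X₁ → Z₂ → ℝ
  link₂₂ : X₂ → Z₂ → ℝ
  link₁₁_stochastic : IsStochastic link₁₁
  link₁₂_stochastic : IsStochastic link₁₂
  link₂₁_stochastic : IsStochastic link₂₁
  link₂₂_stochastic : IsStochastic link₂₂
  output₁ : ∀ x₁ x₂ z s, ∑ y₂, prob x₁ x₂ ((z, s), y₂) =
    if s = 0 then τ₁ * link₁₁ x₁ z else (1 - τ₁) * link₁₂ x₂ z
  output₂ : ∀ x₁ x₂ z s, ∑ y₁, prob x₁ x₂ (y₁, (z, s)) =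
    if s = 0 then (1 - τ₂) * link₂₁ x₁ z else τ₂ * link₂₂ x₂ z

end

/-! A receiver knows its switch state. Relative to a fixed transmitter its output therefore splits
into that transmitter's link followed by an erasure (the switch pointing elsewhere) and a remainder
whose law, given the first part, depends on the other input only: `Observes`,
`observes_erasedKernel`. When the other input is conditionally independent of the message, the
remainder carries no information (`massInfo_split`). Interference disappears and the channel
decouples into two wiretap channels: `K₁₁` against the eavesdropper `K₂₁` for user 1, and `K₂₂`
against `K₁₂` for user 2.

Let `C₁`, `C₂` be the maxima of `I(V;O) - I(V;O')` for these two wiretap channels over all prefixes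
`V → X`. Each of the three regions is the rectangle with sides `C₁`, `C₂` (converted to bits). The
maxima are attained (`exists_isGapBound_secrecyGap`), because the gap is the height of a continuous
function above a point of the compact convex hull of its graph; so the inner region contains the
closed rectangle. The outer region lies in the rectangle because the gap bound is linear in mass and
so survives conditioning.

For the converse, the gap of a product of channels is at most the sum of the gaps
(`IsGapBound.prodKernel`, replacing one factor at a time as in Csiszár's sum identity), and Fano's
inequality turns reliability into small equivocation at the own receiver (`rate_le_of_isGapBound`).
For achievability, each user draws a random codebook with `L` codewords per message
(`exists_codebook`). Decoding error and leakage are both bounded by expected logarithms, which `log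
(1 + x) ≤ x ^ s / s` turns into moments that are powers over the block and decay exponentially.
Since such codes exist at all large block lengths, the two users can share one.

If an input alphabet is empty, all three regions are empty. -/

/-! ### Entropy of unnormalised mass functions -/

/-- The entropy (in nats) of a finite mass function, homogeneous of degree one. -/
noncomputable def massEntropy {α : Type*} [Fintype α] (m : α → ℝ) : ℝ :=
  ∑ a, Real.negMulLog (m a) - Real.negMulLog (∑ a, m a)

/-- The mutual information (in nats) of a finite joint mass function. -/
noncomputable def massInfo {α β : Type*} [Fintype α] [Fintype β] (m : α → β → ℝ) : ℝ :=
  massEntropy (fun b => ∑ a, m a b) - ∑ a, massEntropy (m a)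

/-- The output mass function of the kernel `K` for the input mass function `μ`. -/
def pushMass {X Y : Type*} [Fintype X] (μ : X → ℝ) (K : X → Y → ℝ) (y : Y) : ℝ :=
  ∑ x, μ x * K x y

section Entropy

variable {α β γ : Type*} [Fintype α] [Fintype β] [Fintype γ]

/-- Homogeneity makes a conditional entropy a plain sum over unnormalised slices: no division by the
mass of a slice, hence no case of zero mass. -/
theorem massEntropy_const_mul (c : ℝ) (m : α → ℝ) :
    massEntropy (fun a => c * m a) = c * massEntropy m := by
  simp only [massEntropy, ← Finset.mul_sum, Real.negMulLog_mul, Finset.sum_add_distrib,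
    ← Finset.sum_mul]
  ring

theorem massEntropy_mul_const (c : ℝ) (m : α → ℝ) :
    massEntropy (fun a => m a * c) = c * massEntropy m := by
  simp only [mul_comm _ c, massEntropy_const_mul]

theorem massEntropy_prod (m : α × β → ℝ) :
    massEntropy m = massEntropy (fun b => ∑ a, m (a, b)) + ∑ b, massEntropy (fun a => m (a, b)) := by
  simp only [massEntropy, Finset.sum_sub_distrib, Fintype.sum_prod_type_right]
  ring

theorem massEntropy_equiv (e : α ≃ β) (m : β → ℝ) :
    massEntropy (fun a => m (e a)) = massEntropy m := by
  simp only [massEntropy, Equiv.sum_comp e m, Equiv.sum_comp e (fun b => Real.negMulLog (m b))]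

theorem massEntropy_unique [Unique α] (m : α → ℝ) : massEntropy m = 0 := by
  simp [massEntropy]

theorem massInfo_eq_sub_sum (m : α → β → ℝ) :
    massInfo m = massEntropy (fun a => ∑ b, m a b) - ∑ b, massEntropy (fun a => m a b) := by
  simp only [massInfo, massEntropy, Finset.sum_sub_distrib]
  rw [Finset.sum_comm (f := fun a b => m a b),
    Finset.sum_comm (f := fun a b => Real.negMulLog (m a b))]
  ring

theorem massInfo_const_mul (c : ℝ) (m : α → β → ℝ) :
    massInfo (fun a b => c * m a b) = c * massInfo m := by
  simp only [massInfo, ← Finset.mul_sum, massEntropy_const_mul]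
  ring

/-- Chain rule `I(A;B,C) = I(A;C) + I(A;B|C)`. The slices over `c` are unnormalised, so their sum is
already the conditional information. -/
theorem massInfo_prod (m : α → β × γ → ℝ) :
    massInfo m = massInfo (fun a c => ∑ b, m a (b, c)) + ∑ c, massInfo (fun a b => m a (b, c)) := by
  simp only [massInfo]
  rw [massEntropy_prod]
  simp only [fun a => massEntropy_prod (m a), Finset.sum_add_distrib, Finset.sum_sub_distrib]
  rw [Finset.sum_comm (f := fun a c => massEntropy fun b => m a (b, c))]
  simp only [Finset.sum_comm (f := fun (a : α) (b : β) => m a (b, _))]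
  ring

theorem massInfo_prod' (m : α → β × γ → ℝ) :
    massInfo m = massInfo (fun a b => ∑ c, m a (b, c)) + ∑ b, massInfo (fun a c => m a (b, c)) := by
  have h : massInfo m = massInfo (fun a (p : γ × β) => m a (p.2, p.1)) := by
    simp only [massInfo]
    congr 1
    · exact (massEntropy_equiv (Equiv.prodComm γ β) (fun p => ∑ a, m a p)).symm
    · exact Finset.sum_congr rfl fun a _ => (massEntropy_equiv (Equiv.prodComm γ β) (m a)).symm
  rw [h, massInfo_prod]

theorem massInfo_equiv {β' : Type*} [Fintype β'] (e : β' ≃ β) (m : α → β → ℝ) :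
    massInfo (fun a b => m a (e b)) = massInfo m := by
  simp only [massInfo]
  rw [massEntropy_equiv e (fun b => ∑ a, m a b)]
  simp only [fun a => massEntropy_equiv e (m a)]

-- The weights `b` form a unit mass on each fibre of `e`: given `e y`, the rest of `y` is
-- independent noise.
open Classical in
theorem sum_comp_mul_of_fiber {e : β → γ} {b : β → ℝ}
    (hb : ∀ c, ∑ y, (if e y = c then b y else 0) = 1) (f : γ → ℝ) :
    ∑ y, f (e y) * b y = ∑ c, f c := by
  have h : ∀ y, f (e y) * b y = ∑ c, f c * (if e y = c then b y else 0) := by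
    intro y
    simp
  simp only [h]
  rw [Finset.sum_comm]
  exact Finset.sum_congr rfl fun c _ => by rw [← Finset.mul_sum, hb, mul_one]

open Classical in
theorem sum_massEntropy_split {e : β → γ} {b : β → ℝ}
    (hb : ∀ c, ∑ y, (if e y = c then b y else 0) = 1) (m : α → γ → ℝ) :
    ∑ y, massEntropy (fun a => m a (e y) * b y) = ∑ c, massEntropy (fun a => m a c) := by
  simp only [massEntropy_mul_const]
  simp only [mul_comm (b _)]
  exact sum_comp_mul_of_fiber hb (fun c => massEntropy (fun a => m a c))

open Classical in
/-- A received component that depends on the message only through `e y` carries no more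
information than `e y`. -/
theorem massInfo_split {e : β → γ} {b : β → ℝ}
    (hb : ∀ c, ∑ y, (if e y = c then b y else 0) = 1) (m : α → γ → ℝ) :
    massInfo (fun a y => m a (e y) * b y) = massInfo m := by
  rw [massInfo_eq_sub_sum, massInfo_eq_sub_sum, sum_massEntropy_split hb]
  congr 2
  ext a
  exact sum_comp_mul_of_fiber hb (m a)

end Entropy

/-! ### Laws and entropies of finite random variables -/

section Laws

variable {Ω α β γ : Type*} [Fintype Ω] [Fintype α] [Fintype β] [Fintype γ]

theorem law_nonneg {Ω α : Type*} [Fintype Ω] {q : Ω → ℝ} (hq : ∀ ω, 0 ≤ q ω) (A : Ω → α) (a : α) :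
    0 ≤ law q A a := by
  classical
  exact Finset.sum_nonneg fun ω _ => by split_ifs <;> simp [hq]

theorem sum_law_prod_left {Ω α β : Type*} [Fintype Ω] [Fintype α] (q : Ω → ℝ) (A : Ω → α) (B : Ω → β) (b : β) :
    ∑ a, law q (fun ω => (A ω, B ω)) (a, b) = law q B b := by
  classical
  simp only [law, Prod.mk.injEq]
  rw [Finset.sum_comm]
  refine Finset.sum_congr rfl fun ω _ => ?_
  simp [ite_and]

theorem condEntropy_eq_sum_massEntropy {q : Ω → ℝ} (hq : ∀ ω, 0 ≤ q ω) (A : Ω → α) (B : Ω → β) :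
    condEntropy q A B =
      (∑ b, massEntropy (fun a => law q (fun ω => (A ω, B ω)) (a, b))) / Real.log 2 := by
  have key : ∀ b, ∑ a, law q (fun ω => (A ω, B ω)) (a, b) *
      Real.logb 2 (law q (fun ω => (A ω, B ω)) (a, b) / law q B b) =
      - massEntropy (fun a => law q (fun ω => (A ω, B ω)) (a, b)) / Real.log 2 := by
    intro b
    have hs := sum_law_prod_left q A B b
    have h0 : ∀ a, 0 ≤ law q (fun ω => (A ω, B ω)) (a, b) := fun a => law_nonneg hq _ _
    have : ∀ a, law q (fun ω => (A ω, B ω)) (a, b) *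
        Real.logb 2 (law q (fun ω => (A ω, B ω)) (a, b) / law q B b) =
        (- Real.negMulLog (law q (fun ω => (A ω, B ω)) (a, b))
          - law q (fun ω => (A ω, B ω)) (a, b) * Real.log (law q B b)) / Real.log 2 := by
      intro a
      rcases (h0 a).eq_or_lt with h | h
      · simp [← h]
      · have hb : 0 < law q B b := by
          rw [← hs]
          exact h.trans_le (Finset.single_le_sum (fun a _ => h0 a) (Finset.mem_univ a))
        rw [Real.logb, Real.log_div h.ne' hb.ne', Real.negMulLog]
        ring
    simp only [this]
    rw [← Finset.sum_div, Finset.sum_sub_distrib, Finset.sum_neg_distrib, ← Finset.sum_mul, hs]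
    congr 1
    rw [massEntropy, hs, Real.negMulLog]
    ring
  rw [condEntropy, Finset.sum_comm]
  simp only [key]
  rw [← Finset.sum_div, Finset.sum_neg_distrib]
  ring

theorem condMutualInfo_eq_sum_massInfo {q : Ω → ℝ} (hq : ∀ ω, 0 ≤ q ω)
    (A : Ω → α) (B : Ω → β) (C : Ω → γ) :
    condMutualInfo q A B C =
      (∑ c, massInfo (fun a b => law q (fun ω => (A ω, B ω, C ω)) (a, b, c))) / Real.log 2 := by
  rw [condMutualInfo, condEntropy_eq_sum_massEntropy hq, condEntropy_eq_sum_massEntropy hq,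
    ← sub_div]
  simp only [massInfo_eq_sub_sum, Finset.sum_sub_distrib]
  congr 2
  · refine Finset.sum_congr rfl fun c _ => ?_
    congr 1
    ext a
    classical
    simp only [law, Prod.mk.injEq]
    rw [Finset.sum_comm]
    refine Finset.sum_congr rfl fun ω _ => ?_
    simp only [ite_and]
    simp
  · rw [Fintype.sum_prod_type_right]

end Laws

/-! ### The optimum of the single-letter secrecy gap -/

/-- In a finite-dimensional space the convex hull of a compact set is compact. -/
theorem isCompact_convexHull_of_finiteDimensional {E : Type*} [NormedAddCommGroup E]
    [NormedSpace ℝ E] [FiniteDimensional ℝ E] {s : Set E} (hs : IsCompact s) :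
    IsCompact (convexHull ℝ s) := by
  classical
  -- Carathéodory: `finrank + 1` points suffice, so one fixed index set serves for every point of
  -- the hull.
  set k := Module.finrank ℝ E + 1 with hk
  rcases s.eq_empty_or_nonempty with rfl | ⟨z₀, hz₀⟩
  · simp
  have himg : convexHull ℝ s =
      (fun p : (Fin k → ℝ) × (Fin k → E) => ∑ i, p.1 i • p.2 i) ''
        (stdSimplex ℝ (Fin k) ×ˢ Set.univ.pi fun _ => s) := by
    ext x
    constructor
    · intro hx
      obtain ⟨ι, _, z, w, hz, hind, hw, hw1, rfl⟩ := eq_pos_convex_span_of_mem_convexHull hx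
      have hcard : Fintype.card ι ≤ Fintype.card (Fin k) := by
        rw [Fintype.card_fin, hk]
        exact hind.card_le_finrank_succ.trans
          (Nat.add_le_add_right (Submodule.finrank_le _) 1)
      obtain ⟨f⟩ := Function.Embedding.nonempty_of_card_le hcard
      -- Unused indices get weight zero and the arbitrary point `z₀` of `s`.
      refine ⟨(Function.extend f w 0, Function.extend f z fun _ => z₀), ⟨⟨?_, ?_⟩, ?_⟩, ?_⟩
      · intro j
        by_cases hj : ∃ i, f i = j
        · obtain ⟨i, rfl⟩ := hj
          simpa [f.injective.extend_apply] using (hw i).le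
        · simp [Function.extend_apply' _ _ _ hj]
      · rw [← hw1]
        exact (Fintype.sum_of_injective f f.injective _ _
          (fun j hj => by simp [Function.extend_apply' _ _ _ hj])
          fun i => (f.injective.extend_apply _ _ _).symm).symm
      · intro j _
        by_cases hj : ∃ i, f i = j
        · obtain ⟨i, rfl⟩ := hj
          simpa [f.injective.extend_apply] using hz ⟨i, rfl⟩
        · simpa [Function.extend_apply' _ _ _ hj] using hz₀
      · refine (Fintype.sum_of_injective f f.injective _ _ (fun j hj => ?_) fun i => ?_).symm
        · simp [Function.extend_apply' _ _ _ hj]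
        · simp only [f.injective.extend_apply]
    · rintro ⟨⟨w, z⟩, ⟨⟨hw0, hw1⟩, hz⟩, rfl⟩
      exact (convex_convexHull ℝ s).sum_mem (fun i _ => hw0 i) hw1
        fun i _ => subset_convexHull ℝ s (hz i trivial)
  rw [himg]
  refine ((isCompact_stdSimplex ℝ (Fin k)).prod (isCompact_univ_pi fun _ => hs)).image ?_
  fun_prop

section SecrecyGap

variable {V X Y₁ Y₂ : Type*} [Fintype V] [Fintype X] [Fintype Y₁] [Fintype Y₂]

/-- The information gap `I(V;Y₁) - I(V;Y₂)` (in nats) for the joint mass function `μ` of `(V,X)` and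
the channels `K₁`, `K₂` from `X` to `Y₁`, `Y₂`. -/
noncomputable def secrecyGap (K₁ : X → Y₁ → ℝ) (K₂ : X → Y₂ → ℝ) (μ : V → X → ℝ) : ℝ :=
  massInfo (fun v => pushMass (μ v) K₁) - massInfo (fun v => pushMass (μ v) K₂)

/-- `C` bounds the information gap per unit of mass, for all finite auxiliary alphabets. -/
def IsGapBound (K₁ : X → Y₁ → ℝ) (K₂ : X → Y₂ → ℝ) (C : ℝ) : Prop :=
  ∀ (V : Type) [Fintype V] (μ : V → X → ℝ), (∀ v x, 0 ≤ μ v x) →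
    secrecyGap K₁ K₂ μ ≤ C * ∑ v, ∑ x, μ v x

/-- The difference of the two output entropies for the input mass function `ρ`. -/
noncomputable def entropyGap (K₁ : X → Y₁ → ℝ) (K₂ : X → Y₂ → ℝ) (ρ : X → ℝ) : ℝ :=
  massEntropy (pushMass ρ K₁) - massEntropy (pushMass ρ K₂)

theorem pushMass_const_mul {X Y : Type*} [Fintype X] (c : ℝ) (μ : X → ℝ) (K : X → Y → ℝ) :
    pushMass (fun x => c * μ x) K = fun y => c * pushMass μ K y := by
  ext y
  simp only [pushMass, Finset.mul_sum, mul_assoc]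

theorem sum_pushMass {V X Y : Type*} [Fintype V] [Fintype X] (μ : V → X → ℝ) (K : X → Y → ℝ)
    (y : Y) : ∑ v, pushMass (μ v) K y = pushMass (fun x => ∑ v, μ v x) K y := by
  simp only [pushMass, Finset.sum_mul]
  exact Finset.sum_comm

theorem entropyGap_const_mul (K₁ : X → Y₁ → ℝ) (K₂ : X → Y₂ → ℝ) (c : ℝ) (ρ : X → ℝ) :
    entropyGap K₁ K₂ (fun x => c * ρ x) = c * entropyGap K₁ K₂ ρ := by
  simp only [entropyGap, pushMass_const_mul, massEntropy_const_mul, mul_sub]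

theorem continuous_entropyGap (K₁ : X → Y₁ → ℝ) (K₂ : X → Y₂ → ℝ) :
    Continuous (entropyGap K₁ K₂) := by
  unfold entropyGap massEntropy pushMass
  fun_prop

/-- The gap depends only on the barycentre of the input laws and on the average of `entropyGap` over
them. Maximising it is thus a problem about the convex hull of the graph of `entropyGap`. -/
theorem secrecyGap_eq (K₁ : X → Y₁ → ℝ) (K₂ : X → Y₂ → ℝ) (μ : V → X → ℝ) :
    secrecyGap K₁ K₂ μ =
      entropyGap K₁ K₂ (fun x => ∑ v, μ v x) - ∑ v, entropyGap K₁ K₂ (μ v) := by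
  simp only [secrecyGap, massInfo, entropyGap, Finset.sum_sub_distrib, sum_pushMass]
  ring

theorem exists_smul_stdSimplex [Nonempty X] {μ : X → ℝ} (hμ : ∀ x, 0 ≤ μ x) :
    ∃ ρ ∈ stdSimplex ℝ X, μ = fun x => (∑ x, μ x) * ρ x := by
  classical
  rcases (Finset.sum_nonneg fun x (_ : x ∈ Finset.univ) => hμ x).eq_or_lt with h | h
  · obtain ⟨x₀⟩ := ‹Nonempty X›
    refine ⟨_, single_mem_stdSimplex ℝ x₀, ?_⟩
    rw [← h]
    ext x
    rw [zero_mul]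
    exact (Finset.sum_eq_zero_iff_of_nonneg fun x _ => hμ x).1 h.symm x (Finset.mem_univ x)
  · refine ⟨fun x => μ x / ∑ x, μ x, ⟨fun x => div_nonneg (hμ x) h.le, ?_⟩, ?_⟩
    · rw [← Finset.sum_div, div_self h.ne']
    · ext x
      field_simp

/-- The largest information gap is attained by a finite auxiliary alphabet. -/
theorem exists_isGapBound_secrecyGap [Nonempty X] (K₁ : X → Y₁ → ℝ) (K₂ : X → Y₂ → ℝ) :
    ∃ (k : ℕ) (w : Fin k → ℝ) (ρ : Fin k → X → ℝ), w ∈ stdSimplex ℝ (Fin k) ∧ IsStochastic ρ ∧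
      IsGapBound K₁ K₂ (secrecyGap K₁ K₂ fun v x => w v * ρ v x) := by
  classical
  set G := entropyGap K₁ K₂ with hG
  set S : Set ((X → ℝ) × ℝ) := (fun ρ => (ρ, G ρ)) '' stdSimplex ℝ X with hS
  have hScomp : IsCompact S :=
    (isCompact_stdSimplex ℝ X).image (continuous_id.prodMk (continuous_entropyGap K₁ K₂))
  have hne : (convexHull ℝ S).Nonempty := by
    obtain ⟨x₀⟩ := ‹Nonempty X›
    exact ⟨_, subset_convexHull ℝ S ⟨_, single_mem_stdSimplex ℝ x₀, rfl⟩⟩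
  -- A point `p` of the hull is a pair (barycentre, average of `G`), so `G p.1 - p.2` is the gap of
  -- any decomposition of `p`.
  obtain ⟨p, hp, hmax⟩ := (isCompact_convexHull_of_finiteDimensional hScomp).exists_isMaxOn hne
    (f := fun p => G p.1 - p.2) (by
      have := continuous_entropyGap K₁ K₂
      fun_prop)
  obtain ⟨ι, _, z, w, hz, -, hw, hw1, hsum⟩ := eq_pos_convex_span_of_mem_convexHull hp
  have hz' : ∀ i, ∃ ρ ∈ stdSimplex ℝ X, (ρ, G ρ) = z i := fun i => hz ⟨i, rfl⟩
  choose ρ hρ hρz using hz'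
  let e := Fintype.equivFin ι
  have hval : secrecyGap K₁ K₂ (fun v x => w (e.symm v) * ρ (e.symm v) x) = G p.1 - p.2 := by
    rw [secrecyGap_eq]
    simp only [entropyGap_const_mul]
    rw [Equiv.sum_comp e.symm (fun i => w i * entropyGap K₁ K₂ (ρ i))]
    simp only [fun x => Equiv.sum_comp e.symm (fun i => w i * ρ i x)]
    rw [← hsum]
    congr 1
    · congr 1
      ext x
      simp [Prod.fst_sum, Finset.sum_apply, ← hρz]
    · simp [Prod.snd_sum, ← hρz, hG]
  refine ⟨Fintype.card ι, fun v => w (e.symm v), fun v => ρ (e.symm v),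
    ⟨fun v => (hw _).le, by rw [← hw1]; exact Equiv.sum_comp e.symm w⟩, fun v => hρ _, ?_⟩
  rw [hval]
  intro V _ μ hμ
  choose σ hσ hμσ using fun v => exists_smul_stdSimplex (hμ v)
  set T := ∑ v, ∑ x, μ v x with hT
  have hmass : ∀ v, 0 ≤ ∑ x, μ v x := fun v => Finset.sum_nonneg fun x _ => hμ v x
  have hGz : ∀ v, entropyGap K₁ K₂ (μ v) = (∑ x, μ v x) * G (σ v) := by
    intro v
    conv_lhs => rw [hμσ v]
    exact entropyGap_const_mul K₁ K₂ _ _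
  rcases (Finset.sum_nonneg fun v (_ : v ∈ Finset.univ) => hmass v).eq_or_lt with h | h
  · have h0 := (Finset.sum_eq_zero_iff_of_nonneg fun v _ => hmass v).1 h.symm
    have h0' : ∀ v x, μ v x = 0 := fun v x =>
      (Finset.sum_eq_zero_iff_of_nonneg fun x _ => hμ v x).1 (h0 v (Finset.mem_univ v)) x
        (Finset.mem_univ x)
    have hμ0 : μ = fun _ _ => 0 := funext fun v => funext (h0' v)
    rw [hT, ← h, hμ0]
    simp [secrecyGap, massInfo, pushMass, massEntropy]
  -- Normalised by its total mass `T`, an arbitrary `μ` gives a point of the hull, where the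
  -- maximality of `p` applies.
  · have hmem : (∑ v, ((∑ x, μ v x) / T) • (σ v, G (σ v))) ∈ convexHull ℝ S :=
      (convex_convexHull ℝ S).sum_mem (fun v _ => div_nonneg (hmass v) h.le)
        (by rw [← Finset.sum_div, div_self h.ne'])
        fun v _ => subset_convexHull ℝ S ⟨σ v, hσ v, rfl⟩
    have hle := hmax hmem
    simp only [Set.mem_ofPred_eq, Prod.fst_sum, Prod.snd_sum, Prod.smul_fst, Prod.smul_snd] at hle
    have h1 : (∑ v, ((∑ x, μ v x) / T) • σ v) = fun x => T⁻¹ * ∑ v, μ v x := by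
      ext x
      rw [Finset.sum_apply, Finset.mul_sum]
      refine Finset.sum_congr rfl fun v _ => ?_
      conv_rhs => rw [hμσ v]
      simp only [Pi.smul_apply, smul_eq_mul]
      ring
    have h2 : (∑ v, ((∑ x, μ v x) / T) • G (σ v)) = T⁻¹ * ∑ v, entropyGap K₁ K₂ (μ v) := by
      rw [Finset.mul_sum]
      refine Finset.sum_congr rfl fun v _ => ?_
      rw [hGz, smul_eq_mul]
      ring
    rw [h1, h2, hG, entropyGap_const_mul, ← mul_sub, ← secrecyGap_eq, inv_mul_le_iff₀ h] at hle
    rw [mul_comm]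
    exact hle

end SecrecyGap

/-! ### Products of channels -/

/-- Two independent channels used in parallel. -/
def prodKernel {X X' Y Y' : Type*} (K : X → Y → ℝ) (L : X' → Y' → ℝ) (x : X × X') (y : Y × Y') : ℝ :=
  K x.1 y.1 * L x.2 y.2

/-- The memoryless `n`-fold use of a channel. -/
def blockKernel {X Y : Type*} (K : X → Y → ℝ) (n : ℕ) (x : Fin n → X) (y : Fin n → Y) : ℝ :=
  ∏ i, K (x i) (y i)

section Product

variable {V X X' Y Y' Y₁ Y₂ Y₁' Y₂' : Type*} [Fintype V] [Fintype X] [Fintype X'] [Fintype Y]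
  [Fintype Y'] [Fintype Y₁] [Fintype Y₂] [Fintype Y₁'] [Fintype Y₂']

theorem isStochastic_blockKernel {X : Type*} {K : X → Y → ℝ} (hK : IsStochastic K) (n : ℕ) :
    IsStochastic (blockKernel K n) := by
  classical
  refine fun x => ⟨fun y => Finset.prod_nonneg fun i _ => (hK _).1 _, ?_⟩
  have h := Finset.prod_univ_sum (fun _ : Fin n => (Finset.univ : Finset Y)) fun i y => K (x i) y
  rw [Fintype.piFinset_univ] at h
  simp only [blockKernel]
  rw [← h]
  exact Finset.prod_eq_one fun i _ => (hK (x i)).2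

theorem sum_pushMass_of_isStochastic {K : X → Y → ℝ} (hK : IsStochastic K) (μ : X → ℝ) :
    ∑ y, pushMass μ K y = ∑ x, μ x := by
  simp only [pushMass]
  rw [Finset.sum_comm]
  exact Finset.sum_congr rfl fun x _ => by rw [← Finset.mul_sum, (hK x).2, mul_one]

/-- Chain rule revealing the output of `L` first: the first term does not involve `K`, which is why
two channels `K` with the same `L` compare slice by slice. -/
theorem massInfo_pushMass_prodKernel {K : X → Y → ℝ} (hK : IsStochastic K) (L : X' → Y' → ℝ)
    (μ : V → X × X' → ℝ) :
    massInfo (fun v => pushMass (μ v) (prodKernel K L)) =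
      massInfo (fun v => pushMass (fun x' => ∑ x, μ v (x, x')) L) +
      ∑ y', massInfo (fun v => pushMass (fun x => ∑ x', μ v (x, x') * L x' y') K) := by
  rw [massInfo_prod]
  congr 1
  · congr 1
    ext v y'
    simp only [pushMass, prodKernel, Fintype.sum_prod_type]
    rw [Finset.sum_comm, Finset.sum_congr rfl fun x _ => Finset.sum_comm, Finset.sum_comm]
    refine Finset.sum_congr rfl fun x' _ => ?_
    rw [Finset.sum_mul]
    refine Finset.sum_congr rfl fun x _ => ?_
    calc ∑ y, μ v (x, x') * (K x y * L x' y') = (μ v (x, x') * L x' y') * ∑ y, K x y := by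
          rw [Finset.mul_sum]
          exact Finset.sum_congr rfl fun y _ => by ring
      _ = μ v (x, x') * L x' y' := by rw [(hK x).2, mul_one]
  · refine Finset.sum_congr rfl fun y' _ => ?_
    congr 1
    ext v y
    simp only [pushMass, prodKernel, Fintype.sum_prod_type, Finset.sum_mul]
    exact Finset.sum_congr rfl fun x _ => Finset.sum_congr rfl fun x' _ => by ring

theorem massInfo_pushMass_prodKernel' (K : X → Y → ℝ) {L : X' → Y' → ℝ} (hL : IsStochastic L)
    (μ : V → X × X' → ℝ) :
    massInfo (fun v => pushMass (μ v) (prodKernel K L)) =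
      massInfo (fun v => pushMass (fun x => ∑ x', μ v (x, x')) K) +
      ∑ y, massInfo (fun v => pushMass (fun x' => ∑ x, μ v (x, x') * K x y) L) := by
  rw [massInfo_prod']
  congr 1
  · congr 1
    ext v y
    simp only [pushMass, prodKernel, Fintype.sum_prod_type]
    rw [Finset.sum_comm]
    refine Finset.sum_congr rfl fun x _ => ?_
    rw [Finset.sum_mul, Finset.sum_comm]
    refine Finset.sum_congr rfl fun x' _ => ?_
    calc ∑ y', μ v (x, x') * (K x y * L x' y') = (μ v (x, x') * K x y) * ∑ y', L x' y' := by
          rw [Finset.mul_sum]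
          exact Finset.sum_congr rfl fun y _ => by ring
      _ = μ v (x, x') * K x y := by rw [(hL x').2, mul_one]
  · refine Finset.sum_congr rfl fun y' _ => ?_
    congr 1
    ext v y
    simp only [pushMass, prodKernel, Fintype.sum_prod_type_right, Finset.sum_mul]
    exact Finset.sum_congr rfl fun x _ => Finset.sum_congr rfl fun x' _ => by ring

/-- Hybrid argument through the mixed pair `(K₂, L₁)`. Each comparison changes one factor; the term
of the common factor cancels, and what remains is a single-factor gap summed over slices of total
mass that of `μ`. -/
theorem IsGapBound.prodKernel {K₁ : X → Y₁ → ℝ} {K₂ : X → Y₂ → ℝ} {L₁ : X' → Y₁' → ℝ}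
    {L₂ : X' → Y₂' → ℝ} {C D : ℝ} (hC : IsGapBound K₁ K₂ C) (hD : IsGapBound L₁ L₂ D)
    (hK₁ : IsStochastic K₁) (hK₂ : IsStochastic K₂) (hL₁ : IsStochastic L₁)
    (hL₂ : IsStochastic L₂) :
    IsGapBound (prodKernel K₁ L₁) (prodKernel K₂ L₂) (C + D) := by
  intro V _ μ hμ
  have h1 : massInfo (fun v => pushMass (μ v) (_root_.prodKernel K₁ L₁)) -
      massInfo (fun v => pushMass (μ v) (_root_.prodKernel K₂ L₁)) ≤ C * ∑ v, ∑ p, μ v p := by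
    rw [massInfo_pushMass_prodKernel hK₁, massInfo_pushMass_prodKernel hK₂, add_sub_add_left_eq_sub,
      ← Finset.sum_sub_distrib]
    calc _ ≤ ∑ y', C * ∑ v, ∑ x, ∑ x', μ v (x, x') * L₁ x' y' :=
          Finset.sum_le_sum fun y' _ => hC V _ fun v x =>
            Finset.sum_nonneg fun x' _ => mul_nonneg (hμ _ _) ((hL₁ _).1 _)
      _ = _ := by
          rw [← Finset.mul_sum, Finset.sum_comm]
          congr 1
          refine Finset.sum_congr rfl fun v _ => ?_
          rw [Finset.sum_comm, Fintype.sum_prod_type]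
          refine Finset.sum_congr rfl fun x _ => ?_
          rw [Finset.sum_comm]
          exact Finset.sum_congr rfl fun x' _ => by rw [← Finset.mul_sum, (hL₁ x').2, mul_one]
  have h2 : massInfo (fun v => pushMass (μ v) (_root_.prodKernel K₂ L₁)) -
      massInfo (fun v => pushMass (μ v) (_root_.prodKernel K₂ L₂)) ≤ D * ∑ v, ∑ p, μ v p := by
    rw [massInfo_pushMass_prodKernel' K₂ hL₁, massInfo_pushMass_prodKernel' K₂ hL₂,
      add_sub_add_left_eq_sub, ← Finset.sum_sub_distrib]
    calc _ ≤ ∑ y, D * ∑ v, ∑ x', ∑ x, μ v (x, x') * K₂ x y :=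
          Finset.sum_le_sum fun y' _ => hD V _ fun v x =>
            Finset.sum_nonneg fun x' _ => mul_nonneg (hμ _ _) ((hK₂ _).1 _)
      _ = _ := by
          rw [← Finset.mul_sum, Finset.sum_comm]
          congr 1
          refine Finset.sum_congr rfl fun v _ => ?_
          rw [Finset.sum_comm, Fintype.sum_prod_type_right]
          refine Finset.sum_congr rfl fun x _ => ?_
          rw [Finset.sum_comm]
          exact Finset.sum_congr rfl fun x' _ => by rw [← Finset.mul_sum, (hK₂ x').2, mul_one]
  rw [secrecyGap]
  linarith

theorem massInfo_pushMass_blockKernel_succ (K : X → Y → ℝ) (n : ℕ)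
    (μ : V → (Fin (n + 1) → X) → ℝ) :
    massInfo (fun v => pushMass (μ v) (blockKernel K (n + 1))) =
      massInfo (fun v => pushMass (fun p : X × (Fin n → X) => μ v (Fin.cons p.1 p.2))
        (prodKernel K (blockKernel K n))) := by
  rw [← massInfo_equiv (Fin.consEquiv fun _ => Y)]
  congr 1
  ext v y
  simp only [pushMass]
  rw [← Equiv.sum_comp (Fin.consEquiv fun _ => X)]
  refine Finset.sum_congr rfl fun x _ => ?_
  simp [Fin.consEquiv, blockKernel, prodKernel, Fin.prod_univ_succ]

/-- The information gap of `n` memoryless uses is at most `n` times the single-letter bound. -/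
theorem IsGapBound.blockKernel {K₁ : X → Y₁ → ℝ} {K₂ : X → Y₂ → ℝ} {C : ℝ}
    (hC : IsGapBound K₁ K₂ C) (hK₁ : IsStochastic K₁) (hK₂ : IsStochastic K₂) (n : ℕ) :
    IsGapBound (blockKernel K₁ n) (blockKernel K₂ n) (n * C) := by
  induction n with
  | zero =>
    intro V _ μ _
    simp [secrecyGap, massInfo, massEntropy_unique]
  | succ n ih =>
    intro V _ μ hμ
    have h := hC.prodKernel ih hK₁ hK₂ (isStochastic_blockKernel hK₁ n)
      (isStochastic_blockKernel hK₂ n) V (fun v p => μ v (Fin.cons p.1 p.2)) fun v p => hμ _ _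
    rw [secrecyGap, massInfo_pushMass_blockKernel_succ, massInfo_pushMass_blockKernel_succ]
    refine h.trans_eq ?_
    have hs : ∀ v, ∑ p : X × (Fin n → X), μ v (Fin.cons p.1 p.2) = ∑ x, μ v x := fun v =>
      Equiv.sum_comp (Fin.consEquiv fun _ => X) (μ v)
    simp only [hs]
    push_cast
    ring

end Product

/-! ### Fano's inequality and the converse -/

section Converse

variable {α β X Y Y₁ Y₂ : Type*} [Fintype α] [Fintype β] [Fintype X] [Fintype Y] [Fintype Y₁]
  [Fintype Y₂]

/-- Gibbs' inequality. -/
theorem massEntropy_le_neg_sum_mul_log {m r : α → ℝ} (hm : ∀ a, 0 ≤ m a) (hr : ∀ a, 0 ≤ r a)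
    (hr1 : ∑ a, r a ≤ 1) (hmr : ∀ a, 0 < m a → 0 < r a) :
    massEntropy m ≤ - ∑ a, m a * Real.log (r a) := by
  set S := ∑ a, m a with hS
  have hS0 : 0 ≤ S := Finset.sum_nonneg fun a _ => hm a
  -- This is `log x ≤ x - 1` at `x = S * r a / m a`, multiplied by `m a`.
  have key : ∀ a, Real.negMulLog (m a) + m a * Real.log S + m a * Real.log (r a)
      ≤ S * r a - m a := by
    intro a
    rcases (hm a).eq_or_lt with h | h
    · simpa [← h] using mul_nonneg hS0 (hr a)
    · have hSpos : 0 < S := h.trans_le (Finset.single_le_sum (fun a _ => hm a) (Finset.mem_univ a))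
      have hlog := Real.log_le_sub_one_of_pos (div_pos (mul_pos hSpos (hmr a h)) h)
      rw [Real.log_div (mul_pos hSpos (hmr a h)).ne' h.ne', Real.log_mul hSpos.ne' (hmr a h).ne']
        at hlog
      have h2 := mul_le_mul_of_nonneg_left hlog h.le
      have h3 : m a * (S * r a / m a - 1) = S * r a - m a := by field_simp
      rw [h3] at h2
      rw [Real.negMulLog]
      linarith
  have hsum := Finset.sum_le_sum fun a (_ : a ∈ Finset.univ) => key a
  rw [Finset.sum_add_distrib, Finset.sum_add_distrib, ← Finset.sum_mul, Finset.sum_sub_distrib,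
    ← Finset.mul_sum, ← hS] at hsum
  have : S * ∑ a, r a ≤ S := mul_le_of_le_one_right hS0 hr1
  rw [massEntropy, ← hS, Real.negMulLog]
  linarith

/-- Fano's inequality. -/
theorem sum_massEntropy_le_of_error {M : ℕ} {m : Fin M → Y → ℝ} (hm : ∀ w y, 0 ≤ m w y)
    (hm1 : ∑ w, ∑ y, m w y = 1) (dec : Y → Fin M) {ε : ℝ} (hε : 0 < ε) (hε1 : ε < 1)
    (herr : ∑ w, ∑ y, (if dec y ≠ w then m w y else 0) ≤ ε) :
    ∑ y, massEntropy (fun w => m w y) ≤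
      -Real.log (1 - ε) + Real.negMulLog ε + ε * Real.log M := by
  have hM : 1 ≤ M := by
    rcases Nat.eq_zero_or_pos M with rfl | h
    · simp at hm1
    · exact h
  have hM' : (1 : ℝ) ≤ M := by exact_mod_cast hM
  have hMpos : (0 : ℝ) < M := by linarith
  set A := -Real.log (1 - ε) with hA
  set B := Real.log M - Real.log ε with hB
  have hA0 : 0 ≤ A := by
    have := Real.log_nonpos (x := 1 - ε) (by linarith) (by linarith)
    linarith
  have hB0 : 0 ≤ B := by
    have h1 := Real.log_nonpos hε.le hε1.le
    have h2 := Real.log_nonneg hM'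
    linarith
  have h1 : ∀ y, massEntropy (fun w => m w y) ≤
      ∑ w, (A * m w y + B * (if dec y ≠ w then m w y else 0)) := by
    intro y
    -- The reference law puts `1 - ε` on the decoded message and `ε / M` on every other one. Its
    -- total is at most one, as Gibbs' inequality allows.
    refine (massEntropy_le_neg_sum_mul_log (r := fun w => if dec y = w then 1 - ε else ε / M)
      (fun w => hm w y) (fun w => ?_) ?_ fun w _ => ?_).trans ?_
    · split_ifs
      · linarith
      · positivity
    · calc ∑ w, (if dec y = w then 1 - ε else ε / M)
          ≤ ∑ w, ((if dec y = w then 1 - ε else 0) + ε / M) := by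
            refine Finset.sum_le_sum fun w _ => ?_
            have : 0 ≤ ε / M := by positivity
            split_ifs <;> linarith
        _ = 1 := by
            rw [Finset.sum_add_distrib]
            simp
            field_simp
            ring
    · split_ifs
      · linarith
      · positivity
    · rw [← Finset.sum_neg_distrib]
      refine Finset.sum_le_sum fun w _ => ?_
      have h0 := hm w y
      by_cases h : dec y = w
      · simp only [h, if_true, ne_eq, not_true_eq_false, if_false]
        rw [hA]
        linarith
      · simp only [h, if_false, ne_eq, not_false_eq_true, if_true]
        rw [Real.log_div hε.ne' hMpos.ne']
        have := mul_nonneg hA0 h0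
        rw [hB]
        linarith
  calc ∑ y, massEntropy (fun w => m w y)
      ≤ ∑ y, ∑ w, (A * m w y + B * (if dec y ≠ w then m w y else 0)) :=
        Finset.sum_le_sum fun y _ => h1 y
    _ = A * 1 + B * ∑ w, ∑ y, (if dec y ≠ w then m w y else 0) := by
        rw [← hm1, Finset.sum_comm]
        simp only [Finset.sum_add_distrib, Finset.mul_sum]
    _ ≤ A * 1 + B * ε := by gcongr
    _ = _ := by
        rw [hB, Real.negMulLog]
        ring

/-- The equivocation (in nats) of a uniform message, encoded by `enc`, given the output of `K`. -/
noncomputable def residualEntropy {M : ℕ} (enc : Fin M → X → ℝ) (K : X → Y → ℝ) : ℝ :=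
  ∑ y, massEntropy (fun w => (1 / (M : ℝ)) * pushMass (enc w) K y)

theorem massInfo_uniform {M : ℕ} (hM : 0 < M) {enc : Fin M → X → ℝ} {K : X → Y → ℝ}
    (henc : IsStochastic enc) (hK : IsStochastic K) :
    massInfo (fun w => pushMass (fun x => (1 / (M : ℝ)) * enc w x) K) =
      Real.log M - residualEntropy enc K := by
  have hM' : (0 : ℝ) < M := by exact_mod_cast hM
  rw [massInfo_eq_sub_sum]
  simp only [sum_pushMass_of_isStochastic hK, ← Finset.mul_sum, (henc _).2, mul_one]
  simp only [pushMass_const_mul]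
  congr 1
  simp [massEntropy, Real.negMulLog, hM'.ne']

/-- The two informations equal `log M` minus an equivocation, so `log M` cancels from the gap. -/
theorem residualEntropy_sub_le {M n : ℕ} (hM : 0 < M) {K₁ : X → Y₁ → ℝ} {K₂ : X → Y₂ → ℝ} {C : ℝ}
    (hC : IsGapBound K₁ K₂ C) (hK₁ : IsStochastic K₁) (hK₂ : IsStochastic K₂)
    {enc : Fin M → (Fin n → X) → ℝ} (henc : IsStochastic enc) :
    residualEntropy enc (blockKernel K₂ n) - residualEntropy enc (blockKernel K₁ n) ≤ n * C := by
  have hM' : (0 : ℝ) < M := by exact_mod_cast hM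
  have h := hC.blockKernel hK₁ hK₂ n (Fin M) (fun w x => (1 / (M : ℝ)) * enc w x)
    fun w x => mul_nonneg (by positivity) ((henc w).1 x)
  rw [secrecyGap, massInfo_uniform hM henc (isStochastic_blockKernel hK₁ n),
    massInfo_uniform hM henc (isStochastic_blockKernel hK₂ n)] at h
  have hs : ∑ w, ∑ x, (1 / (M : ℝ)) * enc w x = 1 := by
    simp only [← Finset.mul_sum, (henc _).2]
    simp [hM'.ne']
  rw [hs] at h
  linarith

/-- A rate that is reliable over `K₁` and secret over `K₂` is at most the single-letter gap. -/
theorem rate_le_of_isGapBound [Nonempty X] {K₁ : X → Y₁ → ℝ} {K₂ : X → Y₂ → ℝ} {C R : ℝ}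
    (hC : IsGapBound K₁ K₂ C) (hK₁ : IsStochastic K₁) (hK₂ : IsStochastic K₂)
    (h : ∀ ε : ℝ, 0 < ε → ε < 1 → ∃ (n M : ℕ) (enc : Fin M → (Fin n → X) → ℝ),
      1 ≤ n ∧ 0 < M ∧ IsStochastic enc ∧
      residualEntropy enc (blockKernel K₁ n) ≤
        -Real.log (1 - ε) + Real.negMulLog ε + ε * Real.log M ∧
      n * R - residualEntropy enc (blockKernel K₂ n) ≤ n * ε) :
    R ≤ C := by
  -- Fano's term `ε * log M` needs an upper bound on `M`, for which only a lower bound is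
  -- prescribed. A blind eavesdropper with one output letter supplies it: there the gap is the full
  -- information, so `D` bounds the rate of reliable transmission.
  obtain ⟨k, w, ρ, -, -, hD⟩ :=
    exists_isGapBound_secrecyGap K₁ (fun (_ : X) (_ : Unit) => (1 : ℝ))
  set D := secrecyGap K₁ (fun (_ : X) (_ : Unit) => (1 : ℝ)) fun v x => w v * ρ v x
  have hU : IsStochastic (fun (_ : X) (_ : Unit) => (1 : ℝ)) := fun x => ⟨fun _ => zero_le_one, by simp⟩
  set φ : ℝ → ℝ := fun ε => -Real.log (1 - ε) + Real.negMulLog ε with hφ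
  have hbound : ∀ ε : ℝ, 0 < ε → ε < 1 → R ≤ C + ε + φ ε + ε * (D + φ ε) / (1 - ε) := by
    intro ε hε hε1
    obtain ⟨n, M, enc, hn, hM, henc, h1, h2⟩ := h ε hε hε1
    have hn' : (1 : ℝ) ≤ n := by exact_mod_cast hn
    have hφ0 : 0 ≤ φ ε := by
      have h1 := Real.log_nonpos (x := 1 - ε) (by linarith) (by linarith)
      have h2 := Real.negMulLog_nonneg hε.le hε1.le
      simp only [hφ]
      linarith
    have hgap := residualEntropy_sub_le hM hC hK₁ hK₂ henc
    have hgapU := residualEntropy_sub_le hM hD hK₁ hU henc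
    have hres : residualEntropy enc (blockKernel (fun (_ : X) (_ : Unit) => (1 : ℝ)) n) =
        Real.log M := by
      have := massInfo_uniform hM henc (isStochastic_blockKernel hU n)
      simp only [massInfo, massEntropy_unique, Finset.sum_const_zero, sub_zero] at this
      linarith
    rw [hres] at hgapU
    have hlogM : Real.log M ≤ (n * D + φ ε) / (1 - ε) := by
      rw [le_div_iff₀ (by linarith)]
      simp only [hφ]
      linarith
    have hlogM' : (n * D + φ ε) / (1 - ε) ≤ n * ((D + φ ε) / (1 - ε)) := by
      rw [← mul_div_assoc]
      have : φ ε ≤ n * φ ε := le_mul_of_one_le_left hφ0 hn'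
      gcongr ?_ / _
      · linarith
    have h3 : ε * Real.log M ≤ n * (ε * (D + φ ε) / (1 - ε)) := by
      calc ε * Real.log M ≤ ε * (n * ((D + φ ε) / (1 - ε))) :=
            mul_le_mul_of_nonneg_left (hlogM.trans hlogM') hε.le
        _ = _ := by ring
    have h4 : φ ε ≤ n * φ ε := le_mul_of_one_le_left hφ0 hn'
    have h1' : residualEntropy enc (blockKernel K₁ n) ≤ φ ε + ε * Real.log M := h1
    have h5 : n * R ≤ n * (C + ε + φ ε + ε * (D + φ ε) / (1 - ε)) := by
      rw [mul_add, mul_add, mul_add]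
      linarith
    exact le_of_mul_le_mul_left h5 (by linarith)
  -- The bound does not involve `n` or `M`, so `ε` may tend to zero from the right.
  have hcont : ContinuousAt (fun ε : ℝ => C + ε + φ ε + ε * (D + φ ε) / (1 - ε)) 0 := by
    have h1 : ContinuousAt φ 0 := by
      have := Real.continuous_negMulLog
      refine ContinuousAt.add (ContinuousAt.neg (ContinuousAt.log (by fun_prop) (by norm_num))) ?_
      exact this.continuousAt
    refine ContinuousAt.add (ContinuousAt.add (by fun_prop) h1) ?_
    exact ContinuousAt.div (continuousAt_id.mul (continuousAt_const.add h1)) (by fun_prop)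
      (by norm_num)
  have ht := (hcont.tendsto.mono_left (nhdsWithin_le_nhds (s := Set.Ioi 0)))
  have hval : (C + 0 + φ 0 + 0 * (D + φ 0) / (1 - 0)) = C := by simp [hφ]
  rw [hval] at ht
  refine ge_of_tendsto ht ?_
  filter_upwards [Ioo_mem_nhdsGT (zero_lt_one (α := ℝ))] with ε hε
  exact hbound ε hε.1 hε.2

end Converse

/-! ### Random coding -/

section RandomCodebook

variable {ι A B : Type*} [Fintype ι] [DecidableEq ι] [Fintype A] [Fintype B]

/-- The probability of a codebook with independent codewords of law `p`. -/
def codebookWeight {ι A : Type*} [Fintype ι] (p : A → ℝ) (c : ι → A) : ℝ := ∏ k, p (c k)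

theorem sum_prod_eq_prod_sum (f : ι → A → ℝ) : ∑ c : ι → A, ∏ k, f k (c k) = ∏ k, ∑ a, f k a := by
  classical
  rw [Finset.prod_univ_sum, Fintype.piFinset_univ]

theorem sum_codebookWeight_mul {p : A → ℝ} (hp : ∑ a, p a = 1) (j : ι) (ψ : A → ℝ) :
    ∑ c : ι → A, codebookWeight p c * ψ (c j) = ∑ a, p a * ψ a := by
  have h := sum_prod_eq_prod_sum fun k a => if k = j then p a * ψ a else p a
  have h1 : ∀ c : ι → A, ∏ k, (if k = j then p (c k) * ψ (c k) else p (c k)) =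
      codebookWeight p c * ψ (c j) := by
    intro c
    rw [codebookWeight, ← Finset.mul_prod_erase _ _ (Finset.mem_univ j),
      ← Finset.mul_prod_erase Finset.univ (fun k => p (c k)) (Finset.mem_univ j),
      Finset.prod_congr rfl fun k hk => if_neg (Finset.ne_of_mem_erase hk)]
    simp only [if_true]
    ring
  simp only [h1] at h
  rw [h, ← Finset.mul_prod_erase _ _ (Finset.mem_univ j), Finset.prod_eq_one]
  · simp
  · intro k hk
    simp [Finset.ne_of_mem_erase hk, hp]

theorem sum_codebookWeight {p : A → ℝ} (hp : ∑ a, p a = 1) :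
    ∑ c : ι → A, codebookWeight p c = 1 := by
  simp only [codebookWeight]
  rw [sum_prod_eq_prod_sum]
  simp [hp]

theorem sum_codebookWeight_mul_mul {p : A → ℝ} (hp : ∑ a, p a = 1) {j k : ι} (hjk : j ≠ k)
    (ψ f : A → ℝ) :
    ∑ c : ι → A, codebookWeight p c * (ψ (c j) * f (c k)) =
      (∑ a, p a * ψ a) * ∑ a, p a * f a := by
  have h := sum_prod_eq_prod_sum fun i a =>
    p a * ((if i = j then ψ a else 1) * (if i = k then f a else 1))
  have h1 : ∀ c : ι → A, ∏ i, p (c i) * ((if i = j then ψ (c i) else 1) *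
      (if i = k then f (c i) else 1)) = codebookWeight p c * (ψ (c j) * f (c k)) := by
    intro c
    rw [Finset.prod_mul_distrib, Finset.prod_mul_distrib, Finset.prod_ite_eq', Finset.prod_ite_eq']
    simp [codebookWeight]
  simp only [h1] at h
  rw [h, ← Finset.mul_prod_erase _ _ (Finset.mem_univ j),
    ← Finset.mul_prod_erase (Finset.univ.erase j) _
      (Finset.mem_erase.2 ⟨hjk.symm, Finset.mem_univ k⟩), Finset.prod_eq_one]
  · simp [hjk, hjk.symm]
  · intro i hi
    have h1 := Finset.ne_of_mem_erase hi
    have h2 := Finset.ne_of_mem_erase (Finset.mem_of_mem_erase hi)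
    simp [h1, h2, hp]

/-- Averaging the logarithm of a sum of independent terms over the codebook. -/
theorem sum_codebookWeight_mul_log_le {p : A → ℝ} (hp : p ∈ stdSimplex ℝ A) {a : A → ℝ}
    (ha : ∀ x, 0 ≤ a x) (j : ι) (S : Finset ι) (hj : j ∉ S) :
    ∑ c : ι → A, codebookWeight p c * (a (c j) * Real.log (a (c j) + ∑ k ∈ S, a (c k))) ≤
      ∑ x, p x * (a x * Real.log (a x + S.card * ∑ z, p z * a z)) := by
  set q := ∑ z, p z * a z with hq
  have hq0 : 0 ≤ q := Finset.sum_nonneg fun z _ => mul_nonneg (hp.1 z) (ha z)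
  set ψ : A → ℝ := fun x => a x / (a x + S.card * q) with hψ
  -- Jensen's inequality by hand: the logarithm lies below its tangent at the mean of the sum given
  -- codeword `j`, and the linear term averages to zero because the codewords are independent.
  have htan : ∀ c : ι → A, a (c j) * Real.log (a (c j) + ∑ k ∈ S, a (c k)) ≤
      a (c j) * Real.log (a (c j) + S.card * q) +
        (∑ k ∈ S, ψ (c j) * a (c k) - S.card * (ψ (c j) * q)) := by
    intro c
    have hT : 0 ≤ ∑ k ∈ S, a (c k) := Finset.sum_nonneg fun k _ => ha _
    rcases (ha (c j)).eq_or_lt with h | h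
    · simp [hψ, ← h]
    · have h1 : 0 < a (c j) + S.card * q := by positivity
      have h2 : 0 < a (c j) + ∑ k ∈ S, a (c k) := by positivity
      have hlog := Real.log_le_sub_one_of_pos (div_pos h2 h1)
      rw [Real.log_div h2.ne' h1.ne'] at hlog
      have h3 := mul_le_mul_of_nonneg_left hlog h.le
      have h4 : a (c j) * ((a (c j) + ∑ k ∈ S, a (c k)) / (a (c j) + S.card * q) - 1) =
          ∑ k ∈ S, ψ (c j) * a (c k) - S.card * (ψ (c j) * q) := by
        rw [← Finset.mul_sum]
        simp only [hψ]
        field_simp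
        ring
      linarith
  have hw : ∀ c : ι → A, 0 ≤ codebookWeight p c := fun c => Finset.prod_nonneg fun k _ => hp.1 _
  refine (Finset.sum_le_sum fun c _ => mul_le_mul_of_nonneg_left (htan c) (hw c)).trans_eq ?_
  simp only [mul_add, mul_sub, Finset.sum_add_distrib, Finset.sum_sub_distrib]
  rw [sum_codebookWeight_mul hp.2 j (fun x => a x * Real.log (a x + S.card * q)),
    add_eq_left, sub_eq_zero]
  simp only [Finset.mul_sum]
  rw [Finset.sum_comm]
  have h1 : ∀ k ∈ S, ∑ c : ι → A, codebookWeight p c * (ψ (c j) * a (c k)) =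
      (∑ x, p x * ψ x) * q := fun k hk =>
    sum_codebookWeight_mul_mul hp.2 ((by rintro rfl; exact hj hk)) ψ a
  rw [Finset.sum_congr rfl h1]
  have h2 := sum_codebookWeight_mul hp.2 j (fun x => S.card * (ψ x * q))
  rw [h2]
  simp only [Finset.sum_const, nsmul_eq_mul, Finset.sum_mul, Finset.mul_sum]
  exact Finset.sum_congr rfl fun x _ => by ring

/-- Subadditivity of `x ^ s` and `log y ≤ y - 1`. It replaces logarithms by moments of order `s`,
which factor over the letters of a block. -/
theorem log_one_add_le_rpow_div {x s : ℝ} (hx : 0 ≤ x) (hs : 0 < s) (hs1 : s ≤ 1) :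
    Real.log (1 + x) ≤ x ^ s / s := by
  have h1 : (1 + x) ^ s ≤ 1 + x ^ s := by
    simpa using Real.rpow_add_le_add_rpow zero_le_one hx hs.le hs1
  have h2 : s * Real.log (1 + x) ≤ x ^ s := by
    rw [← Real.log_rpow (by positivity)]
    have h3 := Real.log_le_sub_one_of_pos (x := (1 + x) ^ s) (by positivity)
    linarith
  rw [le_div_iff₀ hs]
  linarith

theorem pushMass_pos {A B : Type*} [Fintype A] {p : A → ℝ} (hp : ∀ a, 0 ≤ p a) {K : A → B → ℝ} (hK : ∀ a b, 0 ≤ K a b)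
    {a : A} {y : B} (ha : 0 < p a) (hy : 0 < K a y) : 0 < pushMass p K y :=
  (mul_pos ha hy).trans_le
    (Finset.single_le_sum (f := fun a => p a * K a y) (fun a _ => mul_nonneg (hp a) (hK a y))
      (Finset.mem_univ a))


/-- `K` is the likelihood of the sent codeword and `N' * Q` the mean total likelihood of its
competitors. -/
theorem mul_log_sub_le_ambiguity {K Q N N' s : ℝ} (hK : 0 ≤ K) (hQ : 0 ≤ Q) (hN' : 0 ≤ N')
    (hN : N' ≤ N) (hs : 0 < s) (hs1 : s ≤ 1) :
    K * (Real.log (K + N' * Q) - Real.log K) ≤ K * (N ^ s / s * (Q / K) ^ s) := by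
  rcases hK.eq_or_lt with rfl | hK
  · simp
  refine mul_le_mul_of_nonneg_left ?_ hK.le
  have hN0 : 0 ≤ N := hN'.trans hN
  have h1 : K + N' * Q ≤ K * (1 + N * (Q / K)) := by
    have h2 : K * (1 + N * (Q / K)) = K + N * Q := by field_simp
    rw [h2]
    gcongr
  have h0 : 0 < K + N' * Q := by positivity
  have h3 := log_one_add_le_rpow_div (x := N * (Q / K)) (by positivity) hs hs1
  have h4 := Real.log_le_log h0 h1
  rw [Real.log_mul hK.ne' (by positivity)] at h4
  rw [Real.mul_rpow hN0 (by positivity)] at h3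
  calc _ ≤ N ^ s * (Q / K) ^ s / s := by linarith
    _ = _ := by ring

/-- `L * Q` is the ideal total when `L` codewords imitate the output law `Q`; the excess `K` is the
share of the codeword that is actually sent. -/
theorem mul_log_sub_le_leakage {K Q L N' s : ℝ} (hK : 0 ≤ K) (hQ : 0 < Q) (hN' : 0 ≤ N')
    (hN : N' ≤ L) (hL : 0 < L) (hs : 0 < s) (hs1 : s ≤ 1) :
    K * (Real.log (K + N' * Q) - Real.log (L * Q)) ≤ K * (L⁻¹ ^ s / s * (K / Q) ^ s) := by
  rcases hK.eq_or_lt with rfl | hK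
  · simp
  refine mul_le_mul_of_nonneg_left ?_ hK.le
  have h1 : K + N' * Q ≤ L * Q * (1 + L⁻¹ * (K / Q)) := by
    have h2 : L * Q * (1 + L⁻¹ * (K / Q)) = K + L * Q := by
      field_simp
      ring
    rw [h2]
    gcongr
  have h0 : 0 < K + N' * Q := by positivity
  have h3 := log_one_add_le_rpow_div (x := L⁻¹ * (K / Q)) (by positivity) hs hs1
  have h4 := Real.log_le_log h0 h1
  rw [Real.log_mul (by positivity) (by positivity)] at h4
  rw [Real.mul_rpow (by positivity) (by positivity)] at h3
  calc _ ≤ L⁻¹ ^ s * (K / Q) ^ s / s := by linarith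
    _ = _ := by ring

/-- The pointwise bound is asked only on the support of `p`, where a letter with positive `K x y`
forces `pushMass p K y` to be positive. -/
theorem sum_codebookWeight_mul_log_sub_le {p : A → ℝ} (hp : p ∈ stdSimplex ℝ A) {a g b : A → ℝ}
    (ha : ∀ x, 0 ≤ a x) (j : ι) (S : Finset ι) (hj : j ∈ S)
    (hb : ∀ x, 0 < p x → a x * (Real.log (a x + (S.erase j).card * ∑ z, p z * a z) - g x) ≤ b x) :
    ∑ c : ι → A, codebookWeight p c * (a (c j) * (Real.log (∑ k ∈ S, a (c k)) - g (c j))) ≤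
      ∑ x, p x * b x := by
  have h := sum_codebookWeight_mul_log_le hp ha j (S.erase j) (Finset.notMem_erase j _)
  have h' := sum_codebookWeight_mul hp.2 j (fun x => a x * g x)
  have hsplit : ∀ c : ι → A, a (c j) + ∑ k ∈ S.erase j, a (c k) = ∑ k ∈ S, a (c k) :=
    fun c => Finset.add_sum_erase _ (fun k => a (c k)) hj
  simp only [hsplit] at h
  simp only [mul_sub, Finset.sum_sub_distrib]
  rw [h']
  refine (sub_le_sub_right h _).trans ?_
  rw [← Finset.sum_sub_distrib]
  refine Finset.sum_le_sum fun x _ => ?_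
  rw [← mul_sub, ← mul_sub]
  rcases (hp.1 x).eq_or_lt with h0 | h0
  · simp [← h0]
  · exact mul_le_mul_of_nonneg_left (hb x h0) h0.le

/-- The left side is the mean of the logarithm of the inverse posterior probability of the sent
codeword; the right side is a Gallager-type moment. -/
theorem sum_codebookWeight_mul_ambiguity_le {p : A → ℝ} (hp : p ∈ stdSimplex ℝ A) {K : A → B → ℝ}
    (hK : ∀ a b, 0 ≤ K a b) {s : ℝ} (hs : 0 < s) (hs1 : s ≤ 1) (j : ι) :
    ∑ c : ι → A, codebookWeight p c *
      ∑ y, K (c j) y * (Real.log (∑ k, K (c k) y) - Real.log (K (c j) y)) ≤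
      (Fintype.card ι : ℝ) ^ s / s * ∑ a, ∑ y, p a * (K a y * (pushMass p K y / K a y) ^ s) := by
  have hy : ∀ y, ∑ c : ι → A, codebookWeight p c *
      (K (c j) y * (Real.log (∑ k, K (c k) y) - Real.log (K (c j) y))) ≤
      ∑ a, p a * (K a y * ((Fintype.card ι : ℝ) ^ s / s * (pushMass p K y / K a y) ^ s)) := by
    intro y
    refine sum_codebookWeight_mul_log_sub_le hp (fun x => hK x y) j Finset.univ (Finset.mem_univ j)
      (g := fun x => Real.log (K x y)) fun x _ => ?_
    refine mul_log_sub_le_ambiguity (hK x y)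
      (Finset.sum_nonneg fun z _ => mul_nonneg (hp.1 z) (hK z y)) (Nat.cast_nonneg _) ?_ hs hs1
    exact_mod_cast Finset.card_le_univ _
  simp only [Finset.mul_sum]
  rw [Finset.sum_comm]
  refine (Finset.sum_le_sum fun y _ => hy y).trans_eq ?_
  rw [Finset.sum_comm]
  exact Finset.sum_congr rfl fun a _ => Finset.sum_congr rfl fun y _ => by ring

/-- Soft covering: on average the codewords in `S`, those of one message, imitate the output law of
`p` with a small divergence. -/
theorem sum_codebookWeight_mul_leakage_le {p : A → ℝ} (hp : p ∈ stdSimplex ℝ A) {K : A → B → ℝ}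
    (hK : ∀ a b, 0 ≤ K a b) {s : ℝ} (hs : 0 < s) (hs1 : s ≤ 1) (j : ι) (S : Finset ι)
    (hj : j ∈ S) :
    ∑ c : ι → A, codebookWeight p c *
      ∑ y, K (c j) y * (Real.log (∑ k ∈ S, K (c k) y) - Real.log (S.card * pushMass p K y)) ≤
      (S.card : ℝ)⁻¹ ^ s / s * ∑ a, ∑ y, p a * (K a y * (K a y / pushMass p K y) ^ s) := by
  have hcard : (0 : ℝ) < S.card := by exact_mod_cast Finset.card_pos.2 ⟨j, hj⟩
  have hy : ∀ y, ∑ c : ι → A, codebookWeight p c *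
      (K (c j) y * (Real.log (∑ k ∈ S, K (c k) y) - Real.log (S.card * pushMass p K y))) ≤
      ∑ a, p a * (K a y * ((S.card : ℝ)⁻¹ ^ s / s * (K a y / pushMass p K y) ^ s)) := by
    intro y
    refine sum_codebookWeight_mul_log_sub_le hp (fun x => hK x y) j S hj
      (g := fun _ => Real.log (S.card * pushMass p K y)) fun x hx => ?_
    rcases (hK x y).eq_or_lt with h0 | h0
    · simp [← h0]
    refine mul_log_sub_le_leakage (hK x y) (pushMass_pos hp.1 hK hx h0) (Nat.cast_nonneg _) ?_
      hcard hs hs1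
    exact_mod_cast Finset.card_le_card (Finset.erase_subset j S)
  simp only [Finset.mul_sum]
  rw [Finset.sum_comm]
  refine (Finset.sum_le_sum fun y _ => hy y).trans_eq ?_
  rw [Finset.sum_comm]
  exact Finset.sum_congr rfl fun a _ => Finset.sum_congr rfl fun y _ => by ring

end RandomCodebook

/-! ### Decoding error and leakage of a codebook -/

section RandomCode

variable {A B B₁ B₂ : Type*} [Fintype A] [Fintype B] [Fintype B₁] [Fintype B₂]

/-- The uniform mixture of the codewords that represent the message `w`. -/
noncomputable def mixtureOutput {M L : ℕ} (c : Fin M × Fin L → A) (K : A → B → ℝ) (w : Fin M)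
    (y : B) : ℝ :=
  1 / (L : ℝ) * ∑ l, K (c (w, l)) y

/-- The error probability of maximum-likelihood decoding is bounded by the ambiguity of the
codeword. -/
theorem exists_decoder_error_le {A B : Type*} [Fintype B] {M L : ℕ} (hM : 0 < M) (hL : 0 < L) {K : A → B → ℝ}
    (hK : ∀ a b, 0 ≤ K a b) (c : Fin M × Fin L → A) :
    ∃ dec : B → Fin M,
      Real.log 2 * ∑ w, ∑ y, (if dec y ≠ w then 1 / (M : ℝ) * mixtureOutput c K w y else 0) ≤
      1 / ((M : ℝ) * L) * ∑ j, ∑ y, K (c j) y *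
        (Real.log (∑ k, K (c k) y) - Real.log (K (c j) y)) := by
  have : Nonempty (Fin M × Fin L) := ⟨(⟨0, hM⟩, ⟨0, hL⟩)⟩
  choose best hbest using fun y => Finite.exists_max fun j => K (c j) y
  refine ⟨fun y => (best y).1, ?_⟩
  -- After a wrong decision some other codeword is at least as likely as the sent one, so the total
  -- likelihood is at least twice that of the sent codeword and the logarithmic ratio is at least
  -- `log 2`.
  have hterm : ∀ w l y, (if (best y).1 ≠ w then Real.log 2 * K (c (w, l)) y else 0) ≤
      K (c (w, l)) y * (Real.log (∑ k, K (c k) y) - Real.log (K (c (w, l)) y)) := by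
    intro w l y
    rcases (hK (c (w, l)) y).eq_or_lt with h0 | h0
    · simp [← h0]
    · have hle : K (c (w, l)) y ≤ ∑ k, K (c k) y :=
        Finset.single_le_sum (f := fun k => K (c k) y) (fun k _ => hK _ _) (Finset.mem_univ _)
      split_ifs with h
      · have h2 : 2 * K (c (w, l)) y ≤ ∑ k, K (c k) y := by
          have hne : best y ≠ (w, l) := fun h' => h (by rw [h'])
          have h3 := Finset.add_le_sum (s := Finset.univ) (f := fun k => K (c k) y)
            (fun k _ => hK _ _) (Finset.mem_univ (best y)) (Finset.mem_univ (w, l)) hne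
          have h4 := hbest y (w, l)
          linarith
        have h5 := Real.log_le_log (by positivity) h2
        rw [Real.log_mul two_ne_zero h0.ne'] at h5
        rw [mul_comm]
        exact mul_le_mul_of_nonneg_left (by linarith) h0.le
      · exact mul_nonneg h0.le (sub_nonneg.2 (Real.log_le_log h0 hle))
  have hrew : Real.log 2 * ∑ w, ∑ y, (if (best y).1 ≠ w then 1 / (M : ℝ) * mixtureOutput c K w y
      else 0) = 1 / ((M : ℝ) * L) * ∑ w, ∑ l, ∑ y,
        (if (best y).1 ≠ w then Real.log 2 * K (c (w, l)) y else 0) := by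
    simp only [Finset.mul_sum]
    refine Finset.sum_congr rfl fun w _ => ?_
    rw [Finset.sum_comm]
    refine Finset.sum_congr rfl fun y _ => ?_
    split_ifs
    · simp only [mixtureOutput, Finset.mul_sum]
      refine Finset.sum_congr rfl fun l _ => ?_
      field_simp
    · simp
  rw [hrew, Fintype.sum_prod_type]
  gcongr with w _ l _ y _
  exact hterm w l y

theorem isStochastic_mixtureOutput {A B : Type*} [Fintype B] {M L : ℕ} (hL : 0 < L) {K : A → B → ℝ} (hK : IsStochastic K)
    (c : Fin M × Fin L → A) : IsStochastic (mixtureOutput c K) := by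
  have hL' : (0 : ℝ) < L := by exact_mod_cast hL
  refine fun w => ⟨fun y => mul_nonneg (by positivity) (Finset.sum_nonneg fun l _ => (hK _).1 y), ?_⟩
  simp only [mixtureOutput, ← Finset.mul_sum]
  rw [Finset.sum_comm]
  simp [(hK _).2, hL'.ne']

/-- The information is the least average divergence of the message-conditional outputs from a common
law, so using `pushMass p K` as that law only increases it. Codewords in the support of `p` keep the
divergence finite. -/
theorem massInfo_mixtureOutput_le {M L : ℕ} (hM : 0 < M) (hL : 0 < L) {K : A → B → ℝ}
    (hK : IsStochastic K) {p : A → ℝ} (hp : p ∈ stdSimplex ℝ A) (c : Fin M × Fin L → A)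
    (hc : ∀ j, 0 < p (c j)) :
    massInfo (fun w y => 1 / (M : ℝ) * mixtureOutput c K w y) ≤
      1 / ((M : ℝ) * L) * ∑ w, ∑ l, ∑ y, K (c (w, l)) y *
        (Real.log (∑ l', K (c (w, l')) y) - Real.log (L * pushMass p K y)) := by
  have hM' : (0 : ℝ) < M := by exact_mod_cast hM
  have hL' : (0 : ℝ) < L := by exact_mod_cast hL
  have hQ0 : ∀ y, 0 ≤ pushMass p K y := fun y =>
    Finset.sum_nonneg fun a _ => mul_nonneg (hp.1 a) ((hK a).1 y)
  have hmix := isStochastic_mixtureOutput (M := M) hL hK c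
  have hQpos : ∀ w l y, 0 < K (c (w, l)) y → 0 < pushMass p K y := fun w l y h =>
    pushMass_pos hp.1 (fun a b => (hK a).1 b) (hc _) h
  have hmixpos : ∀ w y, 0 < mixtureOutput c K w y → 0 < pushMass p K y := by
    intro w y h
    by_contra hn
    have : ∀ l, K (c (w, l)) y = 0 := fun l =>
      le_antisymm (not_lt.1 fun h' => hn (hQpos w l y h')) ((hK _).1 y)
    simp [mixtureOutput, this] at h
  have hgibbs := massEntropy_le_neg_sum_mul_log
    (m := fun y => ∑ w, 1 / (M : ℝ) * mixtureOutput c K w y) (r := pushMass p K)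
    (fun y => Finset.sum_nonneg fun w _ => mul_nonneg (by positivity) ((hmix w).1 y)) hQ0
    (by rw [sum_pushMass_of_isStochastic hK, hp.2]) (by
      intro y hy
      by_contra hn
      have : ∀ w, mixtureOutput c K w y = 0 := fun w =>
        le_antisymm (not_lt.1 fun h' => hn (hmixpos w y h')) ((hmix w).1 y)
      simp [this] at hy)
  have hent : ∀ w, massEntropy (mixtureOutput c K w) =
      - ∑ y, mixtureOutput c K w y * Real.log (mixtureOutput c K w y) := by
    intro w
    rw [massEntropy, (hmix w).2, Real.negMulLog_one, sub_zero, ← Finset.sum_neg_distrib]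
    exact Finset.sum_congr rfl fun y _ => by rw [Real.negMulLog]; ring
  have hterm : ∀ w y, mixtureOutput c K w y * Real.log (mixtureOutput c K w y) -
      mixtureOutput c K w y * Real.log (pushMass p K y) = 1 / (L : ℝ) * ∑ l, K (c (w, l)) y *
        (Real.log (∑ l', K (c (w, l')) y) - Real.log (L * pushMass p K y)) := by
    intro w y
    rw [← Finset.sum_mul, ← mul_assoc]
    change mixtureOutput c K w y * _ - _ = mixtureOutput c K w y * _
    rcases ((hmix w).1 y).eq_or_lt with h | h
    · simp [← h]
    · have hQ := hmixpos w y h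
      have hs : ∑ l, K (c (w, l)) y ≠ 0 := fun h0 => by simp [mixtureOutput, h0] at h
      have : Real.log (mixtureOutput c K w y) = Real.log (∑ l', K (c (w, l')) y) - Real.log L := by
        rw [mixtureOutput, Real.log_mul (by positivity) hs]
        simp
        ring
      rw [this, Real.log_mul hL'.ne' hQ.ne']
      ring
  rw [massInfo]
  simp only [massEntropy_const_mul, hent]
  have hswap : ∀ w, ∑ l, ∑ y, K (c (w, l)) y *
      (Real.log (∑ l', K (c (w, l')) y) - Real.log (L * pushMass p K y)) =
      L * ∑ y, (mixtureOutput c K w y * Real.log (mixtureOutput c K w y) -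
        mixtureOutput c K w y * Real.log (pushMass p K y)) := by
    intro w
    rw [Finset.sum_comm, Finset.mul_sum]
    refine Finset.sum_congr rfl fun y _ => ?_
    rw [hterm, ← mul_assoc, mul_one_div_cancel hL'.ne', one_mul]
  simp only [hswap]
  refine (sub_le_sub_right hgibbs _).trans_eq ?_
  simp only [Finset.sum_mul]
  rw [Finset.sum_comm, ← Finset.sum_neg_distrib, ← Finset.sum_sub_distrib, Finset.mul_sum]
  refine Finset.sum_congr rfl fun w _ => ?_
  rw [Finset.sum_sub_distrib]
  simp only [mul_assoc, ← Finset.mul_sum]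
  field_simp
  ring

/-- Random coding: some codebook has both a small error probability and a small leakage. -/
theorem exists_codebook {M L : ℕ} (hM : 0 < M) (hL : 0 < L) {K₁ : A → B₁ → ℝ} {K₂ : A → B₂ → ℝ}
    (hK₁ : IsStochastic K₁) (hK₂ : IsStochastic K₂) {p : A → ℝ} (hp : p ∈ stdSimplex ℝ A)
    {s t : ℝ} (hs : 0 < s) (hs1 : s ≤ 1) (ht : 0 < t) (ht1 : t ≤ 1) :
    ∃ (c : Fin M × Fin L → A) (dec : B₁ → Fin M),
      Real.log 2 * (∑ w, ∑ y, if dec y ≠ w then 1 / (M : ℝ) * mixtureOutput c K₁ w y else 0) +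
        massInfo (fun w y => 1 / (M : ℝ) * mixtureOutput c K₂ w y) ≤
      ((M : ℝ) * L) ^ s / s * (∑ a, ∑ y, p a * (K₁ a y * (pushMass p K₁ y / K₁ a y) ^ s)) +
      (L : ℝ)⁻¹ ^ t / t * (∑ a, ∑ y, p a * (K₂ a y * (K₂ a y / pushMass p K₂ y) ^ t)) := by
  have hM' : (0 : ℝ) < M := by exact_mod_cast hM
  have hL' : (0 : ℝ) < L := by exact_mod_cast hL
  set E₁ := ((M : ℝ) * L) ^ s / s * (∑ a, ∑ y, p a * (K₁ a y * (pushMass p K₁ y / K₁ a y) ^ s))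
  set E₂ := (L : ℝ)⁻¹ ^ t / t * (∑ a, ∑ y, p a * (K₂ a y * (K₂ a y / pushMass p K₂ y) ^ t))
  set F₁ : Fin M × Fin L → (Fin M × Fin L → A) → ℝ := fun j c =>
    ∑ y, K₁ (c j) y * (Real.log (∑ k, K₁ (c k) y) - Real.log (K₁ (c j) y)) with hF₁
  set F₂ : Fin M × Fin L → (Fin M × Fin L → A) → ℝ := fun j c =>
    ∑ y, K₂ (c j) y * (Real.log (∑ l, K₂ (c (j.1, l)) y) - Real.log (L * pushMass p K₂ y)) with hF₂
  have h1 : ∀ j, ∑ c, codebookWeight p c * F₁ j c ≤ E₁ := by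
    intro j
    simpa using sum_codebookWeight_mul_ambiguity_le hp (fun a b => (hK₁ a).1 b) hs hs1 j
  have h2 : ∀ j, ∑ c, codebookWeight p c * F₂ j c ≤ E₂ := by
    intro j
    have := sum_codebookWeight_mul_leakage_le hp (fun a b => (hK₂ a).1 b) ht ht1 j
      (({j.1} : Finset (Fin M)) ×ˢ (Finset.univ : Finset (Fin L))) (by simp)
    simpa [Finset.sum_product] using this
  set F : (Fin M × Fin L → A) → ℝ := fun c => 1 / ((M : ℝ) * L) * ∑ j, (F₁ j c + F₂ j c) with hF
  have hsum : ∑ c, codebookWeight p c * F c ≤ E₁ + E₂ := by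
    have : ∑ c, codebookWeight p c * F c = 1 / ((M : ℝ) * L) *
        ∑ j, (∑ c, codebookWeight p c * F₁ j c + ∑ c, codebookWeight p c * F₂ j c) := by
      simp only [hF, Finset.mul_sum, ← Finset.sum_add_distrib]
      rw [Finset.sum_comm]
      exact Finset.sum_congr rfl fun j _ => Finset.sum_congr rfl fun c _ => by ring
    rw [this]
    calc _ ≤ 1 / ((M : ℝ) * L) * ∑ j : Fin M × Fin L, (E₁ + E₂) := by
          gcongr with j _
          · exact h1 j
          · exact h2 j
      _ = E₁ + E₂ := by
          simp
          field_simp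
  -- Averaging the sum of the two criteria yields one codebook good for both. It is chosen with
  -- positive weight so that its codewords lie in the support of `p`.
  obtain ⟨c, hc0, hc⟩ : ∃ c : Fin M × Fin L → A, 0 < codebookWeight p c ∧ F c ≤ E₁ + E₂ := by
    by_contra! hcon
    have hw : ∀ c : Fin M × Fin L → A, 0 ≤ codebookWeight p c := fun c =>
      Finset.prod_nonneg fun k _ => hp.1 _
    have htot := sum_codebookWeight (ι := Fin M × Fin L) hp.2
    have hex : ∃ c : Fin M × Fin L → A, 0 < codebookWeight p c := by
      by_contra! h
      have := Finset.sum_nonpos fun c (_ : c ∈ Finset.univ) => h c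
      linarith
    obtain ⟨c₀, hc₀⟩ := hex
    have hlt : ∑ c : Fin M × Fin L → A, codebookWeight p c * (E₁ + E₂) <
        ∑ c, codebookWeight p c * F c := by
      refine Finset.sum_lt_sum (fun c _ => ?_) ⟨c₀, Finset.mem_univ _, ?_⟩
      · rcases (hw c).eq_or_lt with h | h
        · simp [← h]
        · exact mul_le_mul_of_nonneg_left (hcon c h).le h.le
      · exact mul_lt_mul_of_pos_left (hcon c₀ hc₀) hc₀
    rw [← Finset.sum_mul, htot] at hlt
    linarith
  have hpos : ∀ j, 0 < p (c j) := fun j =>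
    lt_of_le_of_ne (hp.1 _) fun h => hc0.ne' (Finset.prod_eq_zero (Finset.mem_univ j) h.symm)
  obtain ⟨dec, hdec⟩ := exists_decoder_error_le hM hL (fun a b => (hK₁ a).1 b) c
  refine ⟨c, dec, (add_le_add hdec (massInfo_mixtureOutput_le hM hL hK₂ hp c hpos)).trans ?_⟩
  refine le_trans (le_of_eq ?_) hc
  rw [hF]
  simp only [Finset.sum_add_distrib, mul_add]
  congr 2
  rw [Fintype.sum_prod_type]

end RandomCode

/-! ### Error exponents and the coding theorem -/

section CodingTheorem

/-- Gibbs' inequality for every row, with the normalised column marginal as reference law. -/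
theorem massInfo_nonneg {α β : Type*} [Fintype α] [Fintype β] {m : α → β → ℝ}
    (hm : ∀ a b, 0 ≤ m a b) : 0 ≤ massInfo m := by
  set Q : β → ℝ := fun b => ∑ a, m a b with hQ
  have hQ0 : ∀ b, 0 ≤ Q b := fun b => Finset.sum_nonneg fun a _ => hm a b
  have hle : ∀ a b, m a b ≤ Q b := fun a b =>
    Finset.single_le_sum (f := fun a => m a b) (fun a _ => hm a b) (Finset.mem_univ a)
  rcases (Finset.sum_nonneg fun b (_ : b ∈ Finset.univ) => hQ0 b).eq_or_lt with hT | hT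
  · have hz : ∀ a b, m a b = 0 := fun a b => by
      have := (Finset.sum_eq_zero_iff_of_nonneg fun b _ => hQ0 b).1 hT.symm b (Finset.mem_univ b)
      exact le_antisymm (this ▸ hle a b) (hm a b)
    simp [massInfo, hz, massEntropy]
  · set T := ∑ b, Q b with hTdef
    have hg : ∀ a, massEntropy (m a) ≤ - ∑ b, m a b * Real.log (Q b / T) := fun a =>
      massEntropy_le_neg_sum_mul_log (hm a) (fun b => div_nonneg (hQ0 b) hT.le)
        (by rw [← Finset.sum_div, div_self hT.ne'])
        fun b hb => div_pos (hb.trans_le (hle a b)) hT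
    have hsum := Finset.sum_le_sum fun a (_ : a ∈ Finset.univ) => hg a
    have heq : ∑ a, - ∑ b, m a b * Real.log (Q b / T) = massEntropy Q := by
      rw [Finset.sum_neg_distrib, Finset.sum_comm]
      have : ∀ b, ∑ a, m a b * Real.log (Q b / T) = Q b * Real.log T * (-1) - Real.negMulLog (Q b) := by
        intro b
        rw [← Finset.sum_mul]
        change Q b * _ = _
        rcases (hQ0 b).eq_or_lt with h | h
        · simp [← h]
        · rw [Real.log_div h.ne' hT.ne', Real.negMulLog]
          ring
      simp only [this]
      rw [Finset.sum_sub_distrib, ← Finset.sum_mul, ← Finset.sum_mul, massEntropy, ← hTdef,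
        Real.negMulLog]
      ring
    rw [heq] at hsum
    exact sub_nonneg.2 hsum

/-- A finite random variable with negative mean has a small exponential moment below one. -/
theorem exists_sum_mul_exp_lt_one {ι : Type*} [Fintype ι] {w x : ι → ℝ} (hw : ∑ i, w i = 1)
    (hx : ∑ i, w i * x i < 0) : ∃ s : ℝ, 0 < s ∧ s ≤ 1 ∧ ∑ i, w i * Real.exp (s * x i) < 1 := by
  -- The exponential moment equals one at `s = 0` and its derivative there is the mean.
  have hd : HasDerivAt (fun s : ℝ => ∑ i, w i * Real.exp (s * x i)) (∑ i, w i * x i) 0 := by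
    refine HasDerivAt.fun_sum fun i _ => ?_
    have h1 : HasDerivAt (fun s : ℝ => s * x i) (x i) 0 := by
      simpa using (hasDerivAt_id (0 : ℝ)).mul_const (x i)
    simpa using (h1.exp.const_mul (w i))
  have ht := hasDerivAt_iff_tendsto_slope_zero.1 hd
  have hev := (ht.mono_left (nhdsWithin_mono 0 (fun s (hs : s ∈ Set.Ioi (0 : ℝ)) => ne_of_gt hs))
    ).eventually (gt_mem_nhds hx)
  obtain ⟨s, hs, hs'⟩ := (hev.and (Ioo_mem_nhdsGT (zero_lt_one (α := ℝ)))).exists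
  refine ⟨s, hs'.1, hs'.2.le, ?_⟩
  simp only [zero_add, zero_mul, Real.exp_zero, mul_one, hw, smul_eq_mul] at hs
  by_contra! hcon
  have := mul_nonneg (inv_nonneg.2 hs'.1.le) (sub_nonneg.2 hcon)
  linarith

/-! ### Single-letter exponents and their powers -/

section Single

variable {V Y : Type*} [Fintype V] [Fintype Y]

theorem massInfo_eq_sum_log {p : V → ℝ} {K : V → Y → ℝ} (hp : ∑ v, p v = 1)
    (hK : IsStochastic K) :
    massInfo (fun v y => p v * K v y) =
      ∑ v, ∑ y, p v * K v y * (Real.log (K v y) - Real.log (pushMass p K y)) := by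
  have h1 : ∀ v, massEntropy (K v) = - ∑ y, K v y * Real.log (K v y) := by
    intro v
    rw [massEntropy, (hK v).2, Real.negMulLog_one, sub_zero, ← Finset.sum_neg_distrib]
    exact Finset.sum_congr rfl fun y _ => by rw [Real.negMulLog]; ring
  have h2 : massEntropy (pushMass p K) = - ∑ y, pushMass p K y * Real.log (pushMass p K y) := by
    rw [massEntropy, sum_pushMass_of_isStochastic hK, hp, Real.negMulLog_one, sub_zero,
      ← Finset.sum_neg_distrib]
    exact Finset.sum_congr rfl fun y _ => by rw [Real.negMulLog]; ring
  rw [massInfo]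
  simp only [massEntropy_const_mul, h1]
  change massEntropy (pushMass p K) - _ = _
  rw [h2]
  conv_lhs => enter [1, 1, 2, y]; rw [pushMass, Finset.sum_mul]
  rw [Finset.sum_comm, ← Finset.sum_neg_distrib, ← Finset.sum_sub_distrib]
  refine Finset.sum_congr rfl fun v _ => ?_
  simp only [mul_sub, Finset.sum_sub_distrib, mul_neg, Finset.mul_sum, pushMass, mul_assoc]
  ring

/-- The variable `log (pushMass p K y / K v y) + r` has mean `r` minus the information, which is
negative; a small exponential moment is therefore below one. -/
theorem exists_exponent_lt_information {p : V → ℝ} (hp : p ∈ stdSimplex ℝ V) {K : V → Y → ℝ}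
    (hK : IsStochastic K) {r : ℝ} (hr : r < massInfo (fun v y => p v * K v y)) :
    ∃ s : ℝ, 0 < s ∧ s ≤ 1 ∧
      Real.exp (s * r) * ∑ v, ∑ y, p v * (K v y * (pushMass p K y / K v y) ^ s) < 1 := by
  have htot : ∑ i : V × Y, p i.1 * K i.1 i.2 = 1 := by
    rw [Fintype.sum_prod_type]
    simp only [← Finset.mul_sum, (hK _).2, mul_one, hp.2]
  have hneg : ∑ i : V × Y, p i.1 * K i.1 i.2 *
      (Real.log (pushMass p K i.2) - Real.log (K i.1 i.2) + r) < 0 := by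
    rw [massInfo_eq_sum_log hp.2 hK] at hr
    have h : ∑ i : V × Y, p i.1 * K i.1 i.2 *
        (Real.log (pushMass p K i.2) - Real.log (K i.1 i.2) + r) = r * ∑ i : V × Y, p i.1 * K i.1 i.2 -
        ∑ v, ∑ y, p v * K v y * (Real.log (K v y) - Real.log (pushMass p K y)) := by
      rw [Finset.mul_sum, Fintype.sum_prod_type, Fintype.sum_prod_type, ← Finset.sum_sub_distrib]
      refine Finset.sum_congr rfl fun v _ => ?_
      rw [← Finset.sum_sub_distrib]
      exact Finset.sum_congr rfl fun y _ => by ring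
    rw [h, htot]
    linarith
  obtain ⟨s, hs, hs1, hlt⟩ := exists_sum_mul_exp_lt_one htot hneg
  refine ⟨s, hs, hs1, lt_of_eq_of_lt ?_ hlt⟩
  rw [Finset.mul_sum, Fintype.sum_prod_type]
  refine Finset.sum_congr rfl fun v _ => ?_
  rw [Finset.mul_sum]
  refine Finset.sum_congr rfl fun y _ => ?_
  rcases (hp.1 v).eq_or_lt with h | h
  · simp [← h]
  rcases ((hK v).1 y).eq_or_lt with h' | h'
  · simp [← h']
  have hQ := pushMass_pos hp.1 (fun a b => (hK a).1 b) h h'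
  rw [Real.rpow_def_of_pos (div_pos hQ h'), Real.log_div hQ.ne' h'.ne', mul_left_comm,
    mul_left_comm (Real.exp _), ← Real.exp_add, ← mul_assoc]
  ring_nf

theorem exists_exponent_gt_information {p : V → ℝ} (hp : p ∈ stdSimplex ℝ V) {K : V → Y → ℝ}
    (hK : IsStochastic K) {r : ℝ} (hr : massInfo (fun v y => p v * K v y) < r) :
    ∃ s : ℝ, 0 < s ∧ s ≤ 1 ∧
      Real.exp (-(s * r)) * ∑ v, ∑ y, p v * (K v y * (K v y / pushMass p K y) ^ s) < 1 := by
  have htot : ∑ i : V × Y, p i.1 * K i.1 i.2 = 1 := by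
    rw [Fintype.sum_prod_type]
    simp only [← Finset.mul_sum, (hK _).2, mul_one, hp.2]
  have hneg : ∑ i : V × Y, p i.1 * K i.1 i.2 *
      (Real.log (K i.1 i.2) - Real.log (pushMass p K i.2) - r) < 0 := by
    rw [massInfo_eq_sum_log hp.2 hK] at hr
    have h : ∑ i : V × Y, p i.1 * K i.1 i.2 *
        (Real.log (K i.1 i.2) - Real.log (pushMass p K i.2) - r) =
        ∑ v, ∑ y, p v * K v y * (Real.log (K v y) - Real.log (pushMass p K y)) -
        r * ∑ i : V × Y, p i.1 * K i.1 i.2 := by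
      rw [Finset.mul_sum, Fintype.sum_prod_type, Fintype.sum_prod_type, ← Finset.sum_sub_distrib]
      refine Finset.sum_congr rfl fun v _ => ?_
      rw [← Finset.sum_sub_distrib]
      exact Finset.sum_congr rfl fun y _ => by ring
    rw [h, htot]
    linarith
  obtain ⟨s, hs, hs1, hlt⟩ := exists_sum_mul_exp_lt_one htot hneg
  refine ⟨s, hs, hs1, lt_of_eq_of_lt ?_ hlt⟩
  rw [Finset.mul_sum, Fintype.sum_prod_type]
  refine Finset.sum_congr rfl fun v _ => ?_
  rw [Finset.mul_sum]
  refine Finset.sum_congr rfl fun y _ => ?_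
  rcases (hp.1 v).eq_or_lt with h | h
  · simp [← h]
  rcases ((hK v).1 y).eq_or_lt with h' | h'
  · simp [← h']
  have hQ := pushMass_pos hp.1 (fun a b => (hK a).1 b) h h'
  rw [Real.rpow_def_of_pos (div_pos h' hQ), Real.log_div h'.ne' hQ.ne', mul_left_comm,
    mul_left_comm (Real.exp _), ← Real.exp_add, ← mul_assoc]
  ring_nf

theorem sum_sum_prod_eq_pow (f : V → Y → ℝ) (n : ℕ) :
    ∑ a : Fin n → V, ∑ y : Fin n → Y, ∏ i, f (a i) (y i) = (∑ v, ∑ y, f v y) ^ n := by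
  classical
  simp only [fun a : Fin n → V => sum_prod_eq_prod_sum fun i y => f (a i) y]
  rw [sum_prod_eq_prod_sum fun _ v => ∑ y, f v y]
  simp

theorem pushMass_codebookWeight_blockKernel {V Y : Type*} [Fintype V] (p : V → ℝ) (K : V → Y → ℝ) (n : ℕ) (y : Fin n → Y) :
    pushMass (codebookWeight p) (blockKernel K n) y = ∏ i, pushMass p K (y i) := by
  classical
  simp only [pushMass, codebookWeight, blockKernel, ← Finset.prod_mul_distrib]
  exact sum_prod_eq_prod_sum fun i v => p v * K v (y i)

theorem pushMass_blockKernel {V X Y : Type*} [Fintype X] (ρ : V → X → ℝ) (K : X → Y → ℝ) (n : ℕ)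
    (a : Fin n → V) (y : Fin n → Y) :
    pushMass (blockKernel ρ n a) (blockKernel K n) y =
      blockKernel (fun v => pushMass (ρ v) K) n a y := by
  classical
  simp only [pushMass, blockKernel, ← Finset.prod_mul_distrib]
  exact sum_prod_eq_prod_sum fun i x => ρ (a i) x * K x (y i)

/-- Independent letters and a memoryless channel make every factor a product, so the moment of the
block is a power of the single-letter one. -/
theorem sum_codebookWeight_blockKernel_ambiguity {p : V → ℝ} (hp : ∀ v, 0 ≤ p v) {K : V → Y → ℝ}
    (hK : IsStochastic K) (n : ℕ) (s : ℝ) :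
    ∑ a : Fin n → V, ∑ y, codebookWeight p a * (blockKernel K n a y *
      (pushMass (codebookWeight p) (blockKernel K n) y / blockKernel K n a y) ^ s) =
      (∑ v, ∑ y, p v * (K v y * (pushMass p K y / K v y) ^ s)) ^ n := by
  have hQ0 : ∀ y, 0 ≤ pushMass p K y := fun y =>
    Finset.sum_nonneg fun a _ => mul_nonneg (hp a) ((hK a).1 y)
  rw [← sum_sum_prod_eq_pow]
  refine Finset.sum_congr rfl fun a _ => Finset.sum_congr rfl fun y _ => ?_
  rw [pushMass_codebookWeight_blockKernel, blockKernel, ← Finset.prod_div_distrib,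
    ← Real.finsetProd_rpow _ _ fun i _ => div_nonneg (hQ0 _) ((hK _).1 _), codebookWeight,
    Finset.prod_mul_distrib, Finset.prod_mul_distrib]

theorem sum_codebookWeight_blockKernel_leakage {p : V → ℝ} (hp : ∀ v, 0 ≤ p v) {K : V → Y → ℝ}
    (hK : IsStochastic K) (n : ℕ) (s : ℝ) :
    ∑ a : Fin n → V, ∑ y, codebookWeight p a * (blockKernel K n a y *
      (blockKernel K n a y / pushMass (codebookWeight p) (blockKernel K n) y) ^ s) =
      (∑ v, ∑ y, p v * (K v y * (K v y / pushMass p K y) ^ s)) ^ n := by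
  have hQ0 : ∀ y, 0 ≤ pushMass p K y := fun y =>
    Finset.sum_nonneg fun a _ => mul_nonneg (hp a) ((hK a).1 y)
  rw [← sum_sum_prod_eq_pow]
  refine Finset.sum_congr rfl fun a _ => Finset.sum_congr rfl fun y _ => ?_
  rw [pushMass_codebookWeight_blockKernel, blockKernel, ← Finset.prod_div_distrib,
    ← Real.finsetProd_rpow _ _ fun i _ => div_nonneg ((hK _).1 _) (hQ0 _), codebookWeight,
    Finset.prod_mul_distrib, Finset.prod_mul_distrib]

end Single

variable {V X Y₁ Y₂ : Type*} [Fintype V] [Fintype X] [Fintype Y₁] [Fintype Y₂]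

theorem isStochastic_pushMass {V X Y : Type*} [Fintype X] [Fintype Y] {ρ : V → X → ℝ}
    {K : X → Y → ℝ} (hρ : IsStochastic ρ) (hK : IsStochastic K) :
    IsStochastic fun v => pushMass (ρ v) K := fun v =>
  ⟨fun y => Finset.sum_nonneg fun x _ => mul_nonneg ((hρ v).1 x) ((hK x).1 y), by
    rw [sum_pushMass_of_isStochastic hK, (hρ v).2]⟩

/-- A codebook over the prefix alphabet `V`, sent letter by letter through `ρ`, is a stochastic
encoder over `X`; its output over `K` is that of the codebook over the composed channel. -/
theorem pushMass_mixtureOutput {n M L : ℕ} {V X Y : Type*} [Fintype X] [Fintype Y]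
    (c : Fin M × Fin L → (Fin n → V)) (ρ : V → X → ℝ) (K : X → Y → ℝ) (w : Fin M) :
    pushMass (mixtureOutput c (blockKernel ρ n) w) (blockKernel K n) =
      mixtureOutput c (blockKernel (fun v => pushMass (ρ v) K) n) w := by
  ext y
  simp only [mixtureOutput, ← pushMass_blockKernel]
  simp only [pushMass, mixtureOutput, Finset.mul_sum, Finset.sum_mul, mul_assoc]
  rw [Finset.sum_comm]

/-- The secret coding theorem for a channel `K₁` to the receiver and `K₂` to the eavesdropper:
every rate (in nats) below the information gap is achieved at all large block lengths. -/
theorem eventually_exists_secret_code {K₁ : X → Y₁ → ℝ} {K₂ : X → Y₂ → ℝ} (hK₁ : IsStochastic K₁)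
    (hK₂ : IsStochastic K₂) {p : V → ℝ} (hp : p ∈ stdSimplex ℝ V) {ρ : V → X → ℝ}
    (hρ : IsStochastic ρ) {R : ℝ} (hR0 : 0 ≤ R)
    (hR : R < secrecyGap K₁ K₂ fun v x => p v * ρ v x) {ε : ℝ} (hε : 0 < ε) :
    ∀ᶠ n : ℕ in Filter.atTop, ∃ (M : ℕ) (enc : Fin M → (Fin n → X) → ℝ)
      (dec : (Fin n → Y₁) → Fin M), 0 < M ∧ IsStochastic enc ∧ Real.exp (n * R) ≤ M ∧
      (∑ w, ∑ y, if dec y ≠ w then 1 / (M : ℝ) * pushMass (enc w) (blockKernel K₁ n) y else 0) ≤ ε ∧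
      Real.log M - residualEntropy enc (blockKernel K₂ n) ≤ ε := by
  set T₁ : V → Y₁ → ℝ := fun v => pushMass (ρ v) K₁ with hT₁def
  set T₂ : V → Y₂ → ℝ := fun v => pushMass (ρ v) K₂ with hT₂def
  have hT₁ : IsStochastic T₁ := isStochastic_pushMass hρ hK₁
  have hT₂ : IsStochastic T₂ := isStochastic_pushMass hρ hK₂
  simp only [secrecyGap, pushMass_const_mul] at hR
  set I₁ := massInfo fun v y => p v * T₁ v y with hI₁
  set I₂ := massInfo fun v y => p v * T₂ v y with hI₂
  have hI₂0 : 0 ≤ I₂ := massInfo_nonneg fun v y => mul_nonneg (hp.1 v) ((hT₂ v).1 y)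
  change R < I₁ - I₂ at hR
  -- `r` is the rate of local randomness: above `I₂` it saturates the eavesdropper, while `R + r <
  -- I₁` lets the receiver decode message and randomness together.
  obtain ⟨r, hr1, hr2⟩ : ∃ r, I₂ < r ∧ r < I₁ - R := exists_between (by linarith)
  obtain ⟨s, hs, hs1, hΦ₁⟩ := exists_exponent_lt_information hp hT₁ (r := R + r) (by linarith)
  obtain ⟨t, ht, ht1, hΦ₂⟩ := exists_exponent_gt_information hp hT₂ hr1
  set Φ₁ := ∑ v, ∑ y, p v * (T₁ v y * (pushMass p T₁ y / T₁ v y) ^ s) with hΦ₁def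
  set Φ₂ := ∑ v, ∑ y, p v * (T₂ v y * (T₂ v y / pushMass p T₂ y) ^ t) with hΦ₂def
  have hΦ₁0 : 0 ≤ Φ₁ := Finset.sum_nonneg fun v _ => Finset.sum_nonneg fun y _ =>
    mul_nonneg (hp.1 v) (mul_nonneg ((hT₁ v).1 y) (Real.rpow_nonneg (div_nonneg
      (Finset.sum_nonneg fun a _ => mul_nonneg (hp.1 a) ((hT₁ a).1 y)) ((hT₁ v).1 y)) _))
  have hΦ₂0 : 0 ≤ Φ₂ := Finset.sum_nonneg fun v _ => Finset.sum_nonneg fun y _ =>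
    mul_nonneg (hp.1 v) (mul_nonneg ((hT₂ v).1 y) (Real.rpow_nonneg (div_nonneg
      ((hT₂ v).1 y) (Finset.sum_nonneg fun a _ => mul_nonneg (hp.1 a) ((hT₂ a).1 y))) _))
  have hlim : Filter.Tendsto (fun n : ℕ => 4 ^ s / s * (Real.exp (s * (R + r)) * Φ₁) ^ n +
      1 / t * (Real.exp (-(t * r)) * Φ₂) ^ n) Filter.atTop (nhds 0) := by
    have h1 := (tendsto_pow_atTop_nhds_zero_of_lt_one (mul_nonneg (Real.exp_pos _).le hΦ₁0)
      hΦ₁).const_mul (4 ^ s / s)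
    have h2 := (tendsto_pow_atTop_nhds_zero_of_lt_one (mul_nonneg (Real.exp_pos _).le hΦ₂0)
      hΦ₂).const_mul (1 / t)
    simpa using h1.add h2
  have hlog2 : 0 < Real.log 2 := Real.log_pos one_lt_two
  have hlog2' : Real.log 2 < 1 := Real.log_two_lt_d9.trans (by norm_num)
  -- The error is weighted by `log 2` and the leakage by one, both nonnegative; the threshold `log 2
  -- * ε` controls both since `log 2 < 1`.
  filter_upwards [hlim.eventually (gt_mem_nhds (mul_pos hlog2 hε))] with n hn
  set M := ⌈Real.exp (n * R)⌉₊ with hM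
  set L := ⌈Real.exp (n * r)⌉₊ with hL
  have hMpos : 0 < M := Nat.ceil_pos.2 (Real.exp_pos _)
  have hLpos : 0 < L := Nat.ceil_pos.2 (Real.exp_pos _)
  have hMpos' : (0 : ℝ) < M := by exact_mod_cast hMpos
  have hLpos' : (0 : ℝ) < L := by exact_mod_cast hLpos
  have hMge : Real.exp (n * R) ≤ M := Nat.le_ceil _
  have hLge : Real.exp (n * r) ≤ L := Nat.le_ceil _
  -- Rounding up at most doubles a number that is at least one; rounding both `M` and `L` produces
  -- the constant `4`.
  have hMle : (M : ℝ) ≤ 2 * Real.exp (n * R) := by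
    have h1 := Nat.ceil_lt_add_one (Real.exp_pos (n * R)).le
    have h2 := Real.one_le_exp (x := n * R) (by positivity)
    linarith
  have hLle : (L : ℝ) ≤ 2 * Real.exp (n * r) := by
    have h1 := Nat.ceil_lt_add_one (Real.exp_pos (n * r)).le
    have h2 := Real.one_le_exp (x := n * r) (mul_nonneg (Nat.cast_nonneg _) (by linarith))
    linarith
  have hpn : codebookWeight p ∈ stdSimplex ℝ (Fin n → V) := by
    classical
    exact ⟨fun a => Finset.prod_nonneg fun i _ => hp.1 _, sum_codebookWeight hp.2⟩
  obtain ⟨c, dec, hc⟩ := exists_codebook hMpos hLpos (isStochastic_blockKernel hT₁ n)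
    (isStochastic_blockKernel hT₂ n) hpn hs hs1 ht ht1
  rw [sum_codebookWeight_blockKernel_ambiguity hp.1 hT₁,
    sum_codebookWeight_blockKernel_leakage hp.1 hT₂, ← hΦ₁def, ← hΦ₂def] at hc
  have hE₁ : ((M : ℝ) * L) ^ s / s * Φ₁ ^ n ≤ 4 ^ s / s * (Real.exp (s * (R + r)) * Φ₁) ^ n := by
    have h1 : (M : ℝ) * L ≤ 4 * Real.exp (n * (R + r)) := by
      calc (M : ℝ) * L ≤ (2 * Real.exp (n * R)) * (2 * Real.exp (n * r)) := by gcongr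
        _ = _ := by rw [mul_add, Real.exp_add]; ring
    have h2 : ((M : ℝ) * L) ^ s ≤ 4 ^ s * Real.exp (s * (R + r)) ^ n := by
      calc ((M : ℝ) * L) ^ s ≤ (4 * Real.exp (n * (R + r))) ^ s := by gcongr
        _ = _ := by
          rw [Real.mul_rpow (by norm_num) (Real.exp_pos _).le, ← Real.exp_mul, ← Real.exp_nat_mul]
          ring_nf
    calc _ ≤ (4 ^ s * Real.exp (s * (R + r)) ^ n) / s * Φ₁ ^ n := by gcongr
      _ = _ := by rw [mul_pow]; ring
  have hE₂ : (L : ℝ)⁻¹ ^ t / t * Φ₂ ^ n ≤ 1 / t * (Real.exp (-(t * r)) * Φ₂) ^ n := by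
    have h2 : (L : ℝ)⁻¹ ^ t ≤ Real.exp (-(t * r)) ^ n := by
      calc (L : ℝ)⁻¹ ^ t ≤ (Real.exp (n * r))⁻¹ ^ t := by gcongr
        _ = _ := by
          rw [← Real.exp_neg, ← Real.exp_mul, ← Real.exp_nat_mul]
          ring_nf
    calc _ ≤ (Real.exp (-(t * r)) ^ n) / t * Φ₂ ^ n := by gcongr
      _ = _ := by rw [mul_pow]; ring
  have hmix₁ := isStochastic_mixtureOutput (M := M) hLpos (isStochastic_blockKernel hT₁ n) c
  have hmix₂ := isStochastic_mixtureOutput (M := M) hLpos (isStochastic_blockKernel hT₂ n) c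
  have herr0 : 0 ≤ ∑ w, ∑ y, if dec y ≠ w then
      1 / (M : ℝ) * mixtureOutput c (blockKernel T₁ n) w y else 0 := by
    refine Finset.sum_nonneg fun w _ => Finset.sum_nonneg fun y _ => ?_
    split_ifs
    · exact mul_nonneg (by positivity) ((hmix₁ w).1 y)
    · exact le_rfl
  have hinfo0 : 0 ≤ massInfo fun w y => 1 / (M : ℝ) * mixtureOutput c (blockKernel T₂ n) w y :=
    massInfo_nonneg fun w y => mul_nonneg (by positivity) ((hmix₂ w).1 y)
  have henc := isStochastic_mixtureOutput (M := M) hLpos (isStochastic_blockKernel hρ n) c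
  refine ⟨M, mixtureOutput c (blockKernel ρ n), dec, hMpos, henc, hMge, ?_, ?_⟩
  · simp only [pushMass_mixtureOutput]
    exact le_of_mul_le_mul_left (by linarith) hlog2
  · rw [← massInfo_uniform hMpos henc (isStochastic_blockKernel hK₂ n)]
    simp only [pushMass_const_mul, pushMass_mixtureOutput]
    have : Real.log 2 * ε ≤ ε := mul_le_of_le_one_left hε.le hlog2'.le
    have := mul_nonneg hlog2.le herr0
    linarith

/-- The degenerate code with a single message. -/
theorem exists_trivial_code [Nonempty X] (K₁ : X → Y₁ → ℝ) (K₂ : X → Y₂ → ℝ) (n : ℕ) :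
    ∃ (enc : Fin 1 → (Fin n → X) → ℝ) (dec : (Fin n → Y₁) → Fin 1), IsStochastic enc ∧
      (∑ w, ∑ y, if dec y ≠ w then
        1 / ((1 : ℕ) : ℝ) * pushMass (enc w) (blockKernel K₁ n) y else 0) = 0 ∧
      residualEntropy enc (blockKernel K₂ n) = 0 := by
  classical
  obtain ⟨x₀⟩ := ‹Nonempty X›
  refine ⟨fun _ => _, fun _ => 0, fun _ => single_mem_stdSimplex ℝ fun _ => x₀, ?_, ?_⟩
  · simp
  · simp [residualEntropy, massEntropy_unique]

end CodingTheorem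

/-! ### Separating the observation of one transmitter -/

section Observation

variable {X X' Y O : Type*} [Fintype X] [Fintype X'] [Fintype Y] [Fintype O]

open Classical in
/-- The output of the two-input channel `W` consists of the output of `K`, which depends on the first
input only, and of a remainder which given that output depends on the second input only. -/
def Observes {X X' Y O : Type*} [Fintype Y] (W : X → X' → Y → ℝ) (K : X → O → ℝ) : Prop :=
  ∃ (e : Y → O) (g : X' → Y → ℝ), (∀ x x' y, W x x' y = K x (e y) * g x' y) ∧
    ∀ x' o, ∑ y, (if e y = o then g x' y else 0) = 1

/-- The memoryless `n`-fold use of a channel with two inputs. -/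
def blockChannel {X X' Y : Type*} (W : X → X' → Y → ℝ) (n : ℕ) (x : Fin n → X) (x' : Fin n → X')
    (y : Fin n → Y) : ℝ :=
  ∏ i, W (x i) (x' i) (y i)

theorem Observes.block {X X' Y O : Type*} [Fintype Y] {W : X → X' → Y → ℝ} {K : X → O → ℝ}
    (h : Observes W K) (n : ℕ) :
    Observes (blockChannel W n) (blockKernel K n) := by
  classical
  obtain ⟨e, g, hW, hg⟩ := h
  refine ⟨fun y i => e (y i), fun x' y => ∏ i, g (x' i) (y i), fun x x' y => ?_, fun x' o => ?_⟩
  · simp only [hW, blockChannel, blockKernel, Finset.prod_mul_distrib]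
  · have h1 := sum_prod_eq_prod_sum fun i y => if e y = o i then g (x' i) y else 0
    rw [Finset.prod_congr rfl fun i _ => hg (x' i) (o i), Finset.prod_const_one] at h1
    rw [← h1]
    refine Finset.sum_congr rfl fun y _ => ?_
    rw [Fintype.prod_ite_zero]
    simp only [funext_iff]
    congr

-- Averaging over an independent second input keeps the splitting. The pair `e`, `b` is chosen
-- before `μ`, so the same noise serves every message.
open Classical in
theorem Observes.exists_factor {X X' Y O : Type*} [Fintype X] [Fintype X'] [Fintype Y]
    {W : X → X' → Y → ℝ} {K : X → O → ℝ} (h : Observes W K) {ν : X' → ℝ} (hν : ∑ x', ν x' = 1) :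
    ∃ (e : Y → O) (b : Y → ℝ), (∀ o, ∑ y, (if e y = o then b y else 0) = 1) ∧
      ∀ (μ : X → ℝ) (y : Y),
        ∑ x, ∑ x', μ x * ν x' * W x x' y = pushMass μ K (e y) * b y := by
  obtain ⟨e, g, hW, hg⟩ := h
  refine ⟨e, fun y => ∑ x', ν x' * g x' y, fun o => ?_, fun μ y => ?_⟩
  · have h1 : ∀ y, (if e y = o then ∑ x', ν x' * g x' y else 0) =
        ∑ x', ν x' * (if e y = o then g x' y else 0) := by
      intro y
      split_ifs <;> simp
    simp only [h1]
    rw [Finset.sum_comm]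
    simp only [← Finset.mul_sum, hg, mul_one, hν]
  · simp only [pushMass, Finset.sum_mul, Finset.mul_sum, hW]
    rw [Finset.sum_comm]
    exact Finset.sum_congr rfl fun x' _ => Finset.sum_congr rfl fun x _ => by ring

/-- The essential hypothesis is in `hlaw`: given `C`, the law `ν c` of the second input does not
depend on the value of `A`. -/
theorem Observes.condMutualInfo_eq {Ω α γ : Type*} [Fintype Ω] [Fintype α] [Fintype γ]
    {W : X → X' → Y → ℝ} {K : X → O → ℝ} (h : Observes W K) {q : Ω → ℝ} (hq : ∀ ω, 0 ≤ q ω)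
    {A : Ω → α} {B : Ω → Y} {C : Ω → γ} {μ : γ → α → X → ℝ} {ν : γ → X' → ℝ}
    (hν : ∀ c, ∑ x', ν c x' = 1)
    (hlaw : ∀ a y c, law q (fun ω => (A ω, B ω, C ω)) (a, y, c) =
      ∑ x, ∑ x', μ c a x * ν c x' * W x x' y) :
    condMutualInfo q A B C = (∑ c, massInfo (fun a => pushMass (μ c a) K)) / Real.log 2 := by
  rw [condMutualInfo_eq_sum_massInfo hq]
  congr 1
  refine Finset.sum_congr rfl fun c _ => ?_
  obtain ⟨e, b, hb, hf⟩ := h.exists_factor (hν c)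
  simp only [hlaw, hf]
  exact massInfo_split hb fun a => pushMass (μ c a) K

/-- The channel that erases the output of `k` with probability `1 - τ`. -/
def erasedKernel {X Z : Type*} (τ : ℝ) (k : X → Z → ℝ) (x : X) (o : Option Z) : ℝ :=
  o.elim (1 - τ) fun z => τ * k x z

theorem isStochastic_erasedKernel {X Z : Type*} [Fintype Z] {τ : ℝ} (hτ : τ ∈ Set.Icc (0 : ℝ) 1)
    {k : X → Z → ℝ} (hk : IsStochastic k) : IsStochastic (erasedKernel τ k) := by
  refine fun x => ⟨fun o => ?_, ?_⟩
  · cases o with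
    | none => exact sub_nonneg.2 hτ.2
    | some z => exact mul_nonneg hτ.1 ((hk x).1 z)
  · simp [Fintype.sum_option, erasedKernel, ← Finset.mul_sum, (hk x).2]

/-- The map `e` keeps the signal when the switch points to the observed transmitter and erases it
otherwise; the erased signal has law `k'`, which ignores the observed input. -/
theorem observes_erasedKernel {X X' Z : Type*} [Fintype Z] {k' : X' → Z → ℝ}
    (hk' : IsStochastic k') {τ : ℝ} {k : X → Z → ℝ} {W : X → X' → Z × Fin 2 → ℝ} (j : Fin 2)
    (hW : ∀ x x' z s, W x x' (z, s) = if s = j then τ * k x z else (1 - τ) * k' x' z) :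
    Observes W (erasedKernel τ k) := by
  classical
  refine ⟨fun y => if y.2 = j then some y.1 else none, fun x' y => if y.2 = j then 1 else k' x' y.1,
    fun x x' y => ?_, fun x' o => ?_⟩
  · obtain ⟨z, s⟩ := y
    rw [hW]
    by_cases h : s = j <;> simp [h, erasedKernel]
  · have hpair : ∀ j : Fin 2, ∃ j', j' ≠ j ∧ (Finset.univ : Finset (Fin 2)) = {j, j'} := by decide
    obtain ⟨j', hne, huniv⟩ := hpair j
    rw [Fintype.sum_prod_type]
    simp only [huniv, Finset.sum_pair hne.symm, if_true, if_neg hne]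
    cases o with
    | none => simpa using (hk' x').2
    | some z => simp

end Observation

/-! ### Marginal channels and laws of the coordinate variables -/

namespace InterferenceChannel

variable {X₁ X₂ Y₁ Y₂ : Type*} [Fintype X₁] [Fintype X₂] [Fintype Y₁] [Fintype Y₂]

/-- The channel from the two transmitters to receiver 1. -/
def marginal₁ {X₁ X₂ : Type*} (P : InterferenceChannel X₁ X₂ Y₁ Y₂) (x₁ : X₁) (x₂ : X₂)
    (y₁ : Y₁) : ℝ :=
  ∑ y₂, P.prob x₁ x₂ (y₁, y₂)

/-- The channel from the two transmitters to receiver 2. -/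
def marginal₂ {X₁ X₂ : Type*} (P : InterferenceChannel X₁ X₂ Y₁ Y₂) (x₁ : X₁) (x₂ : X₂)
    (y₂ : Y₂) : ℝ :=
  ∑ y₁, P.prob x₁ x₂ (y₁, y₂)

section Regions

variable {U V₁ V₂ : Type*} [Fintype U] [Fintype V₁] [Fintype V₂]

theorem law_V₁_Y₁_V₂_U (q : U × V₁ × V₂ × X₁ × X₂ × Y₁ × Y₂ → ℝ) (v₁ : V₁) (y₁ : Y₁) (v₂ : V₂)
    (u : U) :
    law q (fun ω => (rvV₁ ω, rvY₁ ω, rvV₂ ω, rvU ω)) (v₁, y₁, v₂, u) =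
      ∑ x₁, ∑ x₂, ∑ y₂, q (u, v₁, v₂, x₁, x₂, y₁, y₂) := by
  classical
  simp only [law, Fintype.sum_prod_type, Prod.mk.injEq, rvV₁, rvY₁, rvV₂, rvU]
  rw [Fintype.sum_eq_single u fun u' h => by simp [h],
    Fintype.sum_eq_single v₁ fun v h => by simp [h],
    Fintype.sum_eq_single v₂ fun v h => by simp [h]]
  refine Finset.sum_congr rfl fun x₁ _ => Finset.sum_congr rfl fun x₂ _ => ?_
  rw [Fintype.sum_eq_single y₁ fun y h => by simp [h]]
  simp

theorem law_V₁_Y₂_V₂_U (q : U × V₁ × V₂ × X₁ × X₂ × Y₁ × Y₂ → ℝ) (v₁ : V₁) (y₂ : Y₂) (v₂ : V₂)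
    (u : U) :
    law q (fun ω => (rvV₁ ω, rvY₂ ω, rvV₂ ω, rvU ω)) (v₁, y₂, v₂, u) =
      ∑ x₁, ∑ x₂, ∑ y₁, q (u, v₁, v₂, x₁, x₂, y₁, y₂) := by
  classical
  simp only [law, Fintype.sum_prod_type, Prod.mk.injEq, rvV₁, rvY₂, rvV₂, rvU]
  rw [Fintype.sum_eq_single u fun u' h => by simp [h],
    Fintype.sum_eq_single v₁ fun v h => by simp [h],
    Fintype.sum_eq_single v₂ fun v h => by simp [h]]
  refine Finset.sum_congr rfl fun x₁ _ => Finset.sum_congr rfl fun x₂ _ => ?_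
  refine Finset.sum_congr rfl fun y₁ _ => ?_
  rw [Fintype.sum_eq_single y₂ fun y h => by simp [h]]
  simp

end Regions

end InterferenceChannel

section LawPermutation

variable {Ω α β γ δ : Type*} [Fintype Ω]

theorem law_swap_first_third (q : Ω → ℝ) (A : Ω → α) (B : Ω → β) (C : Ω → γ) (D : Ω → δ)
    (a : α) (b : β) (c : γ) (d : δ) :
    law q (fun ω => (C ω, B ω, A ω, D ω)) (c, b, a, d) =
      law q (fun ω => (A ω, B ω, C ω, D ω)) (a, b, c, d) := by
  unfold law
  refine Finset.sum_congr rfl fun ω _ => ?_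
  have h : ((C ω, B ω, A ω, D ω) = (c, b, a, d)) ↔ ((A ω, B ω, C ω, D ω) = (a, b, c, d)) := by
    simp only [Prod.mk.injEq]
    tauto
  by_cases hA : (A ω, B ω, C ω, D ω) = (a, b, c, d)
  · rw [if_pos hA, if_pos (h.2 hA)]
  · rw [if_neg hA, if_neg fun hC => hA (h.1 hC)]

theorem sum_law_third [Fintype γ] (q : Ω → ℝ) (A : Ω → α) (B : Ω → β) (C : Ω → γ) (D : Ω → δ)
    (a : α) (b : β) (d : δ) :
    ∑ c, law q (fun ω => (A ω, B ω, C ω, D ω)) (a, b, c, d) =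
      law q (fun ω => (A ω, B ω, D ω)) (a, b, d) := by
  classical
  simp only [law]
  rw [Finset.sum_comm]
  refine Finset.sum_congr rfl fun ω _ => ?_
  rw [Fintype.sum_eq_single (C ω) fun c h => by simp [h.symm]]
  simp only [Prod.mk.injEq, true_and]

end LawPermutation

/-! ### Single-letter regions of separable channels -/

namespace InterferenceChannel

variable {X₁ X₂ Y₁ Y₂ O₁ O₂ : Type*} [Fintype X₁] [Fintype X₂] [Fintype Y₁] [Fintype Y₂]
  [Fintype O₁] [Fintype O₂]

/-- Each receiver observes each of the transmitters separately, transmitter `k` at receiver `t`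
through `Kₜₖ`. -/
structure Separable {X₁ X₂ Y₁ Y₂ O₁ O₂ : Type*} [Fintype Y₁] [Fintype Y₂] [Fintype O₁] [Fintype O₂]
    (P : InterferenceChannel X₁ X₂ Y₁ Y₂) (K₁₁ : X₁ → O₁ → ℝ) (K₁₂ : X₂ → O₁ → ℝ)
    (K₂₁ : X₁ → O₂ → ℝ) (K₂₂ : X₂ → O₂ → ℝ) : Prop where
  stochastic₁₁ : IsStochastic K₁₁
  stochastic₁₂ : IsStochastic K₁₂
  stochastic₂₁ : IsStochastic K₂₁
  stochastic₂₂ : IsStochastic K₂₂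
  observes₁₁ : Observes P.marginal₁ K₁₁
  observes₁₂ : Observes (fun x₂ x₁ => P.marginal₁ x₁ x₂) K₁₂
  observes₂₁ : Observes P.marginal₂ K₂₁
  observes₂₂ : Observes (fun x₂ x₁ => P.marginal₂ x₁ x₂) K₂₂

variable {P : InterferenceChannel X₁ X₂ Y₁ Y₂} {K₁₁ : X₁ → O₁ → ℝ} {K₁₂ : X₂ → O₁ → ℝ}
  {K₂₁ : X₁ → O₂ → ℝ} {K₂₂ : X₂ → O₂ → ℝ}

/-! ### The outer region -/

section Auxiliary

variable {U V₁ V₂ : Type*} [Fintype U] [Fintype V₁] [Fintype V₂]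
  {q : U × V₁ × V₂ × X₁ × X₂ × Y₁ × Y₂ → ℝ} {pU : U → ℝ} {kV : U → V₁ × V₂ → ℝ}
  {k₁ : V₁ → X₁ → ℝ} {k₂ : V₂ → X₂ → ℝ}

theorem OuterClass.nonneg (h : P.OuterClass q) (ω) : 0 ≤ q ω := by
  obtain ⟨pU, kV, k₁, k₂, hpU, hkV, hk₁, hk₂, hq⟩ := h
  obtain ⟨u, v₁, v₂, x₁, x₂, y₁, y₂⟩ := ω
  rw [hq]
  exact mul_nonneg (mul_nonneg (mul_nonneg (mul_nonneg (hpU.1 u) ((hkV u).1 _)) ((hk₁ v₁).1 x₁))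
    ((hk₂ v₂).1 x₂)) ((P.prob_mem x₁ x₂).1 _)

theorem law_user₁_output₁ (hq : ∀ u v₁ v₂ x₁ x₂ y₁ y₂, q (u, v₁, v₂, x₁, x₂, y₁, y₂) =
      pU u * kV u (v₁, v₂) * k₁ v₁ x₁ * k₂ v₂ x₂ * P.prob x₁ x₂ (y₁, y₂))
    (v₁ : V₁) (y₁ : Y₁) (c : V₂ × U) :
    law q (fun ω => (rvV₁ ω, rvY₁ ω, rvV₂ ω, rvU ω)) (v₁, y₁, c) =
      ∑ x₁, ∑ x₂, pU c.2 * kV c.2 (v₁, c.1) * k₁ v₁ x₁ * k₂ c.1 x₂ * P.marginal₁ x₁ x₂ y₁ := by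
  obtain ⟨v₂, u⟩ := c
  simp only [law_V₁_Y₁_V₂_U, hq, marginal₁, Finset.mul_sum]

theorem law_user₁_output₂ (hq : ∀ u v₁ v₂ x₁ x₂ y₁ y₂, q (u, v₁, v₂, x₁, x₂, y₁, y₂) =
      pU u * kV u (v₁, v₂) * k₁ v₁ x₁ * k₂ v₂ x₂ * P.prob x₁ x₂ (y₁, y₂))
    (v₁ : V₁) (y₂ : Y₂) (c : V₂ × U) :
    law q (fun ω => (rvV₁ ω, rvY₂ ω, rvV₂ ω, rvU ω)) (v₁, y₂, c) =
      ∑ x₁, ∑ x₂, pU c.2 * kV c.2 (v₁, c.1) * k₁ v₁ x₁ * k₂ c.1 x₂ * P.marginal₂ x₁ x₂ y₂ := by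
  obtain ⟨v₂, u⟩ := c
  simp only [law_V₁_Y₂_V₂_U, hq, marginal₂, Finset.mul_sum]

theorem law_user₂_output₁ (hq : ∀ u v₁ v₂ x₁ x₂ y₁ y₂, q (u, v₁, v₂, x₁, x₂, y₁, y₂) =
      pU u * kV u (v₁, v₂) * k₁ v₁ x₁ * k₂ v₂ x₂ * P.prob x₁ x₂ (y₁, y₂))
    (v₂ : V₂) (y₁ : Y₁) (c : V₁ × U) :
    law q (fun ω => (rvV₂ ω, rvY₁ ω, rvV₁ ω, rvU ω)) (v₂, y₁, c) =
      ∑ x₂, ∑ x₁, pU c.2 * kV c.2 (c.1, v₂) * k₂ v₂ x₂ * k₁ c.1 x₁ * P.marginal₁ x₁ x₂ y₁ := by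
  obtain ⟨v₁, u⟩ := c
  rw [law_swap_first_third, law_V₁_Y₁_V₂_U, Finset.sum_comm]
  simp only [hq, marginal₁, Finset.mul_sum]
  exact Finset.sum_congr rfl fun x₂ _ => Finset.sum_congr rfl fun x₁ _ =>
    Finset.sum_congr rfl fun y _ => by ring

theorem law_user₂_output₂ (hq : ∀ u v₁ v₂ x₁ x₂ y₁ y₂, q (u, v₁, v₂, x₁, x₂, y₁, y₂) =
      pU u * kV u (v₁, v₂) * k₁ v₁ x₁ * k₂ v₂ x₂ * P.prob x₁ x₂ (y₁, y₂))
    (v₂ : V₂) (y₂ : Y₂) (c : V₁ × U) :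
    law q (fun ω => (rvV₂ ω, rvY₂ ω, rvV₁ ω, rvU ω)) (v₂, y₂, c) =
      ∑ x₂, ∑ x₁, pU c.2 * kV c.2 (c.1, v₂) * k₂ v₂ x₂ * k₁ c.1 x₁ * P.marginal₂ x₁ x₂ y₂ := by
  obtain ⟨v₁, u⟩ := c
  rw [law_swap_first_third, law_V₁_Y₂_V₂_U, Finset.sum_comm]
  simp only [hq, marginal₂, Finset.mul_sum]
  exact Finset.sum_congr rfl fun x₂ _ => Finset.sum_congr rfl fun x₁ _ =>
    Finset.sum_congr rfl fun y _ => by ring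

theorem sum_outer_mass (hpU : pU ∈ stdSimplex ℝ U) (hkV : IsStochastic kV) (hk₁ : IsStochastic k₁) :
    ∑ c : V₂ × U, ∑ v₁, ∑ x₁, pU c.2 * kV c.2 (v₁, c.1) * k₁ v₁ x₁ = 1 := by
  simp only [← Finset.mul_sum, (hk₁ _).2, mul_one]
  rw [Fintype.sum_prod_type_right]
  simp only [← Finset.mul_sum]
  have : ∀ u, ∑ v₂, ∑ v₁, kV u (v₁, v₂) = 1 := fun u => by
    rw [← (hkV u).2, Fintype.sum_prod_type_right]
  simp only [this, mul_one, hpU.2]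

theorem sum_outer_mass' (hpU : pU ∈ stdSimplex ℝ U) (hkV : IsStochastic kV)
    (hk₂ : IsStochastic k₂) :
    ∑ c : V₁ × U, ∑ v₂, ∑ x₂, pU c.2 * kV c.2 (c.1, v₂) * k₂ v₂ x₂ = 1 := by
  simp only [← Finset.mul_sum, (hk₂ _).2, mul_one]
  rw [Fintype.sum_prod_type_right]
  simp only [← Finset.mul_sum]
  have : ∀ u, ∑ v₁, ∑ v₂, kV u (v₁, v₂) = 1 := fun u => by
    rw [← (hkV u).2, Fintype.sum_prod_type]
  simp only [this, mul_one, hpU.2]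

/-- The bound is linear in mass, so conditioning (a sum over slices of total mass one) cannot beat
it. -/
theorem _root_.IsGapBound.sum_le {X Y Y' γ : Type*} {V : Type} [Fintype X] [Fintype Y] [Fintype Y']
    [Fintype V] [Fintype γ] {K : X → Y → ℝ} {K' : X → Y' → ℝ} {C : ℝ} (hC : IsGapBound K K' C)
    {μ : γ → V → X → ℝ} (hμ : ∀ c v x, 0 ≤ μ c v x) (hμ1 : ∑ c, ∑ v, ∑ x, μ c v x = 1) :
    ∑ c, massInfo (fun v => pushMass (μ c v) K) - ∑ c, massInfo (fun v => pushMass (μ c v) K') ≤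
      C := by
  rw [← Finset.sum_sub_distrib]
  refine (Finset.sum_le_sum fun c _ => hC V (μ c) (hμ c)).trans_eq ?_
  rw [← Finset.mul_sum, hμ1, mul_one]

/-- Once the other auxiliary variable is fixed, the other input is drawn from it alone. Dependence
between `V₁` and `V₂` then only reshapes the input mass function of the observed user. -/
theorem condMutualInfo_of_outer (hP : P.Separable K₁₁ K₁₂ K₂₁ K₂₂) (hq0 : ∀ ω, 0 ≤ q ω)
    (hk₁ : IsStochastic k₁) (hk₂ : IsStochastic k₂)
    (hq : ∀ u v₁ v₂ x₁ x₂ y₁ y₂, q (u, v₁, v₂, x₁, x₂, y₁, y₂) =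
      pU u * kV u (v₁, v₂) * k₁ v₁ x₁ * k₂ v₂ x₂ * P.prob x₁ x₂ (y₁, y₂)) :
    (condMutualInfo q rvV₁ rvY₁ (fun ω => (rvV₂ ω, rvU ω)) = (∑ c : V₂ × U, massInfo fun v =>
        pushMass (fun x => pU c.2 * kV c.2 (v, c.1) * k₁ v x) K₁₁) / Real.log 2 ∧
      condMutualInfo q rvV₁ rvY₂ (fun ω => (rvV₂ ω, rvU ω)) = (∑ c : V₂ × U, massInfo fun v =>
        pushMass (fun x => pU c.2 * kV c.2 (v, c.1) * k₁ v x) K₂₁) / Real.log 2) ∧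
    (condMutualInfo q rvV₂ rvY₁ (fun ω => (rvV₁ ω, rvU ω)) = (∑ c : V₁ × U, massInfo fun v =>
        pushMass (fun x => pU c.2 * kV c.2 (c.1, v) * k₂ v x) K₁₂) / Real.log 2 ∧
      condMutualInfo q rvV₂ rvY₂ (fun ω => (rvV₁ ω, rvU ω)) = (∑ c : V₁ × U, massInfo fun v =>
        pushMass (fun x => pU c.2 * kV c.2 (c.1, v) * k₂ v x) K₂₂) / Real.log 2) := by
  refine ⟨⟨?_, ?_⟩, ⟨?_, ?_⟩⟩
  · exact hP.observes₁₁.condMutualInfo_eq hq0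
      (μ := fun (c : V₂ × U) v x => pU c.2 * kV c.2 (v, c.1) * k₁ v x) (ν := fun c => k₂ c.1)
      (fun c => (hk₂ c.1).2) (law_user₁_output₁ hq)
  · exact hP.observes₂₁.condMutualInfo_eq hq0
      (μ := fun (c : V₂ × U) v x => pU c.2 * kV c.2 (v, c.1) * k₁ v x) (ν := fun c => k₂ c.1)
      (fun c => (hk₂ c.1).2) (law_user₁_output₂ hq)
  · exact hP.observes₁₂.condMutualInfo_eq hq0
      (μ := fun (c : V₁ × U) v x => pU c.2 * kV c.2 (c.1, v) * k₂ v x) (ν := fun c => k₁ c.1)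
      (fun c => (hk₁ c.1).2) (law_user₂_output₁ hq)
  · exact hP.observes₂₂.condMutualInfo_eq hq0
      (μ := fun (c : V₁ × U) v x => pU c.2 * kV c.2 (c.1, v) * k₂ v x) (ν := fun c => k₁ c.1)
      (fun c => (hk₁ c.1).2) (law_user₂_output₂ hq)

end Auxiliary

/-- Only the terms conditioned on the other auxiliary variable are used: given `U` alone, the
interfering input may be correlated with the user's own variable. -/
theorem outerRegion_subset (hP : P.Separable K₁₁ K₁₂ K₂₁ K₂₂) {C₁ C₂ : ℝ}
    (hC₁ : IsGapBound K₁₁ K₂₁ C₁) (hC₂ : IsGapBound K₂₂ K₁₂ C₂) :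
    P.outerRegion ⊆ Set.Icc 0 (C₁ / Real.log 2) ×ˢ Set.Icc 0 (C₂ / Real.log 2) := by
  rintro ⟨R₁, R₂⟩ ⟨a, b, c, q, hout, hR₁, hR₁', hR₂, hR₂'⟩
  have hq0 := hout.nonneg
  obtain ⟨pU, kV, k₁, k₂, hpU, hkV, hk₁, hk₂, hq⟩ := hout
  obtain ⟨⟨h₁₁, h₁₂⟩, ⟨h₂₁, h₂₂⟩⟩ := condMutualInfo_of_outer hP hq0 hk₁ hk₂ hq
  have hlog2 : 0 < Real.log 2 := Real.log_pos one_lt_two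
  refine ⟨⟨hR₁, (hR₁'.trans (min_le_right _ _)).trans ?_⟩,
    ⟨hR₂, (hR₂'.trans (min_le_right _ _)).trans ?_⟩⟩
  · rw [h₁₁, h₁₂, ← sub_div]
    refine div_le_div_of_nonneg_right ?_ hlog2.le
    exact hC₁.sum_le (fun c v x => mul_nonneg (mul_nonneg (hpU.1 _) ((hkV _).1 _)) ((hk₁ v).1 x))
      (sum_outer_mass hpU hkV hk₁)
  · rw [h₂₁, h₂₂, ← sub_div]
    refine div_le_div_of_nonneg_right ?_ hlog2.le
    exact hC₂.sum_le (fun c v x => mul_nonneg (mul_nonneg (hpU.1 _) ((hkV _).1 _)) ((hk₂ v).1 x))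
      (sum_outer_mass' hpU hkV hk₂)

/-- A conditionally independent auxiliary variable does not change the information. -/
theorem _root_.Observes.condMutualInfo_eq_of_indep {X X' Y O : Type*} [Fintype X] [Fintype X']
    [Fintype Y] [Fintype O] {Ω V V' U : Type*} [Fintype Ω] [Fintype V] [Fintype V'] [Fintype U]
    {W : X → X' → Y → ℝ} {K : X → O → ℝ} (h : Observes W K) {q : Ω → ℝ} (hq : ∀ ω, 0 ≤ q ω)
    {A : Ω → V} {B : Ω → Y} {A' : Ω → V'} {D : Ω → U} {μ : U → V → X → ℝ} {κ : U → V' → ℝ}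
    {k' : V' → X' → ℝ} (hκ : IsStochastic κ) (hk' : IsStochastic k')
    (hlaw : ∀ v y c, law q (fun ω => (A ω, B ω, A' ω, D ω)) (v, y, c) =
      ∑ x, ∑ x', κ c.2 c.1 * μ c.2 v x * k' c.1 x' * W x x' y) :
    condMutualInfo q A B D = (∑ u, massInfo (fun v => pushMass (μ u v) K)) / Real.log 2 ∧
    condMutualInfo q A B (fun ω => (A' ω, D ω)) =
      (∑ u, massInfo (fun v => pushMass (μ u v) K)) / Real.log 2 := by
  constructor
  -- Averaging out `A'`, which is independent of `A` given `D`, leaves the second input with law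
  -- `pushMass (κ u) k'`.
  · refine h.condMutualInfo_eq hq (μ := μ) (ν := fun u => pushMass (κ u) k')
      (fun u => by rw [sum_pushMass_of_isStochastic hk', (hκ u).2]) fun v y u => ?_
    rw [← sum_law_third q A B A' D]
    simp only [hlaw, pushMass, Finset.mul_sum, Finset.sum_mul]
    rw [Finset.sum_comm]
    refine Finset.sum_congr rfl fun x _ => ?_
    rw [Finset.sum_comm]
    exact Finset.sum_congr rfl fun x' _ => Finset.sum_congr rfl fun v' _ => by ring
  · rw [h.condMutualInfo_eq hq (fun c : V' × U => (hk' c.1).2) hlaw]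
    congr 1
    simp only [pushMass_const_mul, massInfo_const_mul]
    rw [Fintype.sum_prod_type_right]
    refine Finset.sum_congr rfl fun u _ => ?_
    change ∑ x, κ u x * massInfo (fun v => pushMass (μ u v) K) = _
    rw [← Finset.sum_mul, (hκ u).2, one_mul]

/-! ### The inner region -/

section Inner

variable {U V₁ V₂ : Type*} [Fintype U] [Fintype V₁] [Fintype V₂]
  {q : U × V₁ × V₂ × X₁ × X₂ × Y₁ × Y₂ → ℝ} {pU : U → ℝ} {kV₁ : U → V₁ → ℝ} {kV₂ : U → V₂ → ℝ}
  {k₁ : V₁ → X₁ → ℝ} {k₂ : V₂ → X₂ → ℝ}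

theorem isStochastic_mul {U V₁ V₂ : Type*} [Fintype V₁] [Fintype V₂] {kV₁ : U → V₁ → ℝ}
    {kV₂ : U → V₂ → ℝ} (h₁ : IsStochastic kV₁) (h₂ : IsStochastic kV₂) :
    IsStochastic fun u (v : V₁ × V₂) => kV₁ u v.1 * kV₂ u v.2 := fun u =>
  ⟨fun v => mul_nonneg ((h₁ u).1 _) ((h₂ u).1 _), by
    simp only [Fintype.sum_prod_type, ← Finset.mul_sum, (h₂ u).2, mul_one, (h₁ u).2]⟩

theorem InnerClass.outerClass (h : P.InnerClass q) : P.OuterClass q := by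
  obtain ⟨pU, kV₁, kV₂, k₁, k₂, hpU, hkV₁, hkV₂, hk₁, hk₂, hq⟩ := h
  refine ⟨pU, fun u v => kV₁ u v.1 * kV₂ u v.2, k₁, k₂, hpU, isStochastic_mul hkV₁ hkV₂, hk₁, hk₂,
    fun u v₁ v₂ x₁ x₂ y₁ y₂ => ?_⟩
  rw [hq]
  ring

/-- With `V₁`, `V₂` independent given `U`, conditioning on the other user's variable changes
nothing, so the inner bound and both entries of each outer minimum agree. -/
theorem condMutualInfo_of_inner (hP : P.Separable K₁₁ K₁₂ K₂₁ K₂₂) (hpU : pU ∈ stdSimplex ℝ U)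
    (hkV₁ : IsStochastic kV₁) (hkV₂ : IsStochastic kV₂) (hk₁ : IsStochastic k₁)
    (hk₂ : IsStochastic k₂)
    (hq : ∀ u v₁ v₂ x₁ x₂ y₁ y₂, q (u, v₁, v₂, x₁, x₂, y₁, y₂) =
      pU u * kV₁ u v₁ * kV₂ u v₂ * k₁ v₁ x₁ * k₂ v₂ x₂ * P.prob x₁ x₂ (y₁, y₂)) :
    ((condMutualInfo q rvV₁ rvY₁ rvU =
        (∑ u, massInfo fun v => pushMass (fun x => pU u * kV₁ u v * k₁ v x) K₁₁) / Real.log 2 ∧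
      condMutualInfo q rvV₁ rvY₁ (fun ω => (rvV₂ ω, rvU ω)) =
        (∑ u, massInfo fun v => pushMass (fun x => pU u * kV₁ u v * k₁ v x) K₁₁) / Real.log 2) ∧
    (condMutualInfo q rvV₁ rvY₂ rvU =
        (∑ u, massInfo fun v => pushMass (fun x => pU u * kV₁ u v * k₁ v x) K₂₁) / Real.log 2 ∧
      condMutualInfo q rvV₁ rvY₂ (fun ω => (rvV₂ ω, rvU ω)) =
        (∑ u, massInfo fun v => pushMass (fun x => pU u * kV₁ u v * k₁ v x) K₂₁) / Real.log 2)) ∧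
    ((condMutualInfo q rvV₂ rvY₁ rvU =
        (∑ u, massInfo fun v => pushMass (fun x => pU u * kV₂ u v * k₂ v x) K₁₂) / Real.log 2 ∧
      condMutualInfo q rvV₂ rvY₁ (fun ω => (rvV₁ ω, rvU ω)) =
        (∑ u, massInfo fun v => pushMass (fun x => pU u * kV₂ u v * k₂ v x) K₁₂) / Real.log 2) ∧
    (condMutualInfo q rvV₂ rvY₂ rvU =
        (∑ u, massInfo fun v => pushMass (fun x => pU u * kV₂ u v * k₂ v x) K₂₂) / Real.log 2 ∧
      condMutualInfo q rvV₂ rvY₂ (fun ω => (rvV₁ ω, rvU ω)) =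
        (∑ u, massInfo fun v => pushMass (fun x => pU u * kV₂ u v * k₂ v x) K₂₂) / Real.log 2)) := by
  have hin : P.InnerClass q := ⟨pU, kV₁, kV₂, k₁, k₂, hpU, hkV₁, hkV₂, hk₁, hk₂, hq⟩
  have hq0 := hin.outerClass.nonneg
  have hq' : ∀ u v₁ v₂ x₁ x₂ y₁ y₂, q (u, v₁, v₂, x₁, x₂, y₁, y₂) =
      pU u * (kV₁ u v₁ * kV₂ u v₂) * k₁ v₁ x₁ * k₂ v₂ x₂ *
        P.prob x₁ x₂ (y₁, y₂) := fun u v₁ v₂ x₁ x₂ y₁ y₂ => by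
    rw [hq]
    ring
  refine ⟨⟨hP.observes₁₁.condMutualInfo_eq_of_indep hq0 hkV₂ hk₂ fun v y c => ?_,
    hP.observes₂₁.condMutualInfo_eq_of_indep hq0 hkV₂ hk₂ fun v y c => ?_⟩,
    ⟨hP.observes₁₂.condMutualInfo_eq_of_indep hq0 hkV₁ hk₁ fun v y c => ?_,
    hP.observes₂₂.condMutualInfo_eq_of_indep hq0 hkV₁ hk₁ fun v y c => ?_⟩⟩
  · rw [law_user₁_output₁ (kV := fun u v => kV₁ u v.1 * kV₂ u v.2) hq']
    exact Finset.sum_congr rfl fun x _ => Finset.sum_congr rfl fun x' _ => by ring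
  · rw [law_user₁_output₂ (kV := fun u v => kV₁ u v.1 * kV₂ u v.2) hq']
    exact Finset.sum_congr rfl fun x _ => Finset.sum_congr rfl fun x' _ => by ring
  · rw [law_user₂_output₁ (kV := fun u v => kV₁ u v.1 * kV₂ u v.2) hq']
    exact Finset.sum_congr rfl fun x _ => Finset.sum_congr rfl fun x' _ => by ring
  · rw [law_user₂_output₂ (kV := fun u v => kV₁ u v.1 * kV₂ u v.2) hq']
    exact Finset.sum_congr rfl fun x _ => Finset.sum_congr rfl fun x' _ => by ring

end Inner

theorem innerRegion_subset_outerRegion (hP : P.Separable K₁₁ K₁₂ K₂₁ K₂₂) :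
    P.innerRegion ⊆ P.outerRegion := by
  rintro ⟨R₁, R₂⟩ ⟨a, b, c, q, hin, hR₁, hR₁', hR₂, hR₂'⟩
  have hout := hin.outerClass
  obtain ⟨pU, kV₁, kV₂, k₁, k₂, hpU, hkV₁, hkV₂, hk₁, hk₂, hq⟩ := hin
  obtain ⟨⟨⟨h₁, h₂⟩, ⟨h₃, h₄⟩⟩, ⟨⟨h₅, h₆⟩, ⟨h₇, h₈⟩⟩⟩ :=
    condMutualInfo_of_inner hP hpU hkV₁ hkV₂ hk₁ hk₂ hq
  refine ⟨a, b, c, q, hout, hR₁, ?_, hR₂, ?_⟩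
  · rw [h₁, h₄] at hR₁'
    rwa [h₁, h₂, h₃, h₄, min_self]
  · rw [h₇, h₆] at hR₂'
    rwa [h₅, h₆, h₇, h₈, min_self]

/-- Constant `U` and independent `V₁`, `V₂`: neither user's gap depends on the other, so the two
choices are made freely and simultaneously. -/
theorem subset_innerRegion (hP : P.Separable K₁₁ K₁₂ K₂₁ K₂₂) {b c : ℕ} {w₁ : Fin b → ℝ}
    {w₂ : Fin c → ℝ} {ρ₁ : Fin b → X₁ → ℝ} {ρ₂ : Fin c → X₂ → ℝ} (hw₁ : w₁ ∈ stdSimplex ℝ (Fin b))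
    (hw₂ : w₂ ∈ stdSimplex ℝ (Fin c)) (hρ₁ : IsStochastic ρ₁) (hρ₂ : IsStochastic ρ₂) :
    Set.Icc 0 (secrecyGap K₁₁ K₂₁ (fun v x => w₁ v * ρ₁ v x) / Real.log 2) ×ˢ
      Set.Icc 0 (secrecyGap K₂₂ K₁₂ (fun v x => w₂ v * ρ₂ v x) / Real.log 2) ⊆ P.innerRegion := by
  rintro ⟨R₁, R₂⟩ ⟨⟨hR₁, hR₁'⟩, ⟨hR₂, hR₂'⟩⟩
  have hpU : (fun _ => 1 : Fin 1 → ℝ) ∈ stdSimplex ℝ (Fin 1) := ⟨fun _ => zero_le_one, by simp⟩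
  set q : Fin 1 × Fin b × Fin c × X₁ × X₂ × Y₁ × Y₂ → ℝ := fun ω =>
    1 * w₁ ω.2.1 * w₂ ω.2.2.1 * ρ₁ ω.2.1 ω.2.2.2.1 * ρ₂ ω.2.2.1 ω.2.2.2.2.1 *
      P.prob ω.2.2.2.1 ω.2.2.2.2.1 ω.2.2.2.2.2
  obtain ⟨⟨⟨h₁, -⟩, ⟨-, h₄⟩⟩, ⟨⟨-, h₆⟩, ⟨h₇, -⟩⟩⟩ :=
    condMutualInfo_of_inner (q := q) hP hpU
      (kV₁ := fun _ => w₁) (kV₂ := fun _ => w₂) (fun _ => hw₁) (fun _ => hw₂) hρ₁ hρ₂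
      (fun u v₁ v₂ x₁ x₂ y₁ y₂ => rfl)
  refine ⟨1, b, c, q, ⟨fun _ => 1, fun _ => w₁, fun _ => w₂, ρ₁, ρ₂, hpU, fun _ => hw₁,
    fun _ => hw₂, hρ₁, hρ₂, fun u v₁ v₂ x₁ x₂ y₁ y₂ => rfl⟩, hR₁, ?_, hR₂, ?_⟩
  · rw [h₁, h₄, ← sub_div]
    simpa [secrecyGap] using hR₁'
  · rw [h₇, h₆, ← sub_div]
    simpa [secrecyGap] using hR₂'

end InterferenceChannel

/-! ### Codes for separable channels -/

section UniformJoint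

variable {A A' B O : Type*} [Fintype A] [Fintype A'] [Fintype B] [Fintype O] {M M' : ℕ}

/-- The law of the channel input when the message is uniform. -/
noncomputable def averageInput {A : Type*} (enc : Fin M → A → ℝ) (a : A) : ℝ :=
  ∑ w, 1 / (M : ℝ) * enc w a

/-- The joint law of a uniform message and the output of the channel `W`, whose second input is
encoded by `enc'` from another uniform message. -/
noncomputable def uniformJoint {A A' B : Type*} [Fintype A] [Fintype A'] (enc : Fin M → A → ℝ)
    (enc' : Fin M' → A' → ℝ) (W : A → A' → B → ℝ) (w : Fin M) (y : B) : ℝ :=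
  1 / (M : ℝ) * ∑ x, ∑ x', enc w x * averageInput enc' x' * W x x' y

theorem sum_averageInput (hM : 0 < M) {enc : Fin M → A → ℝ} (henc : IsStochastic enc) :
    ∑ a, averageInput enc a = 1 := by
  have hM' : (M : ℝ) ≠ 0 := by exact_mod_cast hM.ne'
  simp only [averageInput]
  rw [Finset.sum_comm]
  simp only [← Finset.mul_sum, (henc _).2]
  simp [hM']

-- The other user's encoded uniform message is just an independent second input, absorbed by `b` for
-- every encoder of the first user.
open Classical in
theorem Observes.exists_uniformJoint_eq {A A' B O : Type*} [Fintype A] [Fintype A'] [Fintype B]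
    {W : A → A' → B → ℝ} {K : A → O → ℝ} (h : Observes W K)
    (hM' : 0 < M') {enc' : Fin M' → A' → ℝ} (henc' : IsStochastic enc') :
    ∃ (e : B → O) (b : B → ℝ), (∀ o, ∑ y, (if e y = o then b y else 0) = 1) ∧
      ∀ {M : ℕ} (enc : Fin M → A → ℝ) w y,
        uniformJoint enc enc' W w y = 1 / (M : ℝ) * pushMass (enc w) K (e y) * b y := by
  obtain ⟨e, b, hb, hf⟩ := h.exists_factor (sum_averageInput hM' henc')
  refine ⟨e, b, hb, fun enc w y => ?_⟩
  rw [uniformJoint, hf, mul_assoc]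

theorem Observes.sum_massEntropy_uniformJoint {W : A → A' → B → ℝ} {K : A → O → ℝ}
    (h : Observes W K) (hM' : 0 < M') {enc' : Fin M' → A' → ℝ} (henc' : IsStochastic enc')
    (enc : Fin M → A → ℝ) :
    ∑ y, massEntropy (fun w => uniformJoint enc enc' W w y) = residualEntropy enc K := by
  obtain ⟨e, b, hb, hf⟩ := h.exists_uniformJoint_eq hM' henc'
  simp only [hf]
  exact sum_massEntropy_split hb fun w o => 1 / (M : ℝ) * pushMass (enc w) K o

theorem Observes.sum_uniformJoint {W : A → A' → B → ℝ} {K : A → O → ℝ}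
    (h : Observes W K) (hK : IsStochastic K) (hM : 0 < M) (hM' : 0 < M')
    {enc : Fin M → A → ℝ} {enc' : Fin M' → A' → ℝ} (henc : IsStochastic enc)
    (henc' : IsStochastic enc') :
    ∑ w, ∑ y, uniformJoint enc enc' W w y = 1 := by
  have hM0 : (M : ℝ) ≠ 0 := by exact_mod_cast hM.ne'
  obtain ⟨e, b, hb, hf⟩ := h.exists_uniformJoint_eq hM' henc'
  simp only [hf]
  have h1 : ∀ w, ∑ y, 1 / (M : ℝ) * pushMass (enc w) K (e y) * b y = 1 / (M : ℝ) := fun w => by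
    rw [sum_comp_mul_of_fiber hb fun o => 1 / (M : ℝ) * pushMass (enc w) K o, ← Finset.mul_sum,
      sum_pushMass_of_isStochastic hK, (henc w).2, mul_one]
  simp only [h1]
  simp [hM0]

theorem Observes.exists_decoder {W : A → A' → B → ℝ} {K : A → O → ℝ}
    (h : Observes W K) (hM' : 0 < M') {enc' : Fin M' → A' → ℝ} (henc' : IsStochastic enc')
    (enc : Fin M → A → ℝ) (dec : O → Fin M) :
    ∃ dec' : B → Fin M, (∑ w, ∑ y, if dec' y ≠ w then uniformJoint enc enc' W w y else 0) =
      ∑ w, ∑ o, if dec o ≠ w then 1 / (M : ℝ) * pushMass (enc w) K o else 0 := by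
  obtain ⟨e, b, hb, hf⟩ := h.exists_uniformJoint_eq hM' henc'
  refine ⟨fun y => dec (e y), Finset.sum_congr rfl fun w _ => ?_⟩
  rw [← sum_comp_mul_of_fiber hb]
  refine Finset.sum_congr rfl fun y _ => ?_
  rw [hf]
  split_ifs <;> simp

end UniformJoint

/-! ### Error and equivocation through the marginal channels -/

namespace Code

variable {X₁ X₂ Y₁ Y₂ : Type*} [Fintype X₁] [Fintype X₂] [Fintype Y₁] [Fintype Y₂]
  {M₁ M₂ n : ℕ} (c : Code X₁ X₂ Y₁ Y₂ M₁ M₂ n) (P : InterferenceChannel X₁ X₂ Y₁ Y₂)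

theorem sum_outputProb_right (w₁ : Fin M₁) (w₂ : Fin M₂) (y₁ : Fin n → Y₁) :
    ∑ y₂, c.outputProb P w₁ w₂ y₁ y₂ =
      ∑ x₁, ∑ x₂, c.enc₁ w₁ x₁ * c.enc₂ w₂ x₂ * blockChannel P.marginal₁ n x₁ x₂ y₁ := by
  simp only [outputProb]
  rw [Finset.sum_comm]
  refine Finset.sum_congr rfl fun x₁ _ => ?_
  rw [Finset.sum_comm]
  refine Finset.sum_congr rfl fun x₂ _ => ?_
  rw [← Finset.mul_sum]
  congr 1
  exact sum_prod_eq_prod_sum fun i y₂ => P.prob (x₁ i) (x₂ i) (y₁ i, y₂)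

theorem sum_outputProb_left (w₁ : Fin M₁) (w₂ : Fin M₂) (y₂ : Fin n → Y₂) :
    ∑ y₁, c.outputProb P w₁ w₂ y₁ y₂ =
      ∑ x₁, ∑ x₂, c.enc₁ w₁ x₁ * c.enc₂ w₂ x₂ * blockChannel P.marginal₂ n x₁ x₂ y₂ := by
  simp only [outputProb]
  rw [Finset.sum_comm]
  refine Finset.sum_congr rfl fun x₁ _ => ?_
  rw [Finset.sum_comm]
  refine Finset.sum_congr rfl fun x₂ _ => ?_
  rw [← Finset.mul_sum]
  congr 1
  exact sum_prod_eq_prod_sum fun i y₁ => P.prob (x₁ i) (x₂ i) (y₁, y₂ i)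

theorem sum_message₂_eq_uniformJoint {X₁ X₂ Y₁ Y₂ B : Type*} [Fintype X₁] [Fintype X₂]
    (c : Code X₁ X₂ Y₁ Y₂ M₁ M₂ n) (W : (Fin n → X₁) → (Fin n → X₂) → B → ℝ)
    (w₁ : Fin M₁) (y : B) :
    ∑ w₂, 1 / ((M₁ : ℝ) * M₂) * ∑ x₁, ∑ x₂, c.enc₁ w₁ x₁ * c.enc₂ w₂ x₂ * W x₁ x₂ y =
      uniformJoint c.enc₁ c.enc₂ W w₁ y := by
  simp only [uniformJoint, averageInput, Finset.mul_sum, Finset.sum_mul]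
  rw [Finset.sum_comm]
  refine Finset.sum_congr rfl fun x₁ _ => ?_
  rw [Finset.sum_comm]
  refine Finset.sum_congr rfl fun x₂ _ => Finset.sum_congr rfl fun w₂ _ => ?_
  ring

theorem sum_message₁_eq_uniformJoint {X₁ X₂ Y₁ Y₂ B : Type*} [Fintype X₁] [Fintype X₂]
    (c : Code X₁ X₂ Y₁ Y₂ M₁ M₂ n) (W : (Fin n → X₁) → (Fin n → X₂) → B → ℝ)
    (w₂ : Fin M₂) (y : B) :
    ∑ w₁, 1 / ((M₁ : ℝ) * M₂) * ∑ x₁, ∑ x₂, c.enc₁ w₁ x₁ * c.enc₂ w₂ x₂ * W x₁ x₂ y =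
      uniformJoint c.enc₂ c.enc₁ (fun x₂ x₁ => W x₁ x₂) w₂ y := by
  simp only [uniformJoint, averageInput, Finset.mul_sum, Finset.sum_mul]
  rw [Finset.sum_comm, Finset.sum_congr rfl fun x₁ _ => Finset.sum_comm, Finset.sum_comm]
  refine Finset.sum_congr rfl fun x₂ _ => Finset.sum_congr rfl fun x₁ _ =>
    Finset.sum_congr rfl fun w₁ _ => ?_
  ring

theorem jointLaw_nonneg (ω) : 0 ≤ c.jointLaw P ω := by
  refine mul_nonneg (by positivity) ?_
  exact Finset.sum_nonneg fun x₁ _ => Finset.sum_nonneg fun x₂ _ =>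
    mul_nonneg (mul_nonneg ((c.enc₁_stochastic _).1 _) ((c.enc₂_stochastic _).1 _))
      (Finset.prod_nonneg fun i _ => (P.prob_mem _ _).1 _)

theorem errorProb₁_eq :
    c.errorProb₁ P = ∑ w, ∑ y, if c.dec₁ y ≠ w then
      uniformJoint c.enc₁ c.enc₂ (blockChannel P.marginal₁ n) w y else 0 := by
  refine Finset.sum_congr rfl fun w₁ _ => ?_
  simp only [← sum_message₂_eq_uniformJoint, ← sum_outputProb_right]
  simp only [Finset.mul_sum]
  rw [Finset.sum_comm]
  refine Finset.sum_congr rfl fun y₁ _ => ?_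
  split_ifs <;> simp

theorem errorProb₂_eq :
    c.errorProb₂ P = ∑ w, ∑ y, if c.dec₂ y ≠ w then
      uniformJoint c.enc₂ c.enc₁ (fun x₂ x₁ => blockChannel P.marginal₂ n x₁ x₂) w y else 0 := by
  rw [errorProb₂, Finset.sum_comm]
  refine Finset.sum_congr rfl fun w₂ _ => ?_
  simp only [← sum_message₁_eq_uniformJoint, ← sum_outputProb_left]
  simp only [Finset.mul_sum]
  rw [Finset.sum_congr rfl fun w₁ _ => Finset.sum_comm, Finset.sum_comm]
  refine Finset.sum_congr rfl fun y₂ _ => ?_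
  split_ifs <;> simp

theorem law_message₁_output₂ (w : Fin M₁) (y : Fin n → Y₂) :
    law (c.jointLaw P) (fun ω => (ω.1, ω.2.2.2)) (w, y) =
      uniformJoint c.enc₁ c.enc₂ (blockChannel P.marginal₂ n) w y := by
  classical
  simp only [← sum_message₂_eq_uniformJoint, ← sum_outputProb_left, law, Fintype.sum_prod_type,
    Prod.mk.injEq]
  rw [Fintype.sum_eq_single w fun w' h => by simp [h]]
  refine Finset.sum_congr rfl fun w₂ _ => ?_
  rw [Finset.mul_sum]
  refine Finset.sum_congr rfl fun y₁ _ => ?_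
  rw [Fintype.sum_eq_single y fun y' h => by simp [h]]
  simp [jointLaw]

theorem law_message₂_output₁ (w : Fin M₂) (y : Fin n → Y₁) :
    law (c.jointLaw P) (fun ω => (ω.2.1, ω.2.2.1)) (w, y) =
      uniformJoint c.enc₂ c.enc₁ (fun x₂ x₁ => blockChannel P.marginal₁ n x₁ x₂) w y := by
  classical
  simp only [← sum_message₁_eq_uniformJoint, ← sum_outputProb_right, law, Fintype.sum_prod_type,
    Prod.mk.injEq]
  refine Finset.sum_congr rfl fun w₁ _ => ?_
  rw [Fintype.sum_eq_single w fun w' h => by simp [h],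
    Fintype.sum_eq_single y fun y' h => by simp [h], Finset.mul_sum]
  simp [jointLaw]

end Code

/-! ### Converse and achievability for separable channels -/

namespace InterferenceChannel

variable {X₁ X₂ Y₁ Y₂ O₁ O₂ : Type*} [Fintype X₁] [Fintype X₂] [Fintype Y₁] [Fintype Y₂]
  [Fintype O₁] [Fintype O₂] {P : InterferenceChannel X₁ X₂ Y₁ Y₂} {K₁₁ : X₁ → O₁ → ℝ}
  {K₁₂ : X₂ → O₁ → ℝ} {K₂₁ : X₁ → O₂ → ℝ} {K₂₂ : X₂ → O₂ → ℝ} {M₁ M₂ n : ℕ}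

/-- Here the users decouple: the other user's encoder has dropped out of the equivocation. -/
theorem Separable.equivocation₁_eq (hP : P.Separable K₁₁ K₁₂ K₂₁ K₂₂) (hM₂ : 0 < M₂)
    (c : Code X₁ X₂ Y₁ Y₂ M₁ M₂ n) :
    c.equivocation₁ P = residualEntropy c.enc₁ (blockKernel K₂₁ n) / Real.log 2 := by
  rw [Code.equivocation₁, condEntropy_eq_sum_massEntropy (c.jointLaw_nonneg P)]
  simp only [Code.law_message₁_output₂]
  rw [(hP.observes₂₁.block n).sum_massEntropy_uniformJoint hM₂ c.enc₂_stochastic]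

theorem Separable.equivocation₂_eq (hP : P.Separable K₁₁ K₁₂ K₂₁ K₂₂) (hM₁ : 0 < M₁)
    (c : Code X₁ X₂ Y₁ Y₂ M₁ M₂ n) :
    c.equivocation₂ P = residualEntropy c.enc₂ (blockKernel K₁₂ n) / Real.log 2 := by
  rw [Code.equivocation₂, condEntropy_eq_sum_massEntropy (c.jointLaw_nonneg P)]
  simp only [Code.law_message₂_output₁]
  have h : Observes (fun x₂ x₁ => blockChannel P.marginal₁ n x₁ x₂) (blockKernel K₁₂ n) :=
    hP.observes₁₂.block n
  rw [h.sum_massEntropy_uniformJoint hM₁ c.enc₁_stochastic]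

/-- Fano's inequality applies to the full output seen by the decoder, whose equivocation equals that
of the observed part alone. -/
theorem residualEntropy_le_of_error {A A' B O : Type*} [Fintype A] [Fintype A'] [Fintype B]
    [Fintype O] {M M' : ℕ} {W : A → A' → B → ℝ} {K : A → O → ℝ} (h : Observes W K)
    (hW : ∀ x x' y, 0 ≤ W x x' y)
    (hK : IsStochastic K) (hM : 0 < M) (hM' : 0 < M') {enc : Fin M → A → ℝ}
    {enc' : Fin M' → A' → ℝ} (henc : IsStochastic enc) (henc' : IsStochastic enc')
    (dec : B → Fin M) {ε : ℝ} (hε : 0 < ε) (hε1 : ε < 1)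
    (herr : (∑ w, ∑ y, if dec y ≠ w then uniformJoint enc enc' W w y else 0) ≤ ε) :
    residualEntropy enc K ≤ -Real.log (1 - ε) + Real.negMulLog ε + ε * Real.log M := by
  rw [← h.sum_massEntropy_uniformJoint hM' henc' enc]
  refine sum_massEntropy_le_of_error (fun w y => ?_) (h.sum_uniformJoint hK hM hM' henc henc') dec
    hε hε1 herr
  exact mul_nonneg (by positivity) (Finset.sum_nonneg fun x _ => Finset.sum_nonneg fun x' _ =>
    mul_nonneg (mul_nonneg ((henc w).1 x) (Finset.sum_nonneg fun w' _ =>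
      mul_nonneg (by positivity) ((henc' w').1 x'))) (hW x x' y))

theorem Achievable.nonempty {R : ℝ × ℝ} (h : P.Achievable R) : Nonempty X₁ ∧ Nonempty X₂ := by
  obtain ⟨n, M₁, M₂, c, hn, hM₁, hM₂, -⟩ := h.2.2 1 one_pos
  have hM₁' : 0 < M₁ := by
    exact_mod_cast (Real.rpow_pos_of_pos two_pos _).trans_le hM₁
  have hM₂' : 0 < M₂ := by
    exact_mod_cast (Real.rpow_pos_of_pos two_pos _).trans_le hM₂
  constructor
  · by_contra hX
    rw [not_nonempty_iff] at hX
    have : IsEmpty (Fin n → X₁) := ⟨fun f => hX.false (f ⟨0, hn⟩)⟩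
    simpa using (c.enc₁_stochastic ⟨0, hM₁'⟩).2
  · by_contra hX
    rw [not_nonempty_iff] at hX
    have : IsEmpty (Fin n → X₂) := ⟨fun f => hX.false (f ⟨0, hn⟩)⟩
    simpa using (c.enc₂_stochastic ⟨0, hM₂'⟩).2

theorem mul_log_two_sub_le {n R r ε : ℝ} (h : n * R - r / Real.log 2 ≤ n * ε) (hn : 0 ≤ n)
    (hε : 0 ≤ ε) : n * (R * Real.log 2) - r ≤ n * ε := by
  have hlog2 : 0 < Real.log 2 := Real.log_pos one_lt_two
  have hlog2' : Real.log 2 ≤ 1 := (Real.log_two_lt_d9.trans (by norm_num)).le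
  have h1 := mul_le_mul_of_nonneg_right h hlog2.le
  rw [sub_mul, div_mul_cancel₀ _ hlog2.ne'] at h1
  have h2 : n * ε * Real.log 2 ≤ n * ε := mul_le_of_le_one_right (mul_nonneg hn hε) hlog2'
  linarith

theorem Achievable.mem_of_isGapBound [Nonempty X₁] [Nonempty X₂]
    (hP : P.Separable K₁₁ K₁₂ K₂₁ K₂₂) {C₁ C₂ : ℝ} (hC₁ : IsGapBound K₁₁ K₂₁ C₁)
    (hC₂ : IsGapBound K₂₂ K₁₂ C₂) {R : ℝ × ℝ} (h : P.Achievable R) :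
    R ∈ Set.Icc 0 (C₁ / Real.log 2) ×ˢ Set.Icc 0 (C₂ / Real.log 2) := by
  have hlog2 : 0 < Real.log 2 := Real.log_pos one_lt_two
  obtain ⟨hR₁, hR₂, h⟩ := h
  have hmarg₁ : ∀ n x₁ x₂ y, 0 ≤ blockChannel P.marginal₁ n x₁ x₂ y := fun n x₁ x₂ y =>
    Finset.prod_nonneg fun i _ => Finset.sum_nonneg fun _ _ => (P.prob_mem _ _).1 _
  have hmarg₂ : ∀ n x₁ x₂ y, 0 ≤ blockChannel P.marginal₂ n x₁ x₂ y := fun n x₁ x₂ y =>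
    Finset.prod_nonneg fun i _ => Finset.sum_nonneg fun _ _ => (P.prob_mem _ _).1 _
  refine ⟨⟨hR₁, (le_div_iff₀ hlog2).2 ?_⟩, ⟨hR₂, (le_div_iff₀ hlog2).2 ?_⟩⟩
  -- The rate enters through the secrecy condition, which bounds it by the normalised equivocation
  -- at the other receiver up to `ε`; the size of the message set serves for positivity.
  · refine rate_le_of_isGapBound hC₁ hP.stochastic₁₁ hP.stochastic₂₁ fun ε hε hε1 => ?_
    obtain ⟨n, M₁, M₂, c, hn, hM₁, hM₂, herr, heq, -⟩ := h ε hε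
    have hM₁' : 0 < M₁ := by exact_mod_cast (Real.rpow_pos_of_pos two_pos _).trans_le hM₁
    have hM₂' : 0 < M₂ := by exact_mod_cast (Real.rpow_pos_of_pos two_pos _).trans_le hM₂
    rw [hP.equivocation₁_eq hM₂'] at heq
    refine ⟨n, M₁, c.enc₁, hn, hM₁', c.enc₁_stochastic, ?_,
      mul_log_two_sub_le heq (Nat.cast_nonneg n) hε.le⟩
    have herr₁ := (le_max_left _ _).trans herr
    rw [c.errorProb₁_eq] at herr₁
    exact residualEntropy_le_of_error (hP.observes₁₁.block n) (hmarg₁ n)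
      (isStochastic_blockKernel hP.stochastic₁₁ n) hM₁' hM₂' c.enc₁_stochastic c.enc₂_stochastic
      c.dec₁ hε hε1 herr₁
  · refine rate_le_of_isGapBound hC₂ hP.stochastic₂₂ hP.stochastic₁₂ fun ε hε hε1 => ?_
    obtain ⟨n, M₁, M₂, c, hn, hM₁, hM₂, herr, -, heq⟩ := h ε hε
    have hM₁' : 0 < M₁ := by exact_mod_cast (Real.rpow_pos_of_pos two_pos _).trans_le hM₁
    have hM₂' : 0 < M₂ := by exact_mod_cast (Real.rpow_pos_of_pos two_pos _).trans_le hM₂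
    rw [hP.equivocation₂_eq hM₁'] at heq
    refine ⟨n, M₂, c.enc₂, hn, hM₂', c.enc₂_stochastic, ?_,
      mul_log_two_sub_le heq (Nat.cast_nonneg n) hε.le⟩
    have herr₂ := (le_max_right _ _).trans herr
    rw [c.errorProb₂_eq] at herr₂
    exact residualEntropy_le_of_error (hP.observes₂₂.block n) (fun x₂ x₁ => hmarg₂ n x₁ x₂)
      (isStochastic_blockKernel hP.stochastic₂₂ n) hM₂' hM₁' c.enc₂_stochastic c.enc₁_stochastic
      c.dec₂ hε hε1 herr₂

/-- Codes for one user at rates (in bits) below the information gap, or zero. -/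
theorem eventually_exists_user_code {V X Z Z' : Type*} [Fintype V] [Fintype X] [Nonempty X]
    [Fintype Z] [Fintype Z'] {K : X → Z → ℝ} {K' : X → Z' → ℝ} (hK : IsStochastic K)
    (hK' : IsStochastic K') {p : V → ℝ} (hp : p ∈ stdSimplex ℝ V) {ρ : V → X → ℝ}
    (hρ : IsStochastic ρ) {R : ℝ} (hR0 : 0 ≤ R)
    (hR : R < secrecyGap K K' (fun v x => p v * ρ v x) / Real.log 2 ∨ R = 0) {ε : ℝ} (hε : 0 < ε) :
    ∀ᶠ n : ℕ in Filter.atTop, ∃ (M : ℕ) (enc : Fin M → (Fin n → X) → ℝ)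
      (dec : (Fin n → Z) → Fin M), 0 < M ∧ IsStochastic enc ∧ (2 : ℝ) ^ ((n : ℝ) * R) ≤ M ∧
      (∑ w, ∑ y, if dec y ≠ w then 1 / (M : ℝ) * pushMass (enc w) (blockKernel K n) y else 0) ≤ ε ∧
      n * R - residualEntropy enc (blockKernel K' n) / Real.log 2 ≤ n * ε := by
  have hlog2 : 0 < Real.log 2 := Real.log_pos one_lt_two
  have hlog2' : Real.log 2 ≤ 1 := (Real.log_two_lt_d9.trans (by norm_num)).le
  rcases hR with hR | rfl
  · rw [lt_div_iff₀ hlog2] at hR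
    -- A leakage of `ε * log 2` nats is `ε` bits, which is at most `n * ε` because `n ≥ 1`.
    filter_upwards [eventually_exists_secret_code hK hK' hp hρ (mul_nonneg hR0 hlog2.le) hR
      (mul_pos hε hlog2), Filter.eventually_ge_atTop 1] with n hn hn1
    obtain ⟨M, enc, dec, hM, henc, hMR, herr, hleak⟩ := hn
    have hn1' : (1 : ℝ) ≤ n := by exact_mod_cast hn1
    refine ⟨M, enc, dec, hM, henc, ?_, herr.trans (mul_le_of_le_one_right hε.le hlog2'), ?_⟩
    · rw [Real.rpow_def_of_pos two_pos]
      convert hMR using 2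
      ring
    · have h1 := Real.log_le_log (Real.exp_pos _) hMR
      rw [Real.log_exp] at h1
      have h2 : n * R - residualEntropy enc (blockKernel K' n) / Real.log 2 =
          (n * (R * Real.log 2) - residualEntropy enc (blockKernel K' n)) / Real.log 2 := by
        field_simp
      rw [h2, div_le_iff₀ hlog2]
      have h3 : ε * Real.log 2 ≤ n * (ε * Real.log 2) :=
        le_mul_of_one_le_left (mul_pos hε hlog2).le hn1'
      linarith
  · refine Filter.Eventually.of_forall fun n => ?_
    obtain ⟨enc, dec, henc, herr, hres⟩ := exists_trivial_code K K' n
    refine ⟨1, enc, dec, one_pos, henc, by simp, ?_, ?_⟩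
    · exact herr.trans_le hε.le
    · rw [hres]
      simp only [mul_zero, zero_div, sub_zero]
      positivity

/-- The two codes are built independently for the single-user channels. They exist at all large
lengths, so a common one can be taken, and each decoder looks only at its observed part of the
output. -/
theorem achievable_of_lt_gap [Nonempty X₁] [Nonempty X₂] (hP : P.Separable K₁₁ K₁₂ K₂₁ K₂₂)
    {V₁ V₂ : Type*} [Fintype V₁] [Fintype V₂] {p₁ : V₁ → ℝ} {p₂ : V₂ → ℝ} {ρ₁ : V₁ → X₁ → ℝ}
    {ρ₂ : V₂ → X₂ → ℝ} (hp₁ : p₁ ∈ stdSimplex ℝ V₁) (hp₂ : p₂ ∈ stdSimplex ℝ V₂)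
    (hρ₁ : IsStochastic ρ₁) (hρ₂ : IsStochastic ρ₂) {R : ℝ × ℝ} (hR₁ : 0 ≤ R.1) (hR₂ : 0 ≤ R.2)
    (hR₁' : R.1 < secrecyGap K₁₁ K₂₁ (fun v x => p₁ v * ρ₁ v x) / Real.log 2 ∨ R.1 = 0)
    (hR₂' : R.2 < secrecyGap K₂₂ K₁₂ (fun v x => p₂ v * ρ₂ v x) / Real.log 2 ∨ R.2 = 0) :
    P.Achievable R := by
  refine ⟨hR₁, hR₂, fun ε hε => ?_⟩
  obtain ⟨n, ⟨M₁, enc₁, dec₁, hM₁, henc₁, hMR₁, herr₁, hleak₁⟩,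
    ⟨M₂, enc₂, dec₂, hM₂, henc₂, hMR₂, herr₂, hleak₂⟩, hn⟩ :=
    ((eventually_exists_user_code hP.stochastic₁₁ hP.stochastic₂₁ hp₁ hρ₁ hR₁ hR₁' hε).and
      ((eventually_exists_user_code hP.stochastic₂₂ hP.stochastic₁₂ hp₂ hρ₂ hR₂ hR₂' hε).and
        (Filter.eventually_ge_atTop 1))).exists
  obtain ⟨d₁, hd₁⟩ := (hP.observes₁₁.block n).exists_decoder hM₂ henc₂ enc₁ dec₁
  have hobs : Observes (fun x₂ x₁ => blockChannel P.marginal₂ n x₁ x₂) (blockKernel K₂₂ n) :=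
    hP.observes₂₂.block n
  obtain ⟨d₂, hd₂⟩ := hobs.exists_decoder hM₁ henc₁ enc₂ dec₂
  let c : Code X₁ X₂ Y₁ Y₂ M₁ M₂ n := ⟨enc₁, enc₂, henc₁, henc₂, d₁, d₂⟩
  refine ⟨n, M₁, M₂, c, hn, hMR₁, hMR₂, max_le ?_ ?_, ?_, ?_⟩
  · rw [c.errorProb₁_eq]
    exact hd₁.trans_le herr₁
  · rw [c.errorProb₂_eq]
    exact hd₂.trans_le herr₂
  · rw [hP.equivocation₁_eq hM₂]
    exact hleak₁
  · rw [hP.equivocation₂_eq hM₁]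
    exact hleak₂

theorem subset_capacityRegion [Nonempty X₁] [Nonempty X₂] (hP : P.Separable K₁₁ K₁₂ K₂₁ K₂₂)
    {V₁ V₂ : Type*} [Fintype V₁] [Fintype V₂] {p₁ : V₁ → ℝ} {p₂ : V₂ → ℝ} {ρ₁ : V₁ → X₁ → ℝ}
    {ρ₂ : V₂ → X₂ → ℝ} (hp₁ : p₁ ∈ stdSimplex ℝ V₁) (hp₂ : p₂ ∈ stdSimplex ℝ V₂)
    (hρ₁ : IsStochastic ρ₁) (hρ₂ : IsStochastic ρ₂) :
    Set.Icc 0 (secrecyGap K₁₁ K₂₁ (fun v x => p₁ v * ρ₁ v x) / Real.log 2) ×ˢ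
      Set.Icc 0 (secrecyGap K₂₂ K₁₂ (fun v x => p₂ v * ρ₂ v x) / Real.log 2) ⊆
      P.capacityRegion := by
  rintro ⟨R₁, R₂⟩ ⟨⟨hR₁, hR₁'⟩, ⟨hR₂, hR₂'⟩⟩
  -- Scaling towards the origin makes a positive rate strictly smaller than the gap. A zero rate
  -- stays zero, and since the gap itself may vanish it is served by the one-message code.
  have hshrink : ∀ {θ R C : ℝ}, 0 < θ → θ < 1 → 0 ≤ R → R ≤ C → θ * R < C ∨ θ * R = 0 := by
    intro θ R C hθ hθ1 hR hRC
    rcases hR.eq_or_lt with h | h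
    · exact Or.inr (by rw [← h, mul_zero])
    · exact Or.inl ((mul_lt_of_lt_one_left h hθ1).trans_le hRC)
  have ht : Filter.Tendsto (fun θ : ℝ => (θ * R₁, θ * R₂)) (nhdsWithin 1 (Set.Iio 1))
      (nhds (R₁, R₂)) := by
    have hc : Continuous fun θ : ℝ => (θ * R₁, θ * R₂) := by fun_prop
    simpa using (hc.tendsto 1).mono_left nhdsWithin_le_nhds
  refine mem_closure_of_tendsto ht ?_
  filter_upwards [Ioo_mem_nhdsLT (zero_lt_one (α := ℝ))] with θ hθ
  exact achievable_of_lt_gap hP hp₁ hp₂ hρ₁ hρ₂ (mul_nonneg hθ.1.le hR₁) (mul_nonneg hθ.1.le hR₂)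
    (hshrink hθ.1 hθ.2 hR₁ hR₁') (hshrink hθ.1 hθ.2 hR₂ hR₂')

theorem capacityRegion_subset [Nonempty X₁] [Nonempty X₂]
    (hP : P.Separable K₁₁ K₁₂ K₂₁ K₂₂) {C₁ C₂ : ℝ} (hC₁ : IsGapBound K₁₁ K₂₁ C₁)
    (hC₂ : IsGapBound K₂₂ K₁₂ C₂) :
    P.capacityRegion ⊆ Set.Icc 0 (C₁ / Real.log 2) ×ˢ Set.Icc 0 (C₂ / Real.log 2) :=
  closure_minimal (fun _ hR => Achievable.mem_of_isGapBound hP hC₁ hC₂ hR)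
    (isClosed_Icc.prod isClosed_Icc)

theorem nonempty_of_mem_stdSimplex {α : Type*} [Fintype α] {f : α → ℝ} (hf : f ∈ stdSimplex ℝ α) :
    Nonempty α := by
  by_contra hα
  rw [not_nonempty_iff] at hα
  simpa using hf.2

theorem OuterClass.nonempty {U V₁ V₂ : Type*} [Fintype U] [Fintype V₁] [Fintype V₂]
    {q : U × V₁ × V₂ × X₁ × X₂ × Y₁ × Y₂ → ℝ} (h : P.OuterClass q) : Nonempty X₁ ∧ Nonempty X₂ := by
  obtain ⟨pU, kV, k₁, k₂, hpU, hkV, hk₁, hk₂, -⟩ := h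
  obtain ⟨u⟩ := nonempty_of_mem_stdSimplex hpU
  obtain ⟨v⟩ := nonempty_of_mem_stdSimplex (hkV u)
  exact ⟨nonempty_of_mem_stdSimplex (hk₁ v.1), nonempty_of_mem_stdSimplex (hk₂ v.2)⟩

/-- The secrecy capacity region of a separable channel is a rectangle, attained by both bounds. -/
theorem Separable.regions_eq (hP : P.Separable K₁₁ K₁₂ K₂₁ K₂₂) :
    P.capacityRegion = P.innerRegion ∧ P.outerRegion = P.innerRegion := by
  by_cases hX : Nonempty X₁ ∧ Nonempty X₂
  · obtain ⟨h₁, h₂⟩ := hX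
    obtain ⟨b, p₁, ρ₁, hp₁, hρ₁, hC₁⟩ := exists_isGapBound_secrecyGap K₁₁ K₂₁
    obtain ⟨c, p₂, ρ₂, hp₂, hρ₂, hC₂⟩ := exists_isGapBound_secrecyGap K₂₂ K₁₂
    have hrect := subset_innerRegion hP hp₁ hp₂ hρ₁ hρ₂
    have hin := innerRegion_subset_outerRegion hP
    have hout := outerRegion_subset hP hC₁ hC₂
    exact ⟨((capacityRegion_subset hP hC₁ hC₂).trans hrect).antisymm
      ((hin.trans hout).trans (subset_capacityRegion hP hp₁ hp₂ hρ₁ hρ₂)),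
      (hout.trans hrect).antisymm hin⟩
  -- An empty input alphabet admits neither a stochastic kernel into it nor an encoder of positive
  -- length.
  · have h₁ : P.outerRegion = ∅ :=
      Set.eq_empty_of_forall_notMem fun R ⟨_, _, _, _, h, _⟩ => hX h.nonempty
    have h₂ : P.innerRegion = ∅ :=
      Set.eq_empty_of_forall_notMem fun R ⟨_, _, _, _, h, _⟩ => hX h.outerClass.nonempty
    have h₃ : {R | P.Achievable R} = ∅ :=
      Set.eq_empty_of_forall_notMem fun R h => hX (Achievable.nonempty h)
    rw [capacityRegion, h₁, h₂, h₃, closure_empty]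
    exact ⟨rfl, rfl⟩

end InterferenceChannel

/-- A switch channel is separable, each transmitter being observed through an erasure channel. -/
theorem SwitchChannel.separable {X₁ X₂ Z₁ Z₂ : Type*} [Fintype Z₁] [Fintype Z₂]
    (P : SwitchChannel X₁ X₂ Z₁ Z₂) :
    P.toInterferenceChannel.Separable (erasedKernel P.τ₁ P.link₁₁)
      (erasedKernel (1 - P.τ₁) P.link₁₂) (erasedKernel (1 - P.τ₂) P.link₂₁)
      (erasedKernel P.τ₂ P.link₂₂) where
  stochastic₁₁ := isStochastic_erasedKernel P.τ₁_mem P.link₁₁_stochastic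
  stochastic₁₂ := isStochastic_erasedKernel
    ⟨sub_nonneg.2 P.τ₁_mem.2, sub_le_self 1 P.τ₁_mem.1⟩ P.link₁₂_stochastic
  stochastic₂₁ := isStochastic_erasedKernel
    ⟨sub_nonneg.2 P.τ₂_mem.2, sub_le_self 1 P.τ₂_mem.1⟩ P.link₂₁_stochastic
  stochastic₂₂ := isStochastic_erasedKernel P.τ₂_mem P.link₂₂_stochastic
  observes₁₁ := observes_erasedKernel P.link₁₂_stochastic 0 P.output₁
  observes₁₂ := observes_erasedKernel P.link₁₁_stochastic 1 fun x₂ x₁ z s =>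
    (P.output₁ x₁ x₂ z s).trans (by fin_cases s <;> simp)
  observes₂₁ := observes_erasedKernel P.link₂₂_stochastic 0 fun x₁ x₂ z s =>
    (P.output₂ x₁ x₂ z s).trans (by fin_cases s <;> simp)
  observes₂₂ := observes_erasedKernel P.link₂₁_stochastic 1 fun x₂ x₁ z s =>
    (P.output₂ x₁ x₂ z s).trans (by fin_cases s <;> simp)

/-- The secrecy capacity region of the switch channel is the inner-bound region, and the outer-bound
and inner-bound regions coincide. -/
theorem theorem5 {X₁ X₂ Z₁ Z₂ : Type*} [Fintype X₁] [Fintype X₂] [Fintype Z₁] [Fintype Z₂]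
    (P : SwitchChannel X₁ X₂ Z₁ Z₂) :
    P.toInterferenceChannel.capacityRegion = P.toInterferenceChannel.innerRegion ∧
    P.toInterferenceChannel.outerRegion = P.toInterferenceChannel.innerRegion :=
  P.separable.regions_eq
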